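/- **Setting.** All registers consist of qubits. Let $n\le 2^a$; labels $i\in\{0,\dots,n-1\}$ are written in binary on $a$ qubits. A quantum probability oracle for a probability distribution $p=(p_i)$ on $n$ points is a unitary $O_p$ on registers $A$ ($a$ qubits) and $B$ ($b$ qubits) with $O_p|0\rangle=\sum_i\sqrt{p_i}\,|i\rangle_A|\psi_i\rangle_B$ for some orthonormal states $|\psi_i\rangle$. An oracle circuit is a sequence of one-qubit unitaries and queries to the oracle $O_p$ or its inverse $O_p^\dagger$, each possibly controlled on further qubits; the circuit is fixed independently of the oracle that it is run with. Every query to $O_p$ or $O_p^\dagger$ counts as one query, and a gate or query with $c$ controls has gate cost $1+c$. Let $\varphi_j=2^{-j}$ and $0<\varepsilon\le 1$. A *separation circuit* $W_j$ is an oracle circuit on a qubit $C_j$, a qubit $P_j$ and a register $I_j$ of $a+b+a$ qubits, together with functions $\beta_j,\beta'_j:\mathbb R\to\mathbb R$ satisfying $\beta_j(x)^2+\beta'_j(x)^2=1$ for $0\le x\le1$, $\beta_j(x)^2\le\varepsilon^2$ for $0\le x\le\varphi_j$ and $\beta_j(x)^2\ge1-\varepsilon^2$ for $2\varphi_j\le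 x\le1$, such that for every $p$, every oracle $O_p$ and every $i$ $$W_j|0\rangle_{C_j}|0\rangle_{P_j}|0,0,i\rangle_{I_j}=\beta'_j(\sqrt{p_i})|0\rangle_{C_j}|\gamma\rangle_{P_j,I_j}+\beta_j(\sqrt{p_i})|1\rangle_{C_j}|+\rangle_{P_j}|0,0,i\rangle_{I_j}$$ for some unit vector $|\gamma\rangle$ (depending on $j$, $i$ and the oracle). Given $W_1,\dots,W_m$, let $$|\Psi_k\rangle=\Big(\prod_{j=1}^k C_jW_j\,C_jT_j\Big)|0\rangle_C|0\rangle_P|0\rangle_I\,O_p|0\rangle_{AB}$$ (the factor $j=1$ acts first), where $T_j$ adds the label in $A$ bitwise to the last $a$ qubits of $I_j$, and the prefix $C_j$ means that the operator is applied if $C_1,\dots,C_{j-1}$ are all $0$, and the identity otherwise. Put $B_k(x)=\beta'_1(x)\cdots\beta'_{k-1}(x)\beta_k(x)$ and $\mathrm{Sum}(k)=\sum_i p_iB_k(\sqrt{p_i})^2$, and let $|\phi_k\rangle$ be $1/\sqrt{\mathrm{Sum}(k)}$ times the component of $|\Psi_k\rangle$ with $C_k=1$. **Theorem.** There are absolute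 constants $K_0>0$ and $d\in\mathbb N$ such that the following holds for all $n,a,b,m$ with $n\le2^a$ and all $0<\varepsilon\le1$. 1. There are separation circuits $W_1,\dots,W_m$ such that $W_j$ makes at most $K_0\,2^j\log(2/\varepsilon)$ queries and has gate cost at most $K_0(a+b+1)^d\,2^j\log(2/\varepsilon)$. 2. Let $K,G\ge1$ and let $W_1,\dots,W_m$ be any separation circuits such that $W_j$ makes at most $K\,2^j\log(2/\varepsilon)$ queries and has gate cost at most $G\,2^j\log(2/\varepsilon)$. Then for all $1\le k\le m$, $0<\delta\le1$ and $0<s\le1$ there is an oracle circuit $V$, acting on all the registers and one ancilla qubit, which makes at most $$K_0K\,\log\tfrac2\varepsilon\,\log\tfrac2\delta\,\frac{2^k}{\sqrt s}$$ queries to $O_p,O_p^\dagger$ and has gate cost at most $K_0G(a+b+m+1)^d\log\frac2\varepsilon\log\frac2\delta\,\frac{2^k}{\sqrt s}$, such that for every $p$ and every oracle $O_p$ with $\mathrm{Sum}(k)\ge s$ (in particular when $s=\mathrm{Sum}(k)$): $$|\phi_k\rangle=|0\cdots010\cdots0\rangle_C\sum_i\frac{\sqrt{p_i}B_k(\sqrt{p_i})}{\sqrt{\mathrm{Sum}(k)}}|i\rangle_A|\psi_i\rangle_B|g_i\rangle_{P,I}$$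 for some unit vectors $|g_i\rangle$, the only $1$ in register $C$ being at $C_k$; and $$V|0\rangle=|\phi'\rangle|0\rangle,\qquad|\langle\phi'|\phi_k\rangle|^2\ge1-\delta^2$$ for some $|\phi'\rangle$, where the last factor $|0\rangle$ is the ancilla. -/

import Mathlib

open scoped Matrix

noncomputable section

namespace QEntropy

/-! ## Qubits, states and operators -/

/-- A (not necessarily normalized) state vector of a system whose qubits are labelled by `Q`;
the computational basis is `Q → Bool`. -/
abbrev Ket (Q : Type) : Type := (Q → Bool) → ℂ

/-- Operators on the qubits labelled by `Q`, as matrices in the computational basis. -/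
abbrev Op (Q : Type) : Type := Matrix (Q → Bool) (Q → Bool) ℂ

/-- The computational basis vector `|x⟩`. -/
def ket {Q : Type} [DecidableEq Q] [Fintype Q] (x : Q → Bool) : Ket Q := Pi.single x 1

/-- The all-zero basis vector `|0…0⟩`. -/
def ket0 (Q : Type) [DecidableEq Q] [Fintype Q] : Ket Q := ket (fun _ => false)

/-- The state vector has Euclidean norm one. -/
def Normalized {Q : Type} [DecidableEq Q] [Fintype Q] (v : Ket Q) : Prop :=
  ∑ x, ‖v x‖ ^ 2 = 1

open Classical in
/-- `M` applied to the qubits `e r` (`r : R`), and the identity on all other qubits. -/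
def place {R Q : Type} (e : R ↪ Q) (M : Op R) : Op Q :=
  Matrix.of fun x y =>
    if ∀ q, q ∉ Set.range e → x q = y q then M (x ∘ e) (y ∘ e) else 0

open Classical in
/-- `M` on the basis vectors that satisfy the control condition `P`, the identity on the others
(only used with conditions on qubits on which `M` acts trivially). -/
def controlled {Q : Type} (P : (Q → Bool) → Prop) (M : Op Q) : Op Q :=
  Matrix.of fun x y => if P y then M x y else if x = y then 1 else 0

/-- A one-qubit operator on the qubit `t`. -/
def oneQubit {Q : Type} (t : Q) (u : Matrix Bool Bool ℂ) : Op Q :=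
  place (⟨fun _ : Unit => t, fun _ _ _ => rfl⟩ : Unit ↪ Q)
    (u.submatrix (fun x => x ()) (fun x => x ()))

/-! ## Oracle circuits -/

/-- One step of a circuit on the qubits `Q` with access to an oracle acting on qubits `R`:
a one-qubit unitary, or a query to the oracle or to its inverse (if `inv = true`) placed on
chosen qubits; both possibly controlled on a set `S` of further qubits all being `1`.
The step does not depend on the oracle. -/
inductive Step (R Q : Type) : Type
  | gate (S : Finset Q) (t : Q) (ht : t ∉ S) (u : Matrix.unitaryGroup Bool ℂ) : Step R Q
  | query (S : Finset Q) (e : R ↪ Q) (he : ∀ r, e r ∉ S) (inv : Bool) : Step R Q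

/-- The operator of a step when the oracle is `O`. -/
def Step.op {R Q : Type} (O : Op R) : Step R Q → Op Q
  | .gate S t _ u => controlled (fun y => ∀ c ∈ S, y c = true) (oneQubit t u.1)
  | .query S e _ inv =>
      controlled (fun y => ∀ c ∈ S, y c = true) (place e (if inv then Oᴴ else O))

/-- The number of oracle queries of a step. -/
def Step.queries {R Q : Type} : Step R Q → ℕ
  | .gate _ _ _ _ => 0
  | .query _ _ _ _ => 1

/-- The gate cost of a step: a gate or query with `c` controls costs `1 + c`. -/
def Step.size {R Q : Type} : Step R Q → ℕ
  | .gate S _ _ _ => 1 + S.card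
  | .query S _ _ _ => 1 + S.card

/-- An oracle circuit, as the list of its steps in the order in which they are applied. -/
abbrev Circuit (R Q : Type) : Type := List (Step R Q)

/-- The operator computed by a circuit when the oracle is `O`. -/
def Circuit.op {R Q : Type} [DecidableEq Q] [Fintype Q] (O : Op R) : Circuit R Q → Op Q
  | [] => 1
  | s :: c => Circuit.op O c * s.op O

/-- The number of queries (to the oracle or its inverse) made by a circuit. -/
def Circuit.queries {R Q : Type} (c : Circuit R Q) : ℕ := (c.map Step.queries).sum

/-- The total gate cost of a circuit. -/
def Circuit.size {R Q : Type} (c : Circuit R Q) : ℕ := (c.map Step.size).sum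

/-! ## Quantum probability oracles -/

/-- The qubits on which the oracle acts: registers `A` (`a` qubits) and `B` (`b` qubits). -/
abbrev OReg (a b : ℕ) : Type := Fin a ⊕ Fin b

/-- The label `i` written in binary on `a` qubits. -/
def enc (a : ℕ) {n : ℕ} (i : Fin n) : Fin a → Bool := fun t => (i : ℕ).testBit t

/-- `O` is a quantum probability oracle for the distribution `p`: a unitary with
`O |0⟩ = ∑ i, √(p i) |i⟩_A |ψ i⟩_B`, where the states `ψ i` are orthonormal. -/
structure IsOracle {n a b : ℕ} (p : Fin n → ℝ) (ψ : Fin n → Ket (Fin b)) (O : Op (OReg a b)) :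
    Prop where
  nonneg : ∀ i, 0 ≤ p i
  sum_eq_one : ∑ i, p i = 1
  orthonormal : ∀ i j, star (ψ i) ⬝ᵥ ψ j = if i = j then 1 else 0
  unitary : O ∈ Matrix.unitaryGroup (OReg a b → Bool) ℂ
  apply_zero : O *ᵥ ket0 (OReg a b) = fun x =>
    ∑ i, (√(p i) : ℂ) * (ket (enc a i) (x ∘ Sum.inl) * ψ i (x ∘ Sum.inr))

/-! ## Singular value separation -/

/-- The qubits of a pair `(P_j, I_j)`: the single qubit `P_j`, and `I_j`, which consists of a copy
of the registers `A`, `B` of the oracle and a further register of `a` qubits for a label. -/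
abbrev PIReg (a b : ℕ) : Type := Unit ⊕ (OReg a b ⊕ Fin a)

/-- The qubits of a triple `(C_j, P_j, I_j)`; `none` is the single qubit `C_j`. -/
abbrev Loc (a b : ℕ) : Type := Option (PIReg a b)

/-- The vector `|c⟩_C ⊗ |v⟩_{P,I}`. -/
def locKet {a b : ℕ} (c : Bool) (v : Ket (PIReg a b)) : Ket (Loc a b) :=
  fun x => if x none = c then v (fun q => x (some q)) else 0

/-- The vector `|u⟩_P ⊗ (|0⟩|0⟩|i⟩)_I`, where `u` is a one-qubit vector. -/
def piKet {n a b : ℕ} (u : Bool → ℂ) (i : Fin n) : Ket (PIReg a b) :=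
  fun x => u (x (Sum.inl ())) * (ket0 (OReg a b) (fun r => x (Sum.inr (Sum.inl r))) *
    ket (enc a i) (fun t => x (Sum.inr (Sum.inr t))))

/-- The one-qubit vector `|0⟩`. -/
def qzero : Bool → ℂ := fun c => if c then 0 else 1

/-- The one-qubit vector `|+⟩`. -/
def qplus : Bool → ℂ := fun _ => ((√2)⁻¹ : ℝ)

/-- The circuit `W` on `(C, P, I)` is a singular value separation operator with threshold `φ` and
error `ε` and coefficients `β`, `β'`, for every quantum probability oracle of every
distribution on `n` points. -/
structure Separates {a b : ℕ} (n : ℕ) (φ ε : ℝ) (W : Circuit (OReg a b) (Loc a b))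
    (β β' : ℝ → ℝ) : Prop where
  sq_add_sq : ∀ x, 0 ≤ x → x ≤ 1 → β x ^ 2 + β' x ^ 2 = 1
  small : ∀ x, 0 ≤ x → x ≤ φ → β x ^ 2 ≤ ε ^ 2
  large : ∀ x, 2 * φ ≤ x → x ≤ 1 → 1 - ε ^ 2 ≤ β x ^ 2
  apply : ∀ (p : Fin n → ℝ) (ψ : Fin n → Ket (Fin b)) (O : Op (OReg a b)), IsOracle p ψ O →
    ∀ i, ∃ γ : Ket (PIReg a b), Normalized γ ∧
      W.op O *ᵥ locKet false (piKet qzero i) =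
        (β' √(p i) : ℂ) • locKet false γ + (β √(p i) : ℂ) • locKet true (piKet qplus i)

/-- The qubits of the algorithm: the registers `A`, `B` and the `m` triples `(C_j, P_j, I_j)`. -/
abbrev Reg (a b m : ℕ) : Type := OReg a b ⊕ (Fin m × Loc a b)

/-- The qubit `C_j`. -/
def cQubit {a b m : ℕ} (j : Fin m) : Reg a b m := Sum.inr (j, none)

/-- The position of the triple `(C_j, P_j, I_j)` among all qubits. -/
def locEmb {a b m : ℕ} (j : Fin m) : Loc a b ↪ Reg a b m :=
  ⟨fun q => Sum.inr (j, q), fun _ _ h => (Prod.mk.inj (Sum.inr.inj h)).2⟩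

/-- The control condition: the qubits `C_i` with `i < j` are all `0`. -/
def earlierZero {a b m : ℕ} (j : Fin m) (y : Reg a b m → Bool) : Prop :=
  ∀ i < j, y (cQubit i) = false

/-- The controlled separation operator `C_j W`. -/
def CW {a b m : ℕ} (O : Op (OReg a b)) (j : Fin m) (W : Circuit (OReg a b) (Loc a b)) :
    Op (Reg a b m) :=
  controlled (earlierZero j) (place (locEmb j) (W.op O))

/-- The label in register `A` is added bitwise to the last part of `I_j`. -/
def copyLabel {a b m : ℕ} (j : Fin m) (y : Reg a b m → Bool) : Reg a b m → Bool
  | Sum.inr (i, some (Sum.inr (Sum.inr t))) =>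
      if i = j then xor (y (Sum.inr (i, some (Sum.inr (Sum.inr t))))) (y (Sum.inl (Sum.inl t)))
      else y (Sum.inr (i, some (Sum.inr (Sum.inr t))))
  | q => y q

/-- The operator `T_j`, which maps `(|0⟩|0⟩|0⟩)_{I_j} |i⟩_A` to `(|0⟩|0⟩|i⟩)_{I_j} |i⟩_A`. -/
def T {a b m : ℕ} (j : Fin m) : Op (Reg a b m) :=
  Matrix.of fun x y => if x = copyLabel j y then 1 else 0

/-- The controlled operator `C_j T`. -/
def CT {a b m : ℕ} (j : Fin m) : Op (Reg a b m) := controlled (earlierZero j) (T j)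

/-- The state after the first `l` rounds of separation, started from
`|0⟩_C |0⟩_P |0⟩_I (O |0⟩_{AB})`. -/
def stateAfter {a b m : ℕ} (O : Op (OReg a b)) (W : Fin m → Circuit (OReg a b) (Loc a b)) :
    ℕ → Ket (Reg a b m)
  | 0 => place Function.Embedding.inl O *ᵥ ket0 (Reg a b m)
  | l + 1 =>
      if h : l < m then (CW O ⟨l, h⟩ (W ⟨l, h⟩) * CT ⟨l, h⟩) *ᵥ stateAfter O W l
      else stateAfter O W l

/-- The separated state `Ψ_k`, obtained after all rounds up to and including round `k`.
Rounds are numbered from `0`. -/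
def Psi {a b m : ℕ} (O : Op (OReg a b)) (W : Fin m → Circuit (OReg a b) (Loc a b)) (k : Fin m) :
    Ket (Reg a b m) :=
  stateAfter O W (k + 1)

/-- The threshold of round `j` (rounds are numbered from `0`). -/
def thr {m : ℕ} (j : Fin m) : ℝ := 1 / 2 ^ ((j : ℕ) + 1)

/-- The coefficient `B_k(x) = β'_0(x) ⋯ β'_{k-1}(x) β_k(x)`. -/
def coefB {m : ℕ} (β β' : Fin m → ℝ → ℝ) (k : Fin m) (x : ℝ) : ℝ :=
  (∏ j ∈ Finset.Iio k, β' j x) * β k x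

/-- `Sum(k) = ∑ i, p_i B_k(√p_i)²`. -/
def sumB {n m : ℕ} (p : Fin n → ℝ) (β β' : Fin m → ℝ → ℝ) (k : Fin m) : ℝ :=
  ∑ i, p i * coefB β β' k √(p i) ^ 2

/-- The state `φ_k`: the branch `C_k = 1` of `Ψ_k`, divided by `√Sum(k)`. -/
def phi {n a b m : ℕ} (p : Fin n → ℝ) (O : Op (OReg a b))
    (W : Fin m → Circuit (OReg a b) (Loc a b)) (β β' : Fin m → ℝ → ℝ) (k : Fin m) :
    Ket (Reg a b m) :=
  fun x => if x (cQubit k) = true then ((√(sumB p β β' k) : ℝ) : ℂ)⁻¹ * Psi O W k x else 0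

/-- The vector `|0⋯010⋯0⟩_C |i⟩_A |ψ⟩_B |g⟩_{P,I}`, in which exactly `C_k` is `1` among
the qubits of `C`. -/
def branchKet {n a b m : ℕ} (k : Fin m) (i : Fin n) (ψ : Ket (Fin b))
    (g : Ket (Fin m × PIReg a b)) : Ket (Reg a b m) :=
  fun x => (if ∀ j, x (cQubit j) = decide (j = k) then 1 else 0) *
    (ket (enc a i) (fun t => x (Sum.inl (Sum.inl t))) * ψ (fun t => x (Sum.inl (Sum.inr t))) *
      g (fun q => x (Sum.inr (q.1, some q.2))))

/-- The vector `|v⟩|0⟩`, where the second factor is one ancilla qubit, labelled `none`. -/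
def withAncilla {Q : Type} (v : Ket Q) : Ket (Option Q) :=
  fun x => if x none = false then v (fun q => x (some q)) else 0

end QEntropy

end

/-!
# Singular value separation and amplification for quantum probability oracles

Both halves rest on alternating a unitary `U` and its inverse, with phases in between. Let `t` be
the weight of a marked subspace in `U |0⟩`. The alternation stays in a plane, and with suitably
unnormalized basis vectors the two coefficients of the state after `l` steps are polynomials in `t`
(`signal`). They satisfy one polynomial identity, the normalization of the state, and bounds on
their degrees. Conversely, every pair of complex polynomials with this identity and these degrees
comes from some choice of phases (`IsSignalPair.exists_phases`): the identity makes the leading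
coefficients equal in modulus, so that one step can be stripped off and the degrees drop. What
remains is to find polynomials. A real polynomial that is nonnegative on the line is a sum of two
squares, and one that is nonnegative on `[0, 1]` has the Markov–Lukács form; both facts follow from
one induction over the factors (`nonneg_induction`), and they supply the second polynomial of the
pair once the first is prescribed.

*Separation circuits.* Here `U` is the oracle, and the marked states are those whose `A` part agrees
with the label `i`, so that `t = p i`. The circuit uses two phase sequences, complex conjugate to
each other, for the two values of the qubit `P`; in the component along `|+⟩_P` this leaves the real
part `R` of the amplitude, which is an arbitrary real polynomial with `|R| ≤ 1` on `[0, 1]`. For `R`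
the squared Dirichlet kernel `(sin (n θ) / (n sin θ))²`, a polynomial of degree about `2 ^ j` in
`t = sin² θ` which already separates `√t ≤ 2⁻ʲ` from `√t ≥ 2 · 2⁻ʲ` up to constants, is sharpened by
a binomial tail with `O (log (1 / ε))` trials (`exists_separation_phases`, `exists_separates`).

*Extraction.* By induction over the rounds, `Ψ_k` is a superposition, over the labels `i`, of
product states. The branch `C_k = 1` has exactly the announced form, and its squared norm is
`Sum(k)` because different labels give orthogonal states (`restrict_Psi`,
`sum_norm_sq_restrict_Psi`). The circuit that prepares `Ψ_k` costs a geometric sum, dominated by its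
last round. Marking `C_k = 1` and applying the phases to the ancilla, an odd alternation ends with
an overlap of squared modulus `t ‖p(t)‖²` with `φ_k`, where `t = Sum(k)`. A rescaled Chebyshev
polynomial of degree about `log (2 / δ) / √s` makes this at least `1 - δ²` for all `t ∈ [s, 1]`
at once (`exists_amplification_phases`), so `Sum(k)` need not be known.
-/

namespace QEntropy

section Polynomials

open Polynomial

/-! ### Nonnegative real polynomials -/

/-- By continuity, nonnegativity away from one point suffices on a set in the closure of its
interior. -/
theorem eval_nonneg_of_nonneg_off_point {I : Set ℝ} (hI : I ⊆ closure (interior I)) {h : ℝ[X]}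
    (r : ℝ) (hh : ∀ x ∈ I, x ≠ r → 0 ≤ h.eval x) : ∀ x ∈ I, 0 ≤ h.eval x := by
  have hclosed : IsClosed {x : ℝ | 0 ≤ h.eval x} := isClosed_le continuous_const h.continuous
  have hsub : closure (interior I ∩ {r}ᶜ) ⊆ {x : ℝ | 0 ≤ h.eval x} :=
    closure_minimal (fun x hx => hh x (interior_subset hx.1) hx.2) hclosed
  have hcl : closure (interior I) ⊆ closure (interior I ∩ {r}ᶜ) :=
    closure_minimal ((dense_compl_singleton r).open_subset_closure_inter isOpen_interior)
      isClosed_closure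
  exact fun x hx => hsub (hcl (hI hx))

/-- Induction principle for real polynomials that are nonnegative on `I`: they are products of
nonnegative constants, linear factors without sign change in `I`, squares of linear factors, and
quadratic factors without real root. The index of the predicate bounds the degree. -/
theorem nonneg_induction {I : Set ℝ} (hI : I ⊆ closure (interior I)) (hne : I.Nonempty)
    {S : ℕ → ℝ[X] → Prop}
    (hmul : ∀ {n m f g}, S n f → S m g → S (n + m) (f * g))
    (hone : S 1 1) (hconst : ∀ c : ℝ, 0 ≤ c → S 0 (C c))
    (hlin : ∀ r ∉ interior I, ∃ σ : ℝ, σ ≠ 0 ∧ (∀ x ∈ I, 0 ≤ σ * (x - r)) ∧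
      S 1 (C σ * (X - C r)))
    (hsq : ∀ r, S 2 ((X - C r) ^ 2))
    (hquad : ∀ u v : ℝ, v ≠ 0 → S 2 ((X - C u) ^ 2 + C (v ^ 2))) :
    ∀ (N : ℕ) (f : ℝ[X]), f.natDegree ≤ N → (∀ x ∈ I, 0 ≤ f.eval x) → S N f := by
  have hmono : ∀ {n f}, S n f → ∀ k, S (n + k) f := by
    intro n f hf k
    induction k with
    | zero => exact hf
    | succ k ih => simpa [add_assoc] using hmul ih hone
  intro N
  induction N using Nat.strong_induction_on with
  | _ N ih =>
  intro f hdeg hf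
  obtain h0 | hpos := Nat.eq_zero_or_pos f.natDegree
  · rw [eq_C_of_natDegree_eq_zero h0] at hf ⊢
    obtain ⟨x, hx⟩ := hne
    have := hmono (hconst _ (by simpa using hf x hx)) N
    simpa using this
  have hf0 : f ≠ 0 := by rintro rfl; simp at hpos
  by_cases hroot : ∃ r, f.IsRoot r
  · obtain ⟨r, hr⟩ := hroot
    obtain ⟨h, rfl⟩ := dvd_iff_isRoot.2 hr
    have hh0 : h ≠ 0 := right_ne_zero_of_mul hf0
    rw [natDegree_mul (X_sub_C_ne_zero r) hh0, natDegree_X_sub_C] at hdeg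
    by_cases hri : r ∈ interior I
    · -- a root in the interior is a local minimum, hence a double root
      have hmin : IsLocalMin (fun x => ((X - C r) * h).eval x) r := by
        filter_upwards [mem_interior_iff_mem_nhds.1 hri] with x hx
        simpa using hf x hx
      have hd := hmin.deriv_eq_zero
      rw [Polynomial.deriv] at hd
      obtain ⟨k, rfl⟩ := dvd_iff_isRoot.2 (show h.IsRoot r by simpa using hd)
      have hk0 : k ≠ 0 := right_ne_zero_of_mul hh0
      rw [natDegree_mul (X_sub_C_ne_zero r) hk0, natDegree_X_sub_C] at hdeg
      have hk : ∀ x ∈ I, 0 ≤ k.eval x := by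
        refine eval_nonneg_of_nonneg_off_point hI r fun x hx hxr => ?_
        have := hf x hx
        simp only [eval_mul, eval_sub, eval_X, eval_C, ← mul_assoc] at this
        exact nonneg_of_mul_nonneg_right this (mul_self_pos.2 (sub_ne_zero.2 hxr))
      have := hmul (hsq r) (ih (N - 2) (by omega) k (by omega) hk)
      rw [← mul_assoc, ← sq]
      rwa [Nat.add_sub_cancel' (by omega)] at this
    · obtain ⟨σ, hσ, hσI, hS⟩ := hlin r hri
      have hk : ∀ x ∈ I, 0 ≤ (C σ⁻¹ * h).eval x := by
        refine eval_nonneg_of_nonneg_off_point hI r fun x hx hxr => ?_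
        have h1 := hf x hx
        have h2 : 0 < σ * (x - r) :=
          lt_of_le_of_ne (hσI x hx) (mul_ne_zero hσ (sub_ne_zero.2 hxr)).symm
        refine nonneg_of_mul_nonneg_right (a := σ * (x - r)) ?_ h2
        simp only [eval_mul, eval_sub, eval_X, eval_C] at h1 ⊢
        calc 0 ≤ _ := h1
          _ = _ := by field_simp
      have := hmul hS (ih (N - 1) (by omega) (C σ⁻¹ * h)
        (by rw [natDegree_C_mul (inv_ne_zero hσ)]; omega) hk)
      rw [Nat.add_sub_cancel' (by omega)] at this
      convert this using 1
      calc (X - C r) * h = C (σ * σ⁻¹) * ((X - C r) * h) := by simp [hσ]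
        _ = _ := by rw [C_mul]; ring
  · push Not at hroot
    obtain ⟨z, hz⟩ := IsAlgClosed.exists_aeval_eq_zero ℂ f
      (natDegree_pos_iff_degree_pos.1 hpos).ne'
    have him : z.im ≠ 0 := by
      intro h
      refine hroot z.re ?_
      have hzr : z = (z.re : ℂ) := Complex.ext (by simp) (by simpa using h)
      rw [hzr, show (z.re : ℂ) = algebraMap ℝ ℂ z.re from rfl, aeval_algebraMap_apply] at hz
      exact (map_eq_zero (algebraMap ℝ ℂ)).1 hz
    obtain ⟨k, hk⟩ := quadratic_dvd_of_aeval_eq_zero_im_ne_zero f hz him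
    have hq : (X ^ 2 - C (2 * z.re) * X + C (‖z‖ ^ 2) : ℝ[X]) =
        (X - C z.re) ^ 2 + C (z.im ^ 2) := by
      rw [← Complex.normSq_eq_norm_sq, Complex.normSq_apply]
      simp only [C_mul, C_add, C_pow, map_ofNat]
      ring
    rw [hq] at hk
    have hqdeg : ((X - C z.re) ^ 2 + C (z.im ^ 2) : ℝ[X]).natDegree = 2 := by
      rw [natDegree_add_C, natDegree_pow, natDegree_X_sub_C]
    have hq0 : ((X - C z.re) ^ 2 + C (z.im ^ 2) : ℝ[X]) ≠ 0 := by
      intro h; rw [h] at hqdeg; simp at hqdeg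
    have hk0 : k ≠ 0 := by rintro rfl; simp [hk] at hf0
    subst hk
    rw [natDegree_mul hq0 hk0, hqdeg] at hdeg
    have := hmul (hquad z.re z.im him) (ih (N - 2) (by omega) k (by omega) fun x hx => by
      have h1 := hf x hx
      rw [eval_mul] at h1
      refine nonneg_of_mul_nonneg_right h1 ?_
      simp only [eval_add, eval_pow, eval_sub, eval_X, eval_C]
      positivity)
    rwa [Nat.add_sub_cancel' (by omega)] at this

/-- A real polynomial that is nonnegative on `ℝ` is a sum of two squares. -/
theorem exists_sq_add_sq_of_nonneg {k : ℕ} {f : ℝ[X]} (hdeg : f.natDegree ≤ 2 * k)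
    (hf : ∀ x, 0 ≤ f.eval x) :
    ∃ a b : ℝ[X], a.natDegree ≤ k ∧ b.natDegree ≤ k ∧ f = a ^ 2 + b ^ 2 := by
  have key := nonneg_induction (I := Set.univ) (by simp) Set.univ_nonempty
    (S := fun n f => ∃ a b : ℝ[X], 2 * a.natDegree ≤ n ∧ 2 * b.natDegree ≤ n ∧
      f = a ^ 2 + b ^ 2) ?_ ?_ ?_ ?_ ?_ ?_ (2 * k) f hdeg fun x _ => hf x
  · obtain ⟨a, b, ha, hb, h⟩ := key
    exact ⟨a, b, by omega, by omega, h⟩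
  · rintro n m f g ⟨a, b, ha, hb, rfl⟩ ⟨c, d, hc, hd, rfl⟩
    have hm : ∀ {p q : ℝ[X]}, 2 * p.natDegree ≤ n → 2 * q.natDegree ≤ m →
        (p * q).natDegree ≤ (n + m) / 2 := fun {p q} hp hq => by
      have := natDegree_mul_le (p := p) (q := q); omega
    refine ⟨a * c - b * d, a * d + b * c, ?_, ?_, by ring⟩
    · have := natDegree_sub_le_of_le (hm ha hc) (hm hb hd); omega
    · have := natDegree_add_le_of_degree_le (hm ha hd) (hm hb hc); omega
  · exact ⟨1, 0, by simp, by simp, by simp⟩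
  · intro c hc
    exact ⟨C √c, 0, by simp, by simp, by rw [← C_pow, Real.sq_sqrt hc]; simp⟩
  · simp
  · exact fun r => ⟨X - C r, 0, by simp, by simp, by simp⟩
  · exact fun u v _ => ⟨X - C u, C v, by simp, by simp, by simp⟩

/-- The Markov–Lukács form of degree at most `n` of a polynomial on `[0, 1]`: it is
`a² + t (1 - t) b²` for even `n`, and `t a² + (1 - t) b²` for odd `n`. The degree bounds are strict,
so that `b = 0` for `n = 0`. -/
def LukacsForm (n : ℕ) (f : ℝ[X]) : Prop :=
  ∃ a b : ℝ[X], a.degree < ((n / 2 + 1 : ℕ) : WithBot ℕ) ∧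
    b.degree < (((n + 1) / 2 : ℕ) : WithBot ℕ) ∧
    f = if Even n then a ^ 2 + X * (1 - X) * b ^ 2 else X * a ^ 2 + (1 - X) * b ^ 2

theorem degree_mul_lt_of_lt {F : Type*} [Field F] {p q : F[X]} {i j m : ℕ}
    (hp : p.degree < (i : WithBot ℕ)) (hq : q.degree < (j : WithBot ℕ)) (h : i + j ≤ m + 1) :
    (p * q).degree < (m : WithBot ℕ) := by
  by_cases hp0 : p = 0
  · simp [hp0]
  by_cases hq0 : q = 0
  · simp [hq0]
  rw [← natDegree_lt_iff_degree_lt hp0] at hp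
  rw [← natDegree_lt_iff_degree_lt hq0] at hq
  rw [← natDegree_lt_iff_degree_lt (mul_ne_zero hp0 hq0), natDegree_mul hp0 hq0]
  omega

theorem degree_add_lt_of_lt {F : Type*} [Field F] {p q : F[X]} {m : WithBot ℕ}
    (hp : p.degree < m) (hq : q.degree < m) : (p + q).degree < m :=
  (degree_add_le p q).trans_lt (max_lt hp hq)

theorem degree_sub_lt_of_lt {F : Type*} [Field F] {p q : F[X]} {m : WithBot ℕ}
    (hp : p.degree < m) (hq : q.degree < m) : (p - q).degree < m :=
  (degree_sub_le p q).trans_lt (max_lt hp hq)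

theorem degree_X_lt_two {F : Type*} [Field F] : (X : F[X]).degree < ((2 : ℕ) : WithBot ℕ) := by
  rw [degree_X]; norm_num

theorem degree_one_sub_X_lt_two {F : Type*} [Field F] :
    (1 - X : F[X]).degree < ((2 : ℕ) : WithBot ℕ) :=
  degree_sub_lt_of_lt (by rw [degree_one]; norm_num) degree_X_lt_two

theorem LukacsForm.mul_even {n m : ℕ} {f g : ℝ[X]} (hn : Even n) (hf : LukacsForm n f)
    (hg : LukacsForm m g) : LukacsForm (n + m) (f * g) := by
  obtain ⟨a, b, ha, hb, rfl⟩ := hf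
  obtain ⟨c, d, hc, hd, rfl⟩ := hg
  have h1 := degree_one_sub_X_lt_two (F := ℝ)
  have hX := degree_X_lt_two (F := ℝ)
  obtain ⟨k, rfl⟩ := hn
  by_cases hm : Even m
  · obtain ⟨l, rfl⟩ := hm
    refine ⟨a * c - X * (1 - X) * (b * d), a * d + b * c, degree_sub_lt_of_lt ?_ ?_,
      degree_add_lt_of_lt ?_ ?_, ?_⟩
    · exact degree_mul_lt_of_lt ha hc (by omega)
    · rw [← mul_assoc]
      exact degree_mul_lt_of_lt (i := k + 2) (degree_mul_lt_of_lt (i := 3)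
        (degree_mul_lt_of_lt hX h1 (by norm_num)) hb (by omega)) hd (by omega)
    · exact degree_mul_lt_of_lt ha hd (by omega)
    · exact degree_mul_lt_of_lt hb hc (by omega)
    · rw [if_pos ⟨k, rfl⟩, if_pos ⟨l, rfl⟩, if_pos ⟨k + l, by ring⟩]
      ring
  · have hm' : ¬ Even (k + k + m) := by simpa [Nat.even_add] using hm
    rw [Nat.not_even_iff_odd] at hm
    obtain ⟨l, rfl⟩ := hm
    refine ⟨a * c - (1 - X) * (b * d), a * d + X * (b * c), degree_sub_lt_of_lt ?_ ?_,
      degree_add_lt_of_lt ?_ ?_, ?_⟩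
    · exact degree_mul_lt_of_lt ha hc (by omega)
    · exact degree_mul_lt_of_lt h1 (degree_mul_lt_of_lt (m := k + l) hb hd (by omega)) (by omega)
    · exact degree_mul_lt_of_lt ha hd (by omega)
    · exact degree_mul_lt_of_lt hX (degree_mul_lt_of_lt (m := k + l) hb hc (by omega)) (by omega)
    · rw [if_pos ⟨k, rfl⟩, if_neg (by simp), if_neg hm']
      ring

theorem LukacsForm.mul {n m : ℕ} {f g : ℝ[X]} (hf : LukacsForm n f) (hg : LukacsForm m g) :
    LukacsForm (n + m) (f * g) := by
  by_cases hn : Even n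
  · exact hf.mul_even hn hg
  by_cases hm : Even m
  · rw [add_comm, mul_comm]
    exact hg.mul_even hm hf
  have hnm : Even (n + m) := by simp [Nat.even_add, hn, hm]
  obtain ⟨a, b, ha, hb, rfl⟩ := hf
  obtain ⟨c, d, hc, hd, rfl⟩ := hg
  have h1 := degree_one_sub_X_lt_two (F := ℝ)
  have hX := degree_X_lt_two (F := ℝ)
  rw [if_neg hn, if_neg hm]
  rw [Nat.not_even_iff_odd] at hn hm
  obtain ⟨k, rfl⟩ := hn
  obtain ⟨l, rfl⟩ := hm
  refine ⟨X * (a * c) + (1 - X) * (b * d), a * d - b * c, degree_add_lt_of_lt ?_ ?_,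
    degree_sub_lt_of_lt ?_ ?_, ?_⟩
  · exact degree_mul_lt_of_lt hX (degree_mul_lt_of_lt (m := k + l + 1) ha hc (by omega)) (by omega)
  · exact degree_mul_lt_of_lt h1 (degree_mul_lt_of_lt (m := k + l + 1) hb hd (by omega)) (by omega)
  · exact degree_mul_lt_of_lt ha hd (by omega)
  · exact degree_mul_lt_of_lt hb hc (by omega)
  · rw [if_pos hnm]
    ring

theorem degree_C_lt_one {F : Type*} [Field F] (c : F) :
    (C c).degree < ((1 : ℕ) : WithBot ℕ) :=
  degree_C_le.trans_lt (by norm_num)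

/-- The Markov–Lukács theorem on `[0, 1]`. -/
theorem lukacsForm_of_nonneg {n : ℕ} {f : ℝ[X]} (hdeg : f.natDegree ≤ n)
    (hf : ∀ x ∈ Set.Icc (0 : ℝ) 1, 0 ≤ f.eval x) : LukacsForm n f := by
  have hlin : ∀ c d : ℝ, 0 ≤ c → 0 ≤ d → LukacsForm 1 (C c * X + C d * (1 - X)) := by
    intro c d hc hd
    refine ⟨C √c, C √d, degree_C_lt_one _, degree_C_lt_one _, ?_⟩
    rw [if_neg (by simp), ← C_pow, ← C_pow, Real.sq_sqrt hc, Real.sq_sqrt hd]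
    ring
  refine nonneg_induction (I := Set.Icc 0 1) (by simp [interior_Icc, closure_Ioo])
    ⟨0, by simp⟩ LukacsForm.mul ?_ ?_ ?_ ?_ ?_ n f hdeg hf
  · simpa using hlin 1 1 zero_le_one zero_le_one
  · intro c hc
    refine ⟨C √c, 0, degree_C_lt_one _, by simp, ?_⟩
    rw [if_pos (by simp), ← C_pow, Real.sq_sqrt hc]
    simp
  · intro r hr
    rw [interior_Icc, Set.mem_Ioo, not_and_or, not_lt, not_lt] at hr
    obtain hr | hr := hr
    · refine ⟨1, one_ne_zero, fun x hx => by linarith [hx.1], ?_⟩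
      convert hlin (1 - r) (-r) (by linarith) (by linarith) using 1
      simp only [C_sub, C_neg, C_1]
      ring
    · refine ⟨-1, by norm_num, fun x hx => by linarith [hx.2], ?_⟩
      convert hlin (r - 1) r (by linarith) (by linarith) using 1
      simp only [C_sub, C_neg, C_1]
      ring
  · exact fun r => ⟨X - C r, 0, by rw [degree_X_sub_C]; norm_num, by simp, by simp⟩
  · intro u v hv
    -- subtracting `s t (1 - t)` leaves a perfect square for a root `s` of the discriminant
    set A := u ^ 2 + v ^ 2 with hA
    have hv2 : 0 < v ^ 2 := by positivity
    set s := (2 * A - 2 * u) + √((2 * A - 2 * u) ^ 2 + 4 * v ^ 2) with hs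
    have hr : √((2 * A - 2 * u) ^ 2 + 4 * v ^ 2) ^ 2 = (2 * A - 2 * u) ^ 2 + 4 * v ^ 2 :=
      Real.sq_sqrt (by positivity)
    have hs0 : 0 ≤ s := by
      have := Real.abs_le_sqrt (show (2 * A - 2 * u) ^ 2 ≤ (2 * A - 2 * u) ^ 2 + 4 * v ^ 2 by
        linarith)
      linarith [neg_abs_le (2 * A - 2 * u)]
    have hdisc : (-2 * u - s) ^ 2 = 4 * (1 + s) * A := by
      have h1 : s ^ 2 - 2 * (2 * A - 2 * u) * s - 4 * v ^ 2 = 0 := by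
        rw [hs]; linear_combination hr
      rw [hA] at h1 ⊢
      linear_combination h1
    have hs1 : (0 : ℝ) < 1 + s := by linarith
    refine ⟨C √(1 + s) * X + C ((-2 * u - s) / (2 * √(1 + s))), C √s,
      (degree_linear_le.trans_lt (by norm_num)), degree_C_lt_one _, ?_⟩
    rw [if_pos (by decide)]
    have e1 : √(1 + s) ^ 2 = 1 + s := Real.sq_sqrt hs1.le
    have e2 : √s ^ 2 = s := Real.sq_sqrt hs0
    have e3 : 2 * (√(1 + s) * ((-2 * u - s) / (2 * √(1 + s)))) = -2 * u - s := by
      have := (Real.sqrt_pos.2 hs1).ne'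
      field_simp
    have e4 : ((-2 * u - s) / (2 * √(1 + s))) ^ 2 = A := by
      rw [div_pow, mul_pow, e1, hdisc]
      field_simp
      ring
    generalize (-2 * u - s) / (2 * √(1 + s)) = w at e3 e4
    generalize √(1 + s) = y at e1 e3
    have E1 : (C y ^ 2 : ℝ[X]) = C 1 + C s := by rw [← C_pow, e1, C_add]
    have E2 : (C √s ^ 2 : ℝ[X]) = C s := by rw [← C_pow, e2]
    have E3 : (C 2 * (C y * C w) : ℝ[X]) = - C 2 * C u - C s := by
      rw [← C_mul, ← C_mul, e3]; simp
    have E4 : (C w ^ 2 : ℝ[X]) = C u ^ 2 + C v ^ 2 := by rw [← C_pow, e4, hA]; simp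
    simp only [C_pow, map_ofNat, C_1] at E1 E2 E3 E4 ⊢
    linear_combination (-X ^ 2 : ℝ[X]) * E1 - X * (1 - X) * E2 - X * E3 - E4

/-! ### Quantum signal processing -/

/-- Coefficients after `l` alternating applications of a unitary and its inverse, interleaved with
phases `φ` on the marked component; `t` is the squared initial overlap with the marked subspace.
For even `l` they refer to the vectors `|0⟩`, `w`, for odd `l` to the marked and the unmarked
part of `U|0⟩`; all these vectors are left unnormalized, so that the coefficients are polynomials
in `t`. -/
noncomputable def signal (φ : ℕ → ℂ) (t : ℝ) : ℕ → ℂ × ℂ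
  | 0 => (φ 0, 0)
  | l + 1 =>
    if Even l then (φ (l + 1) * ((signal φ t l).1 + (1 - t) * (signal φ t l).2),
      (signal φ t l).1 - t * (signal φ t l).2)
    else (φ (l + 1) * (t * (signal φ t l).1 + (1 - t) * (signal φ t l).2),
      (signal φ t l).1 - (signal φ t l).2)

theorem signal_congr {φ χ : ℕ → ℂ} {t : ℝ} {l : ℕ} (h : ∀ i ≤ l, φ i = χ i) :
    signal φ t l = signal χ t l := by
  induction l with
  | zero => simp [signal, h 0 le_rfl]
  | succ l ih => simp only [signal, ih fun i hi => h i (by omega), h (l + 1) le_rfl]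

theorem signal_conj (φ : ℕ → ℂ) (t : ℝ) (l : ℕ) :
    signal (fun i => starRingEnd ℂ (φ i)) t l =
      (starRingEnd ℂ (signal φ t l).1, starRingEnd ℂ (signal φ t l).2) := by
  induction l with
  | zero => simp [signal]
  | succ l ih =>
    simp only [signal, ih]
    split_ifs <;> simp

/-- The pair `(p, q)` satisfies the normalization of the coefficients after `l` steps, and its
degrees are bounded accordingly. -/
def IsSignalPair (l : ℕ) (p q : ℂ[X]) : Prop :=
  p.degree < ((l / 2 + 1 : ℕ) : WithBot ℕ) ∧ q.degree < (((l + 1) / 2 : ℕ) : WithBot ℕ) ∧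
    1 = if Even l then p * p.map (starRingEnd ℂ) + X * (1 - X) * (q * q.map (starRingEnd ℂ))
      else X * (p * p.map (starRingEnd ℂ)) + (1 - X) * (q * q.map (starRingEnd ℂ))

theorem degree_lt_of_coeff_eq_zero {p : ℂ[X]} {k : ℕ}
    (hp : p.degree < ((k + 1 : ℕ) : WithBot ℕ)) (h : p.coeff k = 0) :
    p.degree < (k : WithBot ℕ) := by
  rw [degree_lt_iff_coeff_zero] at hp ⊢
  intro i hi
  obtain rfl | hi := hi.eq_or_lt
  · exact h
  · exact hp i hi

theorem coeff_mul_conj_top {p : ℂ[X]} {k : ℕ} (hp : p.natDegree ≤ k) :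
    (p * p.map (starRingEnd ℂ)).coeff (k + k) = ((‖p.coeff k‖ ^ 2 : ℝ) : ℂ) := by
  rw [coeff_mul_add_eq_of_natDegree_le hp (natDegree_map_le.trans hp), coeff_map, Complex.mul_conj,
    Complex.normSq_eq_norm_sq]

theorem exists_phase_mul_eq {z w : ℂ} (h : ‖z‖ = ‖w‖) : ∃ c : ℂ, ‖c‖ = 1 ∧ c * z = w := by
  by_cases hz : z = 0
  · refine ⟨1, by simp, ?_⟩
    rw [hz, norm_zero] at h
    rw [hz, norm_eq_zero.1 h.symm, mul_zero]
  · exact ⟨w / z, by rw [norm_div, ← h, div_self (norm_ne_zero_iff.2 hz)], div_mul_cancel₀ w hz⟩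

theorem C_mul_map_conj {c : ℂ} (hc : ‖c‖ = 1) :
    C c * (C c : ℂ[X]).map (starRingEnd ℂ) = 1 := by
  rw [map_C, ← C_mul, Complex.mul_conj, Complex.normSq_eq_norm_sq, hc]
  simp

theorem natDegree_le_of_degree_lt {p : ℂ[X]} {k : ℕ}
    (hp : p.degree < ((k + 1 : ℕ) : WithBot ℕ)) : p.natDegree ≤ k := by
  rw [natDegree_le_iff_coeff_eq_zero]
  rw [degree_lt_iff_coeff_zero] at hp
  exact fun i hi => hp i hi

/-- One step of layer stripping: a phase makes the leading coefficients of `p` and `q` agree, since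
their moduli agree by the normalization, and then undoing a step lowers the degrees. -/
theorem IsSignalPair.strip {l : ℕ} {p q : ℂ[X]} (h : IsSignalPair (l + 1) p q) :
    ∃ (c : ℂ) (p₀ q₀ : ℂ[X]), ‖c‖ = 1 ∧ IsSignalPair l p₀ q₀ ∧
      (if Even l then C c * (p₀ + (1 - X) * q₀) = p ∧ p₀ - X * q₀ = q
        else C c * (X * p₀ + (1 - X) * q₀) = p ∧ p₀ - q₀ = q) := by
  obtain ⟨hp, hq, hn⟩ := h
  obtain ⟨k, rfl | rfl⟩ := Nat.even_or_odd' l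
  · rw [if_neg (by simp)] at hn
    have hp' : p.degree < ((k + 1 : ℕ) : WithBot ℕ) := by convert hp using 3; omega
    have hq' : q.degree < ((k + 1 : ℕ) : WithBot ℕ) := by convert hq using 3; omega
    have hnorm : ‖p.coeff k‖ = ‖q.coeff k‖ := by
      have h1 := congrArg (fun f => coeff f (k + k + 1)) hn
      simp only [sub_mul, one_mul, coeff_add, coeff_sub, coeff_X_mul,
        coeff_mul_conj_top (natDegree_le_of_degree_lt hp'),
        coeff_mul_conj_top (natDegree_le_of_degree_lt hq'), coeff_one] at h1
      rw [coeff_eq_zero_of_natDegree_lt (p := q * _) (n := k + k + 1), if_neg (by omega)] at h1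
      · have h2 : ‖p.coeff k‖ ^ 2 = ‖q.coeff k‖ ^ 2 := by
          have h3 : ((‖p.coeff k‖ ^ 2 : ℝ) : ℂ) = ((‖q.coeff k‖ ^ 2 : ℝ) : ℂ) := by
            linear_combination -h1
          exact_mod_cast h3
        exact (pow_left_inj₀ (norm_nonneg _) (norm_nonneg _) two_ne_zero).1 h2
      · have h4 := natDegree_le_of_degree_lt hq'
        have h5 := natDegree_mul_le (p := q) (q := q.map (starRingEnd ℂ))
        have h6 := natDegree_map_le (p := q) (f := starRingEnd ℂ)
        omega
    obtain ⟨c, hc, hcp⟩ := exists_phase_mul_eq hnorm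
    have hd : (C c * p - q).degree < (k : WithBot ℕ) :=
      degree_lt_of_coeff_eq_zero (degree_sub_lt_of_lt
        (degree_mul_lt_of_lt (degree_C_lt_one c) hp' (by omega)) hq') (by simp [hcp])
    have hcc := C_mul_map_conj hc
    have hcc' : C (starRingEnd ℂ c) * C c = (1 : ℂ[X]) := by
      rw [map_C] at hcc; rw [mul_comm]; exact hcc
    refine ⟨starRingEnd ℂ c, X * (C c * p) + (1 - X) * q, C c * p - q, by simpa using hc,
      ⟨?_, ?_, ?_⟩, ?_⟩
    · rw [show X * (C c * p) + (1 - X) * q = X * (C c * p - q) + q by ring]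
      refine degree_add_lt_of_lt (degree_mul_lt_of_lt degree_X_lt_two hd (by omega)) ?_
      convert hq' using 3; omega
    · convert hd using 2; omega
    · rw [if_pos (by simp)]
      simp only [Polynomial.map_add, Polynomial.map_sub, Polynomial.map_mul, map_X,
        Polynomial.map_one] at hcc ⊢
      linear_combination hn - X * p * p.map (starRingEnd ℂ) * hcc
    · rw [if_pos (by simp)]
      constructor
      · linear_combination p * hcc'
      · ring
  · rw [if_pos (by simp [Nat.even_add_one])] at hn
    have hp' : p.degree < ((k + 1 + 1 : ℕ) : WithBot ℕ) := by convert hp using 3; omega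
    have hq' : q.degree < ((k + 1 : ℕ) : WithBot ℕ) := by convert hq using 3; omega
    have hnorm : ‖p.coeff (k + 1)‖ = ‖q.coeff k‖ := by
      have h1 := congrArg (fun f => coeff f (k + 1 + (k + 1))) hn
      have e : k + 1 + (k + 1) = k + k + 1 + 1 := by ring
      have h0 : (q * q.map (starRingEnd ℂ)).natDegree < k + k + 1 := by
        have h4 := natDegree_le_of_degree_lt hq'
        have h5 := natDegree_mul_le (p := q) (q := q.map (starRingEnd ℂ))
        have h6 := natDegree_map_le (p := q) (f := starRingEnd ℂ)
        omega
      simp only [coeff_add, coeff_mul_conj_top (natDegree_le_of_degree_lt hp'), coeff_one] at h1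
      rw [e, mul_assoc, coeff_X_mul, sub_mul, one_mul, coeff_sub, coeff_X_mul,
        coeff_mul_conj_top (natDegree_le_of_degree_lt hq'), coeff_eq_zero_of_natDegree_lt h0,
        if_neg (by omega)] at h1
      have h2 : ‖p.coeff (k + 1)‖ ^ 2 = ‖q.coeff k‖ ^ 2 := by
        have h3 : ((‖p.coeff (k + 1)‖ ^ 2 : ℝ) : ℂ) = ((‖q.coeff k‖ ^ 2 : ℝ) : ℂ) := by
          linear_combination -h1
        exact_mod_cast h3
      exact (pow_left_inj₀ (norm_nonneg _) (norm_nonneg _) two_ne_zero).1 h2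
    obtain ⟨c, hc, hcp⟩ := exists_phase_mul_eq hnorm
    have hd : (C c * p - X * q).degree < ((k + 1 : ℕ) : WithBot ℕ) :=
      degree_lt_of_coeff_eq_zero (degree_sub_lt_of_lt
        (degree_mul_lt_of_lt (degree_C_lt_one c) hp' (by omega))
        (degree_mul_lt_of_lt degree_X_lt_two hq' (by omega))) (by simp [hcp])
    have hcc := C_mul_map_conj hc
    have hcc' : C (starRingEnd ℂ c) * C c = (1 : ℂ[X]) := by
      rw [map_C] at hcc; rw [mul_comm]; exact hcc
    refine ⟨starRingEnd ℂ c, C c * p + (1 - X) * q, C c * p - X * q, by simpa using hc,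
      ⟨?_, ?_, ?_⟩, ?_⟩
    · rw [show C c * p + (1 - X) * q = (C c * p - X * q) + q by ring]
      convert degree_add_lt_of_lt hd hq' using 3; omega
    · convert hd using 3; omega
    · rw [if_neg (by simp)]
      simp only [Polynomial.map_add, Polynomial.map_sub, Polynomial.map_mul, map_X,
        Polynomial.map_one] at hcc ⊢
      linear_combination hn - p * p.map (starRingEnd ℂ) * hcc
    · rw [if_neg (by simp)]
      constructor
      · linear_combination p * hcc'
      · ring

/-- Every normalized pair of polynomials is realized by phases. -/
theorem IsSignalPair.exists_phases {l : ℕ} {p q : ℂ[X]} (h : IsSignalPair l p q) :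
    ∃ φ : ℕ → ℂ, (∀ i, ‖φ i‖ = 1) ∧ ∀ t : ℝ, signal φ t l = (p.eval (t : ℂ), q.eval (t : ℂ)) := by
  induction l generalizing p q with
  | zero =>
    obtain ⟨hp, hq, hn⟩ := h
    have hq0 : q = 0 := by
      by_contra h0
      rw [← natDegree_lt_iff_degree_lt h0] at hq
      simp at hq
    have hp0 : p = C (p.coeff 0) := eq_C_of_natDegree_le_zero (natDegree_le_of_degree_lt hp)
    refine ⟨fun _ => p.coeff 0, fun _ => ?_, fun t => ?_⟩
    · have h1 := congrArg (fun f => coeff f (0 + 0)) hn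
      simp only [hq0, Even.zero, if_true, zero_mul, mul_zero, add_zero] at h1
      have := coeff_mul_conj_top (p := p) (k := 0) (natDegree_le_of_degree_lt hp)
      rw [add_zero] at this
      rw [this] at h1
      have h2 : ‖p.coeff 0‖ ^ 2 = 1 := by
        rw [coeff_one_zero] at h1
        exact_mod_cast h1.symm
      exact (pow_eq_one_iff_of_nonneg (norm_nonneg _) two_ne_zero).1 h2
    · rw [hp0, hq0]
      simp [signal]
  | succ l ih =>
    obtain ⟨c, p₀, q₀, hc, h₀, hpq⟩ := h.strip
    obtain ⟨φ, hφ, hs⟩ := ih h₀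
    refine ⟨Function.update φ (l + 1) c, fun i => ?_, fun t => ?_⟩
    · by_cases hi : i = l + 1
      · simp [hi, hc]
      · simp [hi, hφ]
    · have : signal (Function.update φ (l + 1) c) t l = signal φ t l :=
        signal_congr fun i hi => by simp [show i ≠ l + 1 by omega]
      simp only [signal, this, hs, Function.update_self]
      split_ifs at hpq ⊢
      · rw [← hpq.1, ← hpq.2]; simp
      · rw [← hpq.1, ← hpq.2]; simp

/-! ### Phases for amplitude amplification -/

/-- The complex polynomial `a + i b`. -/
noncomputable def complexPoly (a b : ℝ[X]) : ℂ[X] :=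
  a.map (algebraMap ℝ ℂ) + C Complex.I * b.map (algebraMap ℝ ℂ)

theorem complexPoly_eval (a b : ℝ[X]) (t : ℝ) :
    (complexPoly a b).eval (t : ℂ) = ((a.eval t : ℝ) : ℂ) + Complex.I * ((b.eval t : ℝ) : ℂ) := by
  have h : ∀ f : ℝ[X], (f.map (algebraMap ℝ ℂ)).eval (t : ℂ) = ((f.eval t : ℝ) : ℂ) := fun f =>
    eval_map_apply (algebraMap ℝ ℂ) t
  simp [complexPoly, h]

theorem complexPoly_mul_conj (a b : ℝ[X]) :
    complexPoly a b * (complexPoly a b).map (starRingEnd ℂ) =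
      (a ^ 2 + b ^ 2).map (algebraMap ℝ ℂ) := by
  have h : ∀ f : ℝ[X], (f.map (algebraMap ℝ ℂ)).map (starRingEnd ℂ) = f.map (algebraMap ℝ ℂ) :=
    fun f => by ext i; simp
  have hI : (C Complex.I * C Complex.I : ℂ[X]) = -1 := by
    rw [← C_mul, Complex.I_mul_I]; simp
  simp only [complexPoly, Polynomial.map_add, Polynomial.map_mul, Polynomial.map_pow, h, map_C,
    Complex.conj_I, C_neg]
  linear_combination (-(b.map (algebraMap ℝ ℂ)) ^ 2) * hI

theorem complexPoly_degree_lt {a b : ℝ[X]} {m : WithBot ℕ} (ha : a.degree < m)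
    (hb : b.degree < m) : (complexPoly a b).degree < m := by
  refine degree_add_lt_of_lt (by rwa [degree_map]) ?_
  rwa [degree_mul, degree_map, degree_C Complex.I_ne_zero, zero_add]

theorem degree_lt_of_natDegree_le {a : ℝ[X]} {k : ℕ} (h : a.natDegree ≤ k) :
    a.degree < ((k + 1 : ℕ) : WithBot ℕ) :=
  degree_le_natDegree.trans_lt (by exact_mod_cast Nat.lt_succ_of_le h)

open Real Polynomial.Chebyshev in
theorem chebyshev_eval_le_of_le_cosh (n : ℕ) {u y : ℝ} (hu : u ≤ cosh y) :
    Odd n → (Chebyshev.T ℝ n).eval u ≤ cosh (n * y) := by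
  intro hn
  obtain h1 | h1 := le_total u 1
  · refine le_trans ?_ (one_le_cosh _)
    obtain h2 | h2 := le_total (-1) u
    · exact (abs_le.1 (abs_eval_T_real_le_one n (abs_le.2 ⟨h2, h1⟩))).2
    · have := one_le_negOnePow_mul_eval_T_real n h2
      rw [Int.negOnePow_odd _ (by exact_mod_cast hn)] at this
      simp at this
      linarith
  · obtain ⟨x, rfl⟩ : ∃ x, u = cosh x := ⟨_, (cosh_arcosh h1).symm⟩
    rw [T_real_cosh, cosh_le_cosh, abs_mul, abs_mul]
    rw [cosh_le_cosh] at hu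
    simpa using mul_le_mul_of_nonneg_left hu (abs_nonneg (n : ℝ))

open Real Polynomial.Chebyshev in
theorem le_chebyshev_eval_of_cosh_le (n : ℕ) {u y : ℝ} (hu : cosh y ≤ u) :
    cosh (n * y) ≤ (Chebyshev.T ℝ n).eval u := by
  obtain ⟨x, rfl⟩ : ∃ x, u = cosh x := ⟨_, (cosh_arcosh ((one_le_cosh y).trans hu)).symm⟩
  rw [T_real_cosh, cosh_le_cosh, Int.cast_natCast, abs_mul, abs_mul]
  rw [cosh_le_cosh] at hu
  exact mul_le_mul_of_nonneg_left hu (abs_nonneg (n : ℝ))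

open Real Polynomial.Chebyshev in
theorem chebyshev_sign (n : ℕ) (hn : Odd n) (u : ℝ) :
    (-1 ≤ u → 0 ≤ 1 + (Chebyshev.T ℝ n).eval u) ∧ (u ≤ -1 → 1 + (Chebyshev.T ℝ n).eval u ≤ 0) := by
  constructor
  · intro h
    obtain h1 | h1 := le_total u 1
    · linarith [(abs_le.1 (abs_eval_T_real_le_one n (abs_le.2 ⟨h, h1⟩))).1]
    · linarith [one_le_eval_T_real n h1]
  · intro h
    have := one_le_negOnePow_mul_eval_T_real n h
    rw [Int.negOnePow_odd _ (by exact_mod_cast hn)] at this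
    simp at this
    linarith

theorem sinh_le_mul_cosh {x : ℝ} (hx : 0 ≤ x) : Real.sinh x ≤ x * Real.cosh x := by
  have hm : MonotoneOn (fun y : ℝ => y * Real.cosh y - Real.sinh y) (Set.Ici 0) := by
    refine monotoneOn_of_deriv_nonneg (convex_Ici 0) (by fun_prop) (by fun_prop) fun y hy => ?_
    rw [interior_Ici] at hy
    have hd : HasDerivAt (fun y : ℝ => y * Real.cosh y - Real.sinh y)
        (1 * Real.cosh y + y * Real.sinh y - Real.cosh y) y :=
      ((hasDerivAt_id y).mul (Real.hasDerivAt_cosh y)).sub (Real.hasDerivAt_sinh y)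
    rw [hd.deriv]
    have := mul_nonneg (le_of_lt hy) (Real.sinh_nonneg_iff.2 (le_of_lt hy))
    linarith
  have := hm (Set.mem_Ici.2 le_rfl) (Set.mem_Ici.2 hx) hx
  simp at this
  linarith

open Real Polynomial.Chebyshev in
/-- Fixed-point amplification: with `Λ = log (2 / δ)` and `2 k + 1 ≥ Λ / √s` uses of the unitary,
the squared overlap with the marked part exceeds `1 - δ ^ 2` whenever it is at least `s` initially.
The failure probability is a rescaled Chebyshev polynomial that is small on `[s, 1]`; it and its
complement are, after removing a linear factor, nonnegative on the whole line, hence absolute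
squares of complex polynomials. -/
theorem exists_amplification_phases {δ s : ℝ} (hδ : 0 < δ) (hδ1 : δ ≤ 1) (hs : 0 < s) {k : ℕ}
    (hk : log (2 / δ) / √s ≤ 2 * k + 1) :
    ∃ φ : ℕ → ℂ, (∀ i, ‖φ i‖ = 1) ∧ ∀ t : ℝ, s ≤ t → t ≤ 1 →
      1 - δ ^ 2 ≤ t * ‖(signal φ t (2 * k + 1)).1‖ ^ 2 := by
  set Λ := log (2 / δ) with hΛ
  have hΛ0 : 0 < Λ := log_pos (by rw [lt_div_iff₀ hδ]; linarith)
  have hcoshΛ : 1 / δ ≤ cosh Λ := by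
    rw [cosh_eq, hΛ, exp_log (by positivity)]
    have := exp_pos (-log (2 / δ))
    have h2 : 2 / δ = 2 * (1 / δ) := by ring
    linarith
  have hL : (0 : ℝ) < 2 * k + 1 := by positivity
  have hodd : Odd (2 * k + 1) := ⟨k, rfl⟩
  set η := Λ / (2 * k + 1) with hη
  have hη0 : 0 ≤ η := by positivity
  have hηs : η ^ 2 ≤ s := by
    rw [← sq_sqrt hs.le]
    refine pow_le_pow_left₀ hη0 ?_ 2
    rw [div_le_iff₀ (sqrt_pos.2 hs)] at hk
    rw [hη, div_le_iff₀ hL]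
    linarith
  set c := cosh (2 * η) with hc
  have hc1 : 1 ≤ c := one_le_cosh _
  have hLη : (((2 * k + 1 : ℕ)) : ℝ) * (2 * η) = 2 * Λ := by
    rw [hη]; push_cast; field_simp
  set M := 2 * cosh Λ ^ 2 with hM
  have hM0 : 0 < M := by have := cosh_pos Λ; positivity
  have hcoshM : cosh (2 * Λ) = M - 1 := by
    rw [hM, cosh_two_mul, sinh_sq]; ring
  set A : ℝ[X] := 1 + (Chebyshev.T ℝ (2 * k + 1 : ℕ)).comp (C c - C (1 + c) * X) with hA
  have hAev : ∀ t, A.eval t = 1 + (Chebyshev.T ℝ (2 * k + 1 : ℕ)).eval (c - (1 + c) * t) :=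
    fun t => by simp [hA, eval_comp]
  have hlin : (C c - C (1 + c) * X : ℝ[X]).natDegree ≤ 1 :=
    (natDegree_sub_le _ _).trans (max_le (by simp) (natDegree_C_mul_le _ _ |>.trans (by simp)))
  have hAdeg : A.natDegree ≤ 2 * k + 1 := by
    refine natDegree_add_le_of_degree_le (by simp) ?_
    rw [natDegree_comp, natDegree_T]
    calc _ ≤ (2 * k + 1) * 1 := Nat.mul_le_mul (Int.natAbs_natCast _).le hlin
      _ = _ := by ring
  -- the complement of the success probability, divided by `1 - t`
  obtain ⟨B, hB⟩ : (X - C 1) ∣ A := dvd_iff_isRoot.2 (by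
    rw [IsRoot, hAev, show c - (1 + c) * 1 = -1 by ring, T_eval_neg_one,
      Int.negOnePow_odd _ (by exact_mod_cast hodd)]
    simp)
  have hBdeg : B.natDegree ≤ 2 * k := by
    by_cases h0 : B = 0
    · simp [h0]
    rw [hB, natDegree_mul (X_sub_C_ne_zero 1) h0, natDegree_X_sub_C] at hAdeg
    omega
  have hB0 : ∀ t, 0 ≤ (C (-M⁻¹) * B).eval t := fun t => by
    refine eval_nonneg_of_nonneg_off_point (I := Set.univ) (by simp) 1 (fun t _ ht => ?_) t trivial
    have h1 := hAev t
    rw [hB] at h1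
    simp only [eval_mul, eval_sub, eval_X, eval_C] at h1 ⊢
    have h2 := chebyshev_sign (2 * k + 1) hodd (c - (1 + c) * t)
    rw [← h1] at h2
    have h3 : eval t B ≤ 0 := by
      obtain h | h := lt_or_gt_of_ne ht
      · have := h2.1 (by nlinarith)
        by_contra hpos
        push Not at hpos
        nlinarith
      · have := h2.2 (by nlinarith)
        by_contra hpos
        push Not at hpos
        nlinarith
    have := mul_nonneg (inv_pos.2 hM0).le (neg_nonneg.2 h3)
    linarith
  -- the success probability, divided by `t`
  obtain ⟨D, hD⟩ : (X - C 0) ∣ (1 - C M⁻¹ * A) := dvd_iff_isRoot.2 (by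
    rw [IsRoot, eval_sub, eval_mul, hAev, mul_zero, sub_zero, hc, T_real_cosh, Int.cast_natCast,
      hLη, hcoshM]
    simp [hM0.ne'])
  rw [C_0, sub_zero] at hD
  have hDdeg : D.natDegree ≤ 2 * k := by
    by_cases h0 : D = 0
    · simp [h0]
    have h1 : (1 - C M⁻¹ * A).natDegree ≤ 2 * k + 1 := by
      refine (natDegree_sub_le _ _).trans (max_le (by simp) ?_)
      exact (natDegree_C_mul_le _ _).trans hAdeg
    rw [hD, natDegree_mul X_ne_zero h0, natDegree_X] at h1
    omega
  have hD0 : ∀ t, 0 ≤ D.eval t := fun t => by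
    refine eval_nonneg_of_nonneg_off_point (I := Set.univ) (by simp) 0 (fun t _ ht => ?_) t trivial
    have h1 := congrArg (eval t) hD
    simp only [eval_mul, eval_sub, eval_X, eval_C, hAev, eval_one] at h1
    obtain h | h := lt_or_gt_of_ne ht
    · have h2 := le_chebyshev_eval_of_cosh_le (2 * k + 1) (u := c - (1 + c) * t) (y := 2 * η)
        (by rw [← hc]; nlinarith)
      rw [hLη, hcoshM] at h2
      have h3 : 1 ≤ M⁻¹ * (1 + eval (c - (1 + c) * t) (Chebyshev.T ℝ (2 * k + 1 : ℕ))) := by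
        rw [inv_mul_eq_div, le_div_iff₀ hM0]; linarith
      by_contra hneg
      push Not at hneg
      nlinarith
    · have h2 := chebyshev_eval_le_of_le_cosh (2 * k + 1) (u := c - (1 + c) * t) (y := 2 * η)
        (by rw [← hc]; nlinarith) hodd
      rw [hLη, hcoshM] at h2
      have h3 : M⁻¹ * (1 + eval (c - (1 + c) * t) (Chebyshev.T ℝ (2 * k + 1 : ℕ))) ≤ 1 := by
        rw [inv_mul_eq_div, div_le_iff₀ hM0]; linarith
      by_contra hneg
      push Not at hneg
      nlinarith
  obtain ⟨p₁, p₂, hp₁, hp₂, hp⟩ := exists_sq_add_sq_of_nonneg hDdeg hD0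
  obtain ⟨q₁, q₂, hq₁, hq₂, hq⟩ := exists_sq_add_sq_of_nonneg
    ((natDegree_C_mul_le _ _).trans hBdeg) hB0
  have hpair : IsSignalPair (2 * k + 1) (complexPoly p₁ p₂) (complexPoly q₁ q₂) := by
    refine ⟨?_, ?_, ?_⟩
    · convert complexPoly_degree_lt (degree_lt_of_natDegree_le hp₁)
        (degree_lt_of_natDegree_le hp₂) using 3
      omega
    · convert complexPoly_degree_lt (degree_lt_of_natDegree_le hq₁)
        (degree_lt_of_natDegree_le hq₂) using 3
      omega
    · rw [if_neg (by simp), complexPoly_mul_conj, complexPoly_mul_conj, ← hp, ← hq]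
      have h1 : (1 : ℝ[X]) = X * D + (1 - X) * (C (-M⁻¹) * B) := by
        rw [← hD, hB]; simp only [Polynomial.C_neg, C_1]; ring
      have h2 := congrArg (Polynomial.map (algebraMap ℝ ℂ)) h1
      simpa using h2
  obtain ⟨φ, hφ, hsig⟩ := hpair.exists_phases
  refine ⟨φ, hφ, fun t hst ht1 => ?_⟩
  rw [hsig, complexPoly_eval]
  have hnorm : ‖((eval t p₁ : ℝ) : ℂ) + Complex.I * ((eval t p₂ : ℝ) : ℂ)‖ ^ 2 = D.eval t := by
    rw [← Complex.normSq_eq_norm_sq, Complex.normSq_apply, hp]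
    simp
    ring
  rw [hnorm]
  have h1 := congrArg (eval t) hD
  simp only [eval_mul, eval_sub, eval_X, eval_C, hAev, eval_one] at h1
  rw [← h1]
  have hu : c - (1 + c) * t ≤ 1 := by
    have e1 : c = 2 * cosh η ^ 2 - 1 := by rw [hc, cosh_two_mul, sinh_sq]; ring
    have e2 : sinh η ^ 2 ≤ s * cosh η ^ 2 := by
      calc sinh η ^ 2 ≤ (η * cosh η) ^ 2 :=
            pow_le_pow_left₀ (sinh_nonneg_iff.2 hη0) (sinh_le_mul_cosh hη0) 2
        _ = η ^ 2 * cosh η ^ 2 := by ring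
        _ ≤ _ := by gcongr
    rw [sinh_sq] at e2
    have e3 : s * cosh η ^ 2 ≤ t * cosh η ^ 2 := by gcongr
    rw [e1]; linarith
  have hT := chebyshev_eval_le_of_le_cosh (2 * k + 1) (u := c - (1 + c) * t) (y := 0)
    (by rwa [cosh_zero]) hodd
  rw [mul_zero, cosh_zero] at hT
  have hMδ : M⁻¹ * 2 ≤ δ ^ 2 := by
    have h3 : (1 / δ) ^ 2 ≤ cosh Λ ^ 2 := pow_le_pow_left₀ (by positivity) hcoshΛ 2
    rw [inv_mul_eq_div, div_le_iff₀ hM0, hM]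
    calc (2 : ℝ) = δ ^ 2 * (2 * (1 / δ) ^ 2) := by field_simp
      _ ≤ _ := by gcongr
  have : M⁻¹ * (1 + eval (c - (1 + c) * t) (Chebyshev.T ℝ (2 * k + 1 : ℕ))) ≤ M⁻¹ * 2 :=
    mul_le_mul_of_nonneg_left (by linarith) (inv_pos.2 hM0).le
  linarith

/-! ### Phases for singular value separation -/

theorem abs_sin_mul_le (n : ℕ) (x : ℝ) : |Real.sin (n * x)| ≤ n * |Real.sin x| := by
  induction n with
  | zero => simp
  | succ n ih =>
    push_cast
    rw [add_mul, one_mul, Real.sin_add, add_mul, one_mul]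
    refine (abs_add_le _ _).trans (add_le_add ?_ ?_)
    · rw [abs_mul]
      exact (mul_le_of_le_one_right (abs_nonneg _) (Real.abs_cos_le_one _)).trans ih
    · rw [abs_mul]
      exact mul_le_of_le_one_left (abs_nonneg _) (Real.abs_cos_le_one _)

theorem three_mul_le_sin {x : ℝ} (h0 : 0 ≤ x) (h1 : x ≤ Real.pi / 6) :
    3 * x / Real.pi ≤ Real.sin x := by
  have hπ := Real.pi_pos
  have hl0 : 0 ≤ 1 - 6 * x / Real.pi := by
    rw [sub_nonneg, div_le_one hπ]; linarith
  have := strictConcaveOn_sin_Icc.concaveOn.2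
    (show (0 : ℝ) ∈ Set.Icc 0 Real.pi from ⟨le_rfl, hπ.le⟩)
    (show Real.pi / 6 ∈ Set.Icc 0 Real.pi from ⟨by positivity, by linarith⟩) hl0
    (show 0 ≤ 6 * x / Real.pi by positivity) (by ring)
  simp only [smul_eq_mul, Real.sin_zero, Real.sin_pi_div_six, mul_zero, zero_add] at this
  have e : 6 * x / Real.pi * (Real.pi / 6) = x := by field_simp
  rw [e] at this
  calc _ = 6 * x / Real.pi * (1 / 2) := by ring
    _ ≤ _ := this

/-- The squared Dirichlet kernel `(sin (n θ) / (n sin θ))²`, `n = 2 h + 1`, as a polynomial in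
`t = sin² θ`. -/
theorem exists_dirichlet_poly (h : ℕ) : ∃ E : ℝ[X], E.natDegree ≤ 2 * h ∧
    ∀ θ : ℝ, Real.sin θ ^ 2 * E.eval (Real.sin θ ^ 2) =
      Real.sin ((2 * h + 1 : ℕ) * θ) ^ 2 / (2 * h + 1 : ℕ) ^ 2 := by
  set n : ℕ := 2 * h + 1 with hn
  have hodd : Odd (n : ℤ) := by exact_mod_cast (⟨h, rfl⟩ : Odd n)
  set A : ℝ[X] := 1 + (Chebyshev.T ℝ n).comp (C 2 * X - C 1) with hA
  have hAev : ∀ t, A.eval t = 1 + (Chebyshev.T ℝ n).eval (2 * t - 1) := fun t => by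
    simp [hA, eval_comp]
  have hAdeg : A.natDegree ≤ n := by
    refine natDegree_add_le_of_degree_le (by simp) ?_
    rw [natDegree_comp, Chebyshev.natDegree_T]
    calc _ ≤ n * 1 := Nat.mul_le_mul (Int.natAbs_natCast _).le
          ((natDegree_sub_le _ _).trans (max_le ((natDegree_C_mul_le _ _).trans (by simp))
            (by simp)))
      _ = _ := by ring
  obtain ⟨B, hB⟩ : (X - C 0) ∣ A := dvd_iff_isRoot.2 (by
    rw [IsRoot, hAev, show (2 : ℝ) * 0 - 1 = -1 by ring, Chebyshev.T_eval_neg_one,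
      Int.negOnePow_odd _ hodd]
    simp)
  rw [C_0, sub_zero] at hB
  refine ⟨C (2 * (n : ℝ) ^ 2)⁻¹ * B, (natDegree_C_mul_le _ _).trans ?_, fun θ => ?_⟩
  · by_cases h0 : B = 0
    · simp [h0]
    rw [hB, natDegree_mul X_ne_zero h0, natDegree_X] at hAdeg
    omega
  · have h1 := hAev (Real.sin θ ^ 2)
    have e : 2 * Real.sin θ ^ 2 - 1 = -Real.cos (2 * θ) := by
      rw [Real.cos_two_mul, Real.cos_sq']; ring
    have e2 : Real.cos (n * (2 * θ)) = 1 - 2 * Real.sin (n * θ) ^ 2 := by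
      rw [show (n : ℝ) * (2 * θ) = 2 * (n * θ) by ring, Real.cos_two_mul, Real.cos_sq']; ring
    rw [e, Chebyshev.T_eval_neg, Chebyshev.T_real_cos, Int.negOnePow_odd _ hodd, hB,
      Int.cast_natCast, e2] at h1
    simp only [eval_mul, eval_X, eval_C] at h1 ⊢
    have hn0 : (n : ℝ) ≠ 0 := by positivity
    rw [show Real.sin θ ^ 2 * ((2 * (n : ℝ) ^ 2)⁻¹ * eval (Real.sin θ ^ 2) B) =
      (2 * (n : ℝ) ^ 2)⁻¹ * (Real.sin θ ^ 2 * eval (Real.sin θ ^ 2) B) by ring, h1]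
    push_cast
    field_simp
    simp

/-- A polynomial of degree `2 ^ J` in `t = x²` that separates the `x` below and above the threshold
up to constants. -/
theorem exists_weak_separation {J : ℕ} (hJ : 1 ≤ J) : ∃ E : ℝ[X], E.natDegree ≤ 2 ^ J ∧
    (∀ t ∈ Set.Icc (0 : ℝ) 1, 0 ≤ E.eval t ∧ E.eval t ≤ 1) ∧
    (∀ x : ℝ, 0 ≤ x → x ≤ 1 / 2 ^ J → 2 / 5 ≤ E.eval (x ^ 2)) ∧
    (∀ x : ℝ, 2 * (1 / 2 ^ J) ≤ x → x ≤ 1 → E.eval (x ^ 2) ≤ 1 / 4) := by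
  obtain ⟨h, hh⟩ : ∃ h, 2 ^ J = 2 * h :=
    ⟨2 ^ (J - 1), by rw [← pow_succ', Nat.sub_add_cancel hJ]⟩
  have hh1 : 1 ≤ h := by have := Nat.one_le_two_pow (n := J); omega
  have hhR : (2 : ℝ) ^ J = 2 * h := by exact_mod_cast hh
  have hh1R : (1 : ℝ) ≤ h := by exact_mod_cast hh1
  obtain ⟨E, hdeg, hE⟩ := exists_dirichlet_poly h
  have hev : ∀ x, 0 < x → x ≤ 1 → ∃ θ, 0 < θ ∧ θ ≤ Real.pi / 2 ∧ Real.sin θ = x ∧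
      x ^ 2 * E.eval (x ^ 2) = Real.sin ((2 * h + 1 : ℕ) * θ) ^ 2 / (2 * h + 1 : ℕ) ^ 2 :=
    fun x h0 h1 => ⟨Real.arcsin x, Real.arcsin_pos.2 h0, Real.arcsin_le_pi_div_two x,
      Real.sin_arcsin (by linarith) h1, by
        rw [← hE, Real.sin_arcsin (by linarith) h1]⟩
  set n : ℝ := ((2 * h + 1 : ℕ) : ℝ) with hn
  have hnh : n = 2 * h + 1 := by rw [hn]; push_cast; ring
  have hn0 : 0 < n := by rw [hnh]; positivity
  have hbound : ∀ x, 0 < x → x ≤ 1 → 0 ≤ E.eval (x ^ 2) ∧ E.eval (x ^ 2) ≤ 1 := by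
    intro x h0 h1
    obtain ⟨θ, _, _, hs, he⟩ := hev x h0 h1
    have hx2 : 0 < x ^ 2 := by positivity
    have h2 := abs_sin_mul_le (2 * h + 1) θ
    rw [← hn, hs, abs_of_pos h0] at h2
    have h3 : Real.sin (n * θ) ^ 2 ≤ (n * x) ^ 2 := by
      rw [← sq_abs]; exact pow_le_pow_left₀ (abs_nonneg _) h2 2
    constructor
    · refine nonneg_of_mul_nonneg_right (a := x ^ 2) ?_ hx2
      rw [he]; positivity
    · refine le_of_mul_le_mul_left (a := x ^ 2) ?_ hx2
      rw [he, mul_one, div_le_iff₀ (by positivity)]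
      linarith
  have hsmall : ∀ x, 0 < x → x ≤ 1 / 2 ^ J → 2 / 5 ≤ E.eval (x ^ 2) := by
    intro x h0 h1
    rw [hhR] at h1
    have hx1 : x ≤ 1 := h1.trans (by rw [div_le_one (by positivity)]; linarith)
    obtain ⟨θ, hθ0, hθ1, hs, he⟩ := hev x h0 hx1
    have hπ := Real.pi_pos
    have hθ : n * θ ≤ Real.pi / 2 := by
      by_contra hcon
      push Not at hcon
      have h2 : Real.pi / (2 * n) < θ := by
        rw [div_lt_iff₀ (by positivity)]; linarith
      have h3 : Real.sin (Real.pi / (2 * n)) < Real.sin θ :=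
        Real.sin_lt_sin_of_lt_of_le_pi_div_two (by
          have : 0 < Real.pi / (2 * n) := by positivity
          linarith) hθ1 h2
      have h4 := three_mul_le_sin (x := Real.pi / (2 * n)) (by positivity)
        (div_le_div_of_nonneg_left hπ.le (by norm_num) (by rw [hnh]; linarith))
      have h5 : 3 * (Real.pi / (2 * n)) / Real.pi = 3 / (2 * n) := by field_simp
      rw [h5] at h4
      have h6 : 1 / (2 * (h : ℝ)) ≤ 3 / (2 * n) := by
        rw [div_le_div_iff₀ (by positivity) (by positivity), hnh]; linarith
      rw [hs] at h3
      linarith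
    have h2 := Real.mul_le_sin (x := n * θ) (by positivity) hθ
    have h3 : x ≤ θ := by rw [← hs]; exact Real.sin_le hθ0.le
    have h4 : 2 / Real.pi * (n * x) ≤ Real.sin (n * θ) :=
      le_trans (by gcongr) h2
    have h5 : (2 / Real.pi * (n * x)) ^ 2 ≤ Real.sin (n * θ) ^ 2 :=
      pow_le_pow_left₀ (by positivity) h4 2
    have hx2 : 0 < x ^ 2 := by positivity
    refine le_of_mul_le_mul_left (a := x ^ 2) ?_ hx2
    rw [he, le_div_iff₀ (by positivity)]
    refine le_trans ?_ h5
    have h6 : 2 / 5 ≤ (2 / Real.pi) ^ 2 := by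
      rw [div_pow, div_le_div_iff₀ (by norm_num) (by positivity)]
      nlinarith [Real.pi_lt_d2]
    calc x ^ 2 * (2 / 5) * n ^ 2 = 2 / 5 * (n * x) ^ 2 := by ring
      _ ≤ (2 / Real.pi) ^ 2 * (n * x) ^ 2 := by gcongr
      _ = _ := by ring
  -- the point `0` follows by continuity
  have hsqrt : ∀ t ∈ Set.Icc (0 : ℝ) 1, t ≠ 0 → 0 < √t ∧ √t ≤ 1 ∧ √t ^ 2 = t := fun t ht h0 =>
    ⟨Real.sqrt_pos.2 (lt_of_le_of_ne ht.1 h0.symm), Real.sqrt_le_one.2 ht.2, Real.sq_sqrt ht.1⟩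
  have hIcc : ∀ c : ℝ, 0 < c → Set.Icc (0 : ℝ) c ⊆ closure (interior (Set.Icc 0 c)) :=
    fun c hc => by rw [interior_Icc, closure_Ioo hc.ne]
  refine ⟨E, by omega, fun t ht => ⟨?_, ?_⟩, fun x h0 h1 => ?_, fun x h0 h1 => ?_⟩
  · refine eval_nonneg_of_nonneg_off_point (hIcc 1 one_pos) 0 (fun t ht h0 => ?_) t ht
    obtain ⟨a, b, c⟩ := hsqrt t ht h0
    simpa [c] using (hbound _ a b).1
  · have := eval_nonneg_of_nonneg_off_point (h := 1 - E) (hIcc 1 one_pos) 0 (fun t ht h0 => ?_) t ht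
    · simpa using this
    obtain ⟨a, b, c⟩ := hsqrt t ht h0
    simpa [c] using (hbound _ a b).2
  · have hc : (0 : ℝ) < (1 / 2 ^ J) ^ 2 := by positivity
    have hc1 : ((1 : ℝ) / 2 ^ J) ≤ 1 := by
      rw [div_le_one (by positivity)]; exact one_le_pow₀ (by norm_num)
    have := eval_nonneg_of_nonneg_off_point (h := E - C (2 / 5)) (hIcc _ hc) 0
      (fun t ht h0 => ?_) (x ^ 2) ⟨by positivity, by gcongr⟩
    · simpa using this
    obtain ⟨a, b, c⟩ := hsqrt t ⟨ht.1, ht.2.trans (pow_le_one₀ (by positivity) hc1)⟩ h0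
    have := hsmall √t a ((Real.sqrt_le_sqrt ht.2).trans (Real.sqrt_sq (by positivity)).le)
    simpa [c] using this
  · have hx0 : 0 < x := lt_of_lt_of_le (by positivity) h0
    obtain ⟨θ, _, _, hs, he⟩ := hev x hx0 h1
    have hx2 : 0 < x ^ 2 := by positivity
    refine le_of_mul_le_mul_left (a := x ^ 2) ?_ hx2
    rw [he, div_le_iff₀ (by positivity)]
    have h2 : 2 ≤ n * x := by
      rw [hhR] at h0
      calc (2 : ℝ) = 2 * h * (2 * (1 / (2 * h))) := by field_simp
        _ ≤ n * x := by gcongr; rw [hnh]; linarith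
    calc Real.sin (n * θ) ^ 2 ≤ 1 := Real.sin_sq_le_one _
      _ ≤ (n * x) ^ 2 * (1 / 4) := by nlinarith
      _ = _ := by ring

/-- A Chernoff bound for the binomial distribution, with free parameter `z`. -/
theorem pow_mul_sum_bernstein_le {n N : ℕ} {S : Finset ℕ} (hS : S ⊆ Finset.range (n + 1)) {q z : ℝ}
    (hq0 : 0 ≤ q) (hq1 : q ≤ 1) (hz : 0 ≤ z) (hzS : ∀ k ∈ S, z ^ N ≤ z ^ k) :
    z ^ N * ∑ k ∈ S, (bernsteinPolynomial ℝ n k).eval q ≤ (z * q + (1 - q)) ^ n := by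
  have h1 : (0 : ℝ) ≤ 1 - q := by linarith
  rw [add_pow, Finset.mul_sum]
  refine le_trans (Finset.sum_le_sum fun k hk => ?_)
    (Finset.sum_le_sum_of_subset_of_nonneg hS fun k _ _ => by positivity)
  simp only [bernsteinPolynomial, eval_mul, eval_pow, eval_sub, eval_one, eval_X, eval_natCast]
  calc z ^ N * (n.choose k * q ^ k * (1 - q) ^ (n - k))
      ≤ z ^ k * (n.choose k * q ^ k * (1 - q) ^ (n - k)) :=
        mul_le_mul_of_nonneg_right (hzS k hk) (by positivity)
    _ = _ := by rw [mul_pow]; ring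

/-- The probability that fewer than `N` of `3 N` independent trials succeed, as a function of the
success probability. -/
noncomputable def minorityPoly (N : ℕ) : ℝ[X] :=
  ∑ k ∈ Finset.range N, bernsteinPolynomial ℝ (3 * N) k

theorem bernstein_eval_nonneg (n k : ℕ) {q : ℝ} (hq0 : 0 ≤ q) (hq1 : q ≤ 1) :
    0 ≤ (bernsteinPolynomial ℝ n k).eval q := by
  have h1 : (0 : ℝ) ≤ 1 - q := by linarith
  simp only [bernsteinPolynomial, eval_mul, eval_pow, eval_sub, eval_one, eval_X, eval_natCast]
  positivity

theorem one_sub_minorityPoly_eval (N : ℕ) (q : ℝ) : 1 - (minorityPoly N).eval q =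
    ∑ k ∈ Finset.Ico N (3 * N + 1), (bernsteinPolynomial ℝ (3 * N) k).eval q := by
  have h := congrArg (eval q) (bernsteinPolynomial.sum ℝ (3 * N))
  rw [Finset.range_eq_Ico, ← Finset.sum_Ico_consecutive _ (Nat.zero_le N) (by omega), eval_add,
    eval_one] at h
  rw [← h, minorityPoly, Finset.range_eq_Ico, eval_finsetSum, eval_finsetSum]
  ring

theorem minorityPoly_eval_nonneg (N : ℕ) {q : ℝ} (hq0 : 0 ≤ q) (hq1 : q ≤ 1) :
    0 ≤ (minorityPoly N).eval q ∧ (minorityPoly N).eval q ≤ 1 := by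
  constructor
  · rw [minorityPoly, eval_finsetSum]
    exact Finset.sum_nonneg fun k _ => bernstein_eval_nonneg _ _ hq0 hq1
  · rw [← sub_nonneg, one_sub_minorityPoly_eval]
    exact Finset.sum_nonneg fun k _ => bernstein_eval_nonneg _ _ hq0 hq1

theorem minorityPoly_eval_le (N : ℕ) {q : ℝ} (hq0 : 2 / 5 ≤ q) (hq1 : q ≤ 1) :
    (minorityPoly N).eval q ≤ (972 / 1000) ^ N := by
  have h := pow_mul_sum_bernstein_le (n := 3 * N) (N := N) (S := Finset.range N) (z := 3 / 4)
    (Finset.range_subset_range.2 (by omega)) (by linarith) hq1 (by norm_num) fun k hk =>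
      pow_le_pow_of_le_one (by norm_num) (by norm_num) (Finset.mem_range.1 hk).le
  rw [minorityPoly, eval_finsetSum]
  have h2 : (3 / 4 * q + (1 - q)) ^ (3 * N) ≤ (3 / 4) ^ N * (972 / 1000 : ℝ) ^ N := by
    rw [pow_mul, ← mul_pow]
    refine pow_le_pow_left₀ (pow_nonneg (by linarith) 3) ?_ N
    calc (3 / 4 * q + (1 - q)) ^ 3 ≤ (9 / 10) ^ 3 :=
          pow_le_pow_left₀ (by linarith) (by linarith) 3
      _ = _ := by norm_num
  exact le_of_mul_le_mul_left (h.trans h2) (by positivity)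

theorem one_sub_minorityPoly_eval_le (N : ℕ) {q : ℝ} (hq0 : 0 ≤ q) (hq1 : q ≤ 1 / 4) :
    1 - (minorityPoly N).eval q ≤ (972 / 1000) ^ N := by
  have h := pow_mul_sum_bernstein_le (n := 3 * N) (N := N) (S := Finset.Ico N (3 * N + 1))
    (z := 3 / 2) (by rw [Finset.range_eq_Ico]; exact Finset.Ico_subset_Ico (by omega) le_rfl)
    hq0 (by linarith) (by norm_num) fun k hk =>
      pow_le_pow_right₀ (by norm_num) (Finset.mem_Ico.1 hk).1
  rw [one_sub_minorityPoly_eval]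
  have h2 : (3 / 2 * q + (1 - q)) ^ (3 * N) ≤ (3 / 2) ^ N * (972 / 1000 : ℝ) ^ N := by
    rw [pow_mul, ← mul_pow]
    refine pow_le_pow_left₀ (pow_nonneg (by linarith) 3) ?_ N
    calc (3 / 2 * q + (1 - q)) ^ 3 ≤ (9 / 8) ^ 3 :=
          pow_le_pow_left₀ (by linarith) (by linarith) 3
      _ ≤ _ := by norm_num
  exact le_of_mul_le_mul_left (h.trans h2) (by positivity)

theorem minorityPoly_natDegree_le (N : ℕ) : (minorityPoly N).natDegree ≤ 3 * N := by
  refine natDegree_sum_le_of_forall_le _ _ fun k hk => ?_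
  have hk := Finset.mem_range.1 hk
  have h1 : (1 - X : ℝ[X]).natDegree ≤ 1 := (natDegree_sub_le _ _).trans (by simp)
  rw [bernsteinPolynomial]
  refine natDegree_mul_le.trans ((add_le_add (natDegree_mul_le.trans (add_le_add
    (natDegree_natCast _).le (natDegree_X_pow _).le)) (natDegree_pow_le_of_le _ h1)).trans ?_)
  omega

/-- Phases that turn the overlap `x` into an amplitude with real part `R (x²)`, where `R` is close
to `0` below the threshold `2⁻ᴶ` and close to `1` above twice the threshold. A weakly separating
polynomial is sharpened by the tail of a binomial distribution. -/
theorem exists_separation_phases {J : ℕ} (hJ : 1 ≤ J) {ε : ℝ} (hε : 0 < ε) (hε1 : ε ≤ 1) :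
    ∃ (φ : ℕ → ℂ) (D : ℕ) (R : ℝ[X]), (∀ i, ‖φ i‖ = 1) ∧
      ((2 * D : ℕ) : ℝ) ≤ 500 * (2 ^ J * Real.log (2 / ε)) ∧
      (∀ t : ℝ, (signal φ t (2 * D)).1.re = R.eval t) ∧
      (∀ t ∈ Set.Icc (0 : ℝ) 1, R.eval t ^ 2 ≤ 1) ∧
      (∀ x : ℝ, 0 ≤ x → x ≤ 1 / 2 ^ J → R.eval (x ^ 2) ^ 2 ≤ ε ^ 2) ∧
      (∀ x : ℝ, 2 * (1 / 2 ^ J) ≤ x → x ≤ 1 → 1 - ε ^ 2 ≤ R.eval (x ^ 2) ^ 2) := by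
  obtain ⟨E, hEdeg, hE01, hEsmall, hElarge⟩ := exists_weak_separation hJ
  set Λ := Real.log (2 / ε) with hΛ
  have hΛ1 : 0.69 ≤ Λ := by
    have h2 : Real.log 2 ≤ Λ := Real.log_le_log two_pos (by rw [le_div_iff₀ hε]; linarith)
    linarith [Real.log_two_gt_d9]
  set N := ⌈80 * Λ⌉₊ with hN
  have hN1 : 80 * Λ ≤ N := Nat.le_ceil _
  have hN2 : (N : ℝ) ≤ 80 * Λ + 1 := (Nat.ceil_lt_add_one (by positivity)).le
  have htail : (972 / 1000 : ℝ) ^ N ≤ ε ^ 2 / 4 := by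
    have h1 : (972 / 1000 : ℝ) ≤ Real.exp (-(28 / 1000)) := by
      linarith [Real.add_one_le_exp (-(28 / 1000 : ℝ))]
    have h2 : ε ^ 2 / 4 = Real.exp (-(2 * Λ)) := by
      rw [Real.exp_neg, two_mul, Real.exp_add, hΛ, Real.exp_log (by positivity)]
      field_simp
      norm_num
    calc (972 / 1000 : ℝ) ^ N ≤ Real.exp (-(28 / 1000)) ^ N :=
          pow_le_pow_left₀ (by norm_num) h1 N
      _ = Real.exp (N * -(28 / 1000)) := (Real.exp_nat_mul _ _).symm
      _ ≤ Real.exp (-(2 * Λ)) := Real.exp_le_exp.2 (by linarith)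
      _ = _ := h2.symm
  set D := 3 * N * 2 ^ J with hD
  set R : ℝ[X] := (minorityPoly N).comp E with hR
  have hReval : ∀ t, R.eval t = (minorityPoly N).eval (E.eval t) := fun t => eval_comp
  have hRdeg : R.natDegree ≤ D := by
    rw [hR, natDegree_comp]; exact Nat.mul_le_mul (minorityPoly_natDegree_le N) hEdeg
  have hR01 : ∀ t ∈ Set.Icc (0 : ℝ) 1, 0 ≤ R.eval t ∧ R.eval t ≤ 1 := fun t ht => by
    rw [hReval]; exact minorityPoly_eval_nonneg N (hE01 t ht).1 (hE01 t ht).2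
  have hRsq : ∀ t ∈ Set.Icc (0 : ℝ) 1, R.eval t ^ 2 ≤ 1 := fun t ht =>
    pow_le_one₀ (hR01 t ht).1 (hR01 t ht).2
  have hluk : LukacsForm (2 * D) (1 - R ^ 2) := by
    refine lukacsForm_of_nonneg ?_ fun t ht => by simpa using hRsq t ht
    exact (natDegree_sub_le _ _).trans (max_le (by simp) (natDegree_pow_le_of_le 2 hRdeg))
  obtain ⟨a, b, ha, hb, hab⟩ := hluk
  rw [if_pos (by simp)] at hab
  have hpair : IsSignalPair (2 * D) (complexPoly R a) (complexPoly b 0) := by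
    refine ⟨complexPoly_degree_lt ?_ ha, complexPoly_degree_lt hb (by simp), ?_⟩
    · convert degree_lt_of_natDegree_le hRdeg using 3
      omega
    · rw [if_pos (by simp), complexPoly_mul_conj, complexPoly_mul_conj]
      have h1 : (1 : ℝ[X]) = (R ^ 2 + a ^ 2) + X * (1 - X) * (b ^ 2 + 0 ^ 2) := by
        linear_combination hab
      have h2 := congrArg (Polynomial.map (algebraMap ℝ ℂ)) h1
      simpa using h2
  obtain ⟨φ, hφ, hsig⟩ := hpair.exists_phases
  have hthr : ((1 : ℝ) / 2 ^ J) ≤ 1 := by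
    rw [div_le_one (by positivity)]; exact one_le_pow₀ (by norm_num)
  refine ⟨φ, D, R, hφ, ?_, fun t => ?_, hRsq, fun x h0 h1 => ?_, fun x h0 h1 => ?_⟩
  · rw [hD]
    push_cast
    calc (2 : ℝ) * (3 * N * 2 ^ J) = 6 * N * 2 ^ J := by ring
      _ ≤ (500 * Λ) * 2 ^ J :=
          mul_le_mul_of_nonneg_right (by linarith) (by positivity)
      _ = _ := by ring
  · rw [hsig, complexPoly_eval]
    simp
  · have hx : x ^ 2 ∈ Set.Icc (0 : ℝ) 1 :=
      ⟨by positivity, pow_le_one₀ h0 (h1.trans hthr)⟩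
    refine pow_le_pow_left₀ (hR01 _ hx).1 ?_ 2
    rw [hReval]
    have := minorityPoly_eval_le N (hEsmall x h0 h1) (hE01 _ hx).2
    nlinarith
  · have hx0 : 0 ≤ x := le_trans (by positivity) h0
    have hx : x ^ 2 ∈ Set.Icc (0 : ℝ) 1 := ⟨by positivity, pow_le_one₀ hx0 h1⟩
    have := one_sub_minorityPoly_eval_le N (hE01 _ hx).1 (hElarge x h0 h1)
    rw [← hReval] at this
    nlinarith [hR01 _ hx]

end Polynomials

/-! ### Operators on subsets of the qubits -/

section Slices

variable {R Q Q' : Type}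

/-- The vector on the qubits `R` that is obtained from `v` by fixing the qubits outside the range
of `e` to the values that they have in `x`. -/
noncomputable def slice (e : R ↪ Q) (x : Q → Bool) (v : Ket Q) : Ket R :=
  fun z => v (Function.extend e z x)

theorem extend_comp_self (e : R ↪ Q) (x : Q → Bool) : Function.extend e (x ∘ e) x = x := by
  funext q
  by_cases h : ∃ r, e r = q
  · obtain ⟨r, rfl⟩ := h
    rw [e.injective.extend_apply]; rfl
  · rw [Function.extend_apply' _ _ _ h]

theorem extend_comp (e : R ↪ Q) (z : R → Bool) (x : Q → Bool) :
    Function.extend e z x ∘ e = z := by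
  funext r
  exact e.injective.extend_apply _ _ _

theorem extend_extend (e : R ↪ Q) (w z : R → Bool) (x : Q → Bool) :
    Function.extend e w (Function.extend e z x) = Function.extend e w x := by
  funext q
  by_cases h : ∃ r, e r = q
  · obtain ⟨r, rfl⟩ := h
    simp only [e.injective.extend_apply]
  · simp only [Function.extend_apply' _ _ _ h]

theorem extend_trans (f : R ↪ Q) (e : Q ↪ Q') (w : R → Bool) (z : Q → Bool) (x : Q' → Bool) :
    Function.extend (f.trans e) w (Function.extend e z x) =
      Function.extend e (Function.extend f w z) x := by
  funext q
  by_cases h : ∃ r, e r = q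
  · obtain ⟨q, rfl⟩ := h
    rw [e.injective.extend_apply]
    by_cases h' : ∃ r, f r = q
    · obtain ⟨r, rfl⟩ := h'
      rw [f.injective.extend_apply]
      exact (f.trans e).injective.extend_apply _ _ r
    · rw [Function.extend_apply' _ _ _ h', Function.extend_apply', e.injective.extend_apply]
      rintro ⟨r, hr⟩
      exact h' ⟨r, e.injective hr⟩
  · rw [Function.extend_apply' _ _ _ h, Function.extend_apply', Function.extend_apply' _ _ _ h]
    rintro ⟨r, hr⟩
    exact h ⟨f r, hr⟩

theorem extend_eq_of_notMem (e : R ↪ Q) (z : R → Bool) (x : Q → Bool) {q : Q}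
    (hq : ∀ r, e r ≠ q) : Function.extend e z x q = x q :=
  Function.extend_apply' _ _ _ fun ⟨r, hr⟩ => hq r hr

theorem extend_eq_extend (e : R ↪ Q) (z : R → Bool) {x y : Q → Bool}
    (h : ∀ q, q ∉ Set.range e → x q = y q) : Function.extend e z x = Function.extend e z y := by
  funext q
  by_cases hq : ∃ r, e r = q
  · obtain ⟨r, rfl⟩ := hq
    simp only [e.injective.extend_apply]
  · rw [Function.extend_apply' _ _ _ hq, Function.extend_apply' _ _ _ hq, h q hq]

theorem slice_self (e : R ↪ Q) (x : Q → Bool) (v : Ket Q) : slice e x v (x ∘ e) = v x := by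
  rw [slice, extend_comp_self]

theorem slice_extend (e : R ↪ Q) (x : Q → Bool) (z : R → Bool) (v : Ket Q) :
    slice e (Function.extend e z x) v = slice e x v := by
  funext w
  rw [slice, slice, extend_extend]

theorem slice_trans (f : R ↪ Q) (e : Q ↪ Q') (z : Q → Bool) (x : Q' → Bool) (v : Ket Q') :
    slice (f.trans e) (Function.extend e z x) v = slice f z (slice e x v) := by
  funext w
  rw [slice, slice, slice, extend_trans]

/-- The condition `P` does not depend on the qubits in the range of `e`. -/
def IndepOf (e : R ↪ Q) (P : (Q → Bool) → Prop) : Prop :=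
  ∀ x z, P (Function.extend e z x) ↔ P x

theorem IndepOf.iff_of_place_ne_zero {e : R ↪ Q} {P : (Q → Bool) → Prop} (hP : IndepOf e P)
    {M : Op R} {x y : Q → Bool} (h : place e M x y ≠ 0) : P x ↔ P y := by
  have hxy : ∀ q, q ∉ Set.range e → x q = y q := by
    by_contra hc
    exact h (if_neg hc)
  rw [← hP x (y ∘ e), extend_eq_extend e _ hxy, extend_comp_self]

theorem indepOf_controls {S : Finset Q} {e : R ↪ Q} (he : ∀ r, e r ∉ S) :
    IndepOf e fun y => ∀ c ∈ S, y c = true := fun x z =>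
  forall₂_congr fun c hc => by
    rw [extend_eq_of_notMem]
    rintro r rfl
    exact he r hc

theorem conjTranspose_place (e : R ↪ Q) (M : Op R) : (place e M)ᴴ = place e Mᴴ := by
  ext x y
  by_cases h : ∀ q, q ∉ Set.range e → x q = y q
  · exact (congrArg star (if_pos fun q hq => (h q hq).symm)).trans (if_pos h).symm
  · exact ((congrArg star (if_neg fun h' => h fun q hq => (h' q hq).symm)).trans
      (star_zero _)).trans (if_neg h).symm

theorem conjTranspose_controlled_place {e : R ↪ Q} {P : (Q → Bool) → Prop} (hP : IndepOf e P)
    (M : Op R) : (controlled P (place e M))ᴴ = controlled P (place e Mᴴ) := by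
  ext x y
  rw [← conjTranspose_place]
  simp only [controlled, Matrix.conjTranspose_apply, Matrix.of_apply]
  by_cases hx : P x <;> by_cases hy : P y
  · rw [if_pos hx, if_pos hy]
  · have h0 : place e M y x = 0 := by
      by_contra h
      exact hy ((hP.iff_of_place_ne_zero h).2 hx)
    rw [if_pos hx, if_neg hy, if_neg (by rintro rfl; exact hy hx), h0, star_zero]
  · have h0 : place e M y x = 0 := by
      by_contra h
      exact hx ((hP.iff_of_place_ne_zero h).1 hy)
    rw [if_neg hx, if_pos hy, if_neg (by rintro rfl; exact hx hy), h0, star_zero]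
  · rw [if_neg hx, if_neg hy]
    by_cases h : x = y
    · rw [if_pos h, if_pos h.symm, star_one]
    · rw [if_neg h, if_neg (Ne.symm h), star_zero]

end Slices

section Placed

variable {R Q : Type} [DecidableEq R] [Fintype R] [DecidableEq Q] [Fintype Q]

theorem place_mulVec (e : R ↪ Q) (M : Op R) (v : Ket Q) (x : Q → Bool) :
    (place e M *ᵥ v) x = (M *ᵥ slice e x v) (x ∘ e) := by
  simp only [Matrix.mulVec, dotProduct]
  have hinj : Function.Injective fun z : R → Bool => Function.extend e z x := fun z w h => by
    rw [← extend_comp e z x, ← extend_comp e w x]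
    exact congrArg (· ∘ e) h
  refine (Fintype.sum_of_injective _ hinj _ _ (fun y hy => ?_) fun z => ?_).symm
  · rw [place, Matrix.of_apply, if_neg, zero_mul]
    intro h
    refine hy ⟨y ∘ e, ?_⟩
    have h1 : Function.extend e (y ∘ e) x = Function.extend e (y ∘ e) y := extend_eq_extend _ _ h
    exact h1.trans (extend_comp_self e y)
  · rw [place, Matrix.of_apply, if_pos, extend_comp, slice]
    intro q hq
    rw [extend_eq_of_notMem]
    exact fun r hr => hq ⟨r, hr⟩

/-- `controlled` tests the input basis vector; if `M` preserves the condition, the output may be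
tested instead. -/
theorem controlled_mulVec {P : (Q → Bool) → Prop} [DecidablePred P] {M : Op Q}
    (hP : ∀ x y, M x y ≠ 0 → (P x ↔ P y)) (v : Ket Q) (x : Q → Bool) :
    (controlled P M *ᵥ v) x = if P x then (M *ᵥ v) x else v x := by
  simp only [Matrix.mulVec, dotProduct, controlled, Matrix.of_apply]
  split_ifs with hx
  · refine Finset.sum_congr rfl fun y _ => ?_
    by_cases hy : P y
    · rw [if_pos hy]
    · have h0 : M x y = 0 := by
        by_contra h
        exact hy ((hP x y h).1 hx)
      rw [if_neg hy, if_neg (by rintro rfl; exact hy hx), h0]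
  · rw [Finset.sum_eq_single x]
    · simp [hx]
    · intro y _ hy
      by_cases hPy : P y
      · have h0 : M x y = 0 := by
          by_contra h
          exact hx ((hP x y h).2 hPy)
        rw [if_pos hPy, h0, zero_mul]
      · rw [if_neg hPy, if_neg hy.symm, zero_mul]
    · simp

theorem controlled_place_mulVec {e : R ↪ Q} {P : (Q → Bool) → Prop} [DecidablePred P]
    (hP : IndepOf e P) (M : Op R) (v : Ket Q) (x : Q → Bool) :
    (controlled P (place e M) *ᵥ v) x =
      if P x then (M *ᵥ slice e x v) (x ∘ e) else v x := by
  rw [controlled_mulVec (fun x y h => hP.iff_of_place_ne_zero h), place_mulVec]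

theorem slice_controlled_place {e : R ↪ Q} {P : (Q → Bool) → Prop} [DecidablePred P]
    (hP : IndepOf e P) (M : Op R) (v : Ket Q) (x : Q → Bool) :
    slice e x (controlled P (place e M) *ᵥ v) =
      if P x then M *ᵥ slice e x v else slice e x v := by
  funext z
  rw [slice, controlled_place_mulVec hP, slice_extend, extend_comp]
  simp only [hP x z]
  split_ifs <;> rfl

theorem ext_mulVec {A B : Op Q} (h : ∀ v x, (A *ᵥ v) x = (B *ᵥ v) x) : A = B :=
  Matrix.ext_of_mulVec_single fun _ => funext fun x => h _ x

theorem controlled_place_mem_unitaryGroup {e : R ↪ Q} {P : (Q → Bool) → Prop} (hP : IndepOf e P)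
    {M : Op R} (hM : M ∈ Matrix.unitaryGroup (R → Bool) ℂ) :
    controlled P (place e M) ∈ Matrix.unitaryGroup (Q → Bool) ℂ := by
  classical
  rw [Matrix.mem_unitaryGroup_iff', Matrix.star_eq_conjTranspose, conjTranspose_controlled_place hP]
  refine ext_mulVec fun v x => ?_
  rw [← Matrix.mulVec_mulVec, controlled_place_mulVec hP, slice_controlled_place hP,
    controlled_place_mulVec hP, Matrix.one_mulVec]
  split_ifs with hx
  · rw [Matrix.mulVec_mulVec, ← Matrix.star_eq_conjTranspose, Matrix.mem_unitaryGroup_iff'.1 hM,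
      Matrix.one_mulVec, slice_self]
  · rfl

end Placed

/-! ### Elementary circuits -/

section Basic

variable {R Q : Type}

/-- The embedding of a single qubit. -/
def qubitEmb (t : Q) : Unit ↪ Q := ⟨fun _ => t, fun _ _ _ => rfl⟩

/-- A one-qubit matrix as an operator on the qubits labelled by `Unit`. -/
def unitOp (u : Matrix Bool Bool ℂ) : Op Unit := u.submatrix (fun x => x ()) (fun x => x ())

namespace Step

/-- The inverse of a step. -/
def inverse : Step R Q → Step R Q
  | gate S t ht u => gate S t ht u⁻¹
  | query S e he inv => query S e he !inv

theorem op_inverse (O : Op R) (s : Step R Q) :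
    s.inverse.op O = (s.op O)ᴴ := by
  cases s with
  | gate S t ht u =>
    exact (conjTranspose_controlled_place
      (indepOf_controls (e := qubitEmb t) fun _ => ht) (unitOp u.1)).symm
  | query S e he inv =>
    refine Eq.trans ?_ (conjTranspose_controlled_place (indepOf_controls he) _).symm
    cases inv <;> simp [inverse, op]

theorem queries_inverse (s : Step R Q) : s.inverse.queries = s.queries := by cases s <;> rfl

theorem size_inverse (s : Step R Q) : s.inverse.size = s.size := by cases s <;> rfl

theorem one_le_size (s : Step R Q) : 1 ≤ s.size := by cases s <;> simp [size]

end Step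

namespace Circuit

theorem queries_append (c d : Circuit R Q) : queries (c ++ d) = queries c + queries d := by
  simp [queries]

theorem size_append (c d : Circuit R Q) : size (c ++ d) = size c + size d := by
  simp [size]

/-- The inverse of a circuit. -/
def inverse (c : Circuit R Q) : Circuit R Q := (c.map Step.inverse).reverse

theorem queries_inverse (c : Circuit R Q) : queries c.inverse = queries c := by
  rw [inverse, queries, queries, List.map_reverse, List.sum_reverse, List.map_map]
  exact congrArg List.sum (List.map_congr_left fun s _ => s.queries_inverse)

theorem size_inverse (c : Circuit R Q) : size c.inverse = size c := by
  rw [inverse, size, size, List.map_reverse, List.sum_reverse, List.map_map]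
  exact congrArg List.sum (List.map_congr_left fun s _ => s.size_inverse)

end Circuit

end Basic

section Circuits

variable {R Q : Type} [DecidableEq Q]

theorem extend_qubitEmb (t : Q) (z : Unit → Bool) (x : Q → Bool) :
    Function.extend (qubitEmb t) z x = Function.update x t (z ()) := by
  funext q
  by_cases hq : q = t
  · subst hq
    rw [Function.update_self]
    exact (qubitEmb q).injective.extend_apply _ _ ()
  · rw [Function.update_of_ne hq, extend_eq_of_notMem]
    exact fun _ h => hq h.symm

theorem unitOp_mem_unitaryGroup (u : Matrix.unitaryGroup Bool ℂ) :
    unitOp u.1 ∈ Matrix.unitaryGroup (Unit → Bool) ℂ := by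
  rw [Matrix.mem_unitaryGroup_iff', Matrix.star_eq_conjTranspose]
  have h := Matrix.mem_unitaryGroup_iff'.1 u.2
  rw [Matrix.star_eq_conjTranspose] at h
  let e := Equiv.funUnique Unit Bool
  change (u.1ᴴ.submatrix e e) * (u.1.submatrix e e) = 1
  rw [Matrix.submatrix_mul_equiv, h, Matrix.submatrix_one_equiv]

theorem gate_op_mulVec [Fintype Q] (O : Op R) (S : Finset Q) (t : Q) (ht : t ∉ S)
    (u : Matrix.unitaryGroup Bool ℂ) (v : Ket Q) (x : Q → Bool) :
    ((Step.gate S t ht u : Step R Q).op O *ᵥ v) x =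
      if ∀ c ∈ S, x c = true then ∑ b, u.1 (x t) b * v (Function.update x t b) else v x := by
  have := controlled_place_mulVec (indepOf_controls (e := qubitEmb t) fun _ => ht) (unitOp u.1) v x
  refine this.trans ?_
  congr 1
  simp only [Matrix.mulVec, dotProduct, slice, extend_qubitEmb]
  exact (Equiv.funUnique Unit Bool).sum_comp (fun b => u.1 (x t) b * v (Function.update x t b))

theorem query_op_mulVec [DecidableEq R] [Fintype R] [Fintype Q] (O : Op R) (S : Finset Q)
    (e : R ↪ Q) (he : ∀ r, e r ∉ S) (inv : Bool) (v : Ket Q) (x : Q → Bool) :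
    ((Step.query S e he inv : Step R Q).op O *ᵥ v) x =
      if ∀ c ∈ S, x c = true then ((if inv then Oᴴ else O) *ᵥ slice e x v) (x ∘ e) else v x :=
  controlled_place_mulVec (indepOf_controls he) _ v x

namespace Step

theorem op_mem_unitaryGroup [DecidableEq R] [Fintype R] [Fintype Q] {O : Op R}
    (hO : O ∈ Matrix.unitaryGroup (R → Bool) ℂ) (s : Step R Q) :
    s.op O ∈ Matrix.unitaryGroup (Q → Bool) ℂ := by
  cases s with
  | gate S t ht u =>
    exact controlled_place_mem_unitaryGroup (indepOf_controls (e := qubitEmb t) fun _ => ht)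
      (unitOp_mem_unitaryGroup u)
  | query S e he inv =>
    refine controlled_place_mem_unitaryGroup (indepOf_controls he) ?_
    cases inv
    · exact hO
    · exact Unitary.star_mem hO

end Step

namespace Circuit

theorem op_append [Fintype Q] (O : Op R) (c d : Circuit R Q) : op O (c ++ d) = op O d * op O c := by
  induction c with
  | nil => simp [op]
  | cons s c ih => simp [op, ih, Matrix.mul_assoc]

theorem op_append_mulVec [Fintype Q] (O : Op R) (c d : Circuit R Q) (v : Ket Q) :
    op O (c ++ d) *ᵥ v = op O d *ᵥ (op O c *ᵥ v) := by
  rw [op_append, Matrix.mulVec_mulVec]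

theorem op_singleton [Fintype Q] (O : Op R) (s : Step R Q) : op O [s] = s.op O := by
  simp [op]

theorem op_mem_unitaryGroup [DecidableEq R] [Fintype R] [Fintype Q] {O : Op R}
    (hO : O ∈ Matrix.unitaryGroup (R → Bool) ℂ) (c : Circuit R Q) :
    op O c ∈ Matrix.unitaryGroup (Q → Bool) ℂ := by
  induction c with
  | nil => exact one_mem _
  | cons s c ih => exact mul_mem ih (s.op_mem_unitaryGroup hO)

theorem op_inverse [Fintype Q] (O : Op R) (c : Circuit R Q) :
    op O c.inverse = (op O c)ᴴ := by
  induction c with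
  | nil => simp [op, inverse]
  | cons s c ih =>
    rw [inverse, List.map_cons, List.reverse_cons, op_append, op_singleton, op,
      Matrix.conjTranspose_mul, Step.op_inverse, ← ih, inverse]

end Circuit

end Circuits

/-! ### Circuits on a subset of the qubits, with further controls -/

section Embedding

variable {R Q Q' : Type} [DecidableEq Q']

/-- The step on the qubits in the range of `e`, with the additional controls `S`. -/
def Step.embed (e : Q ↪ Q') (S : Finset Q') (hS : ∀ q, e q ∉ S) : Step R Q → Step R Q'
  | gate S' t ht u => gate (S'.map e ∪ S) (e t) (by simp [hS, ht]) u
  | query S' f hf inv => query (S'.map e ∪ S) (f.trans e) (by simp [hS, hf]) inv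

theorem controls_extend {e : Q ↪ Q'} {S : Finset Q'} (hS : ∀ q, e q ∉ S) (S' : Finset Q)
    (z : Q → Bool) (x : Q' → Bool) :
    (∀ c ∈ S'.map e ∪ S, Function.extend e z x c = true) ↔
      (∀ c ∈ S', z c = true) ∧ ∀ c ∈ S, x c = true := by
  simp only [Finset.mem_union, or_imp, forall_and, Finset.mem_map, forall_exists_index, and_imp,
    forall_apply_eq_imp_iff₂, e.injective.extend_apply]
  exact and_congr_right fun _ => indepOf_controls hS x z

theorem slice_controlled_place_trans {P : Type} [DecidableEq P] [Fintype P] [DecidableEq Q]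
    [Fintype Q] [Fintype Q'] {f : P ↪ Q} {e : Q ↪ Q'} {S : Finset Q'} (hS : ∀ q, e q ∉ S)
    {S' : Finset Q} (hf : ∀ p, f p ∉ S') (M : Op P) (v : Ket Q') (x : Q' → Bool) :
    slice e x (controlled (fun y => ∀ c ∈ S'.map e ∪ S, y c = true) (place (f.trans e) M) *ᵥ v) =
      if ∀ c ∈ S, x c = true then
        controlled (fun y => ∀ c ∈ S', y c = true) (place f M) *ᵥ slice e x v
      else slice e x v := by
  funext z
  rw [slice, controlled_place_mulVec (indepOf_controls (by simp [hS, hf]))]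
  simp only [controls_extend hS]
  by_cases hx : ∀ c ∈ S, x c = true
  · rw [if_pos hx, controlled_place_mulVec (indepOf_controls hf), slice_trans,
      show Function.extend e z x ∘ f.trans e = (Function.extend e z x ∘ e) ∘ f from rfl,
      extend_comp]
    by_cases hz : ∀ c ∈ S', z c = true
    · rw [if_pos ⟨hz, hx⟩, if_pos hz]
    · rw [if_neg fun h => hz h.1, if_neg hz]
      rfl
  · rw [if_neg fun h => hx h.2, if_neg hx]
    rfl

theorem Step.slice_op_embed [DecidableEq R] [Fintype R] [DecidableEq Q] [Fintype Q] [Fintype Q']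
    {e : Q ↪ Q'} {S : Finset Q'} (hS : ∀ q, e q ∉ S) (O : Op R) (s : Step R Q) (v : Ket Q')
    (x : Q' → Bool) :
    slice e x ((s.embed e S hS).op O *ᵥ v) =
      if ∀ c ∈ S, x c = true then s.op O *ᵥ slice e x v else slice e x v := by
  cases s with
  | gate S' t ht u =>
    exact slice_controlled_place_trans (f := qubitEmb t) hS (fun _ => ht) (unitOp u.1) v x
  | query S' f hf inv => exact slice_controlled_place_trans hS hf _ v x

/-- The circuit on the qubits in the range of `e`, with the additional controls `S`. -/
def Circuit.embed (e : Q ↪ Q') (S : Finset Q') (hS : ∀ q, e q ∉ S) (c : Circuit R Q) :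
    Circuit R Q' :=
  c.map (Step.embed e S hS)

/-- On every slice along `e`, the embedded circuit acts as the original circuit or, if the
additional controls are off, as the identity. -/
theorem Circuit.slice_op_embed [DecidableEq R] [Fintype R] [DecidableEq Q] [Fintype Q] [Fintype Q']
    {e : Q ↪ Q'} {S : Finset Q'} (hS : ∀ q, e q ∉ S) (O : Op R) (c : Circuit R Q) (v : Ket Q')
    (x : Q' → Bool) :
    slice e x (Circuit.op O (c.embed e S hS) *ᵥ v) =
      if ∀ c ∈ S, x c = true then Circuit.op O c *ᵥ slice e x v else slice e x v := by
  induction c generalizing v with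
  | nil => simp [Circuit.embed, Circuit.op]
  | cons s c ih =>
    rw [Circuit.embed, List.map_cons, Circuit.op, Circuit.op, ← Matrix.mulVec_mulVec]
    refine (ih _).trans ?_
    rw [Step.slice_op_embed]
    split_ifs
    · rw [Matrix.mulVec_mulVec]
    · rfl

theorem Circuit.queries_embed {e : Q ↪ Q'} {S : Finset Q'} (hS : ∀ q, e q ∉ S)
    (c : Circuit R Q) : (c.embed e S hS).queries = c.queries := by
  rw [embed, queries, queries, List.map_map]
  exact congrArg List.sum (List.map_congr_left fun s _ => by cases s <;> rfl)

theorem Circuit.size_embed_le {e : Q ↪ Q'} {S : Finset Q'} (hS : ∀ q, e q ∉ S)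
    (c : Circuit R Q) : (c.embed e S hS).size ≤ (1 + S.card) * c.size := by
  induction c with
  | nil => simp [embed, size]
  | cons s c ih =>
    have h1 : (s.embed e S hS).size ≤ (1 + S.card) * s.size := by
      have h2 : (s.embed e S hS).size ≤ s.size + S.card := by
        cases s <;> simp only [Step.embed, Step.size] <;>
          exact (Nat.add_le_add_left (Finset.card_union_le _ _) 1).trans
            (by rw [Finset.card_map]; omega)
      nlinarith [s.one_le_size]
    calc size (embed e S hS (s :: c)) = (s.embed e S hS).size + size (embed e S hS c) := by
          simp [embed, size]
      _ ≤ (1 + S.card) * s.size + (1 + S.card) * size c := add_le_add h1 ih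
      _ = (1 + S.card) * (s.size + size c) := by ring
      _ = _ := by simp [size]

end Embedding

/-! ### Gadgets -/

/-- The one-qubit gate `X`. -/
def notGate : Matrix.unitaryGroup Bool ℂ :=
  ⟨Matrix.of fun a b => if a = b then 0 else 1, by
    rw [Matrix.mem_unitaryGroup_iff']
    ext a b
    cases a <;> cases b <;> simp [Matrix.mul_apply]⟩

/-- The Hadamard gate. -/
noncomputable def hadamard : Matrix.unitaryGroup Bool ℂ :=
  ⟨Matrix.of fun a b => (((√2)⁻¹ : ℝ) : ℂ) * if a && b then -1 else 1, by
    have h : (((√2)⁻¹ : ℝ) : ℂ) * (((√2)⁻¹ : ℝ) : ℂ) = 1 / 2 := by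
      rw [← Complex.ofReal_mul, ← mul_inv, Real.mul_self_sqrt zero_le_two]
      norm_num
    rw [Matrix.mem_unitaryGroup_iff']
    ext a b
    cases a <;> cases b <;>
      simp only [Matrix.mul_apply, Fintype.sum_bool, Matrix.star_apply, Matrix.of_apply, star_mul',
        Complex.star_def, Complex.conj_ofReal] <;> simp <;>
      norm_num at h ⊢ <;> linear_combination 2 * h⟩

/-- The gate `diag(c, c̄)`. -/
def phaseGate (c : ℂ) (hc : ‖c‖ = 1) : Matrix.unitaryGroup Bool ℂ :=
  ⟨Matrix.diagonal fun a => if a then starRingEnd ℂ c else c, by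
    have h : c * starRingEnd ℂ c = 1 := by
      rw [Complex.mul_conj, Complex.normSq_eq_norm_sq, hc]; simp
    rw [Matrix.mem_unitaryGroup_iff', Matrix.star_eq_conjTranspose, Matrix.diagonal_conjTranspose,
      Matrix.diagonal_mul_diagonal, ← Matrix.diagonal_one]
    congr 1
    funext a
    cases a
    · simpa [mul_comm] using h
    · simpa using h⟩

section Flips

variable {R Q ι : Type}

open Classical in
/-- The bits at the targets `tgt i` with `p i` are negated. -/
noncomputable def flipFn (tgt : ι → Q) (p : ι → Prop) (x : Q → Bool) : Q → Bool :=
  fun q => if ∃ i, tgt i = q ∧ p i then !x q else x q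

theorem flipFn_of_ne {tgt : ι → Q} {q : Q} (hq : ∀ i, tgt i ≠ q) (p : ι → Prop) (x : Q → Bool) :
    flipFn tgt p x q = x q := by
  rw [flipFn, if_neg]
  rintro ⟨i, hi, _⟩
  exact hq i hi

theorem flipFn_apply {tgt : ι → Q} (ht : Function.Injective tgt) (p : ι → Prop) [DecidablePred p]
    (x : Q → Bool) (i : ι) : flipFn tgt p x (tgt i) = if p i then !x (tgt i) else x (tgt i) := by
  have : (∃ j, tgt j = tgt i ∧ p j) ↔ p i :=
    ⟨fun ⟨j, h, hp⟩ => ht h ▸ hp, fun h => ⟨i, rfl, h⟩⟩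
  simp only [flipFn, this]

theorem flipFn_flipFn {tgt : ι → Q} (p : ι → Prop) (x : Q → Bool) :
    flipFn tgt p (flipFn tgt p x) = x := by
  funext q
  unfold flipFn
  split_ifs <;> simp

/-- The bits at the targets `tgt i`, `i ∈ s`, are negated, with controls `S i`. No target is a
control, so the order of the gates is immaterial. -/
noncomputable def flipLayer (R : Type) (tgt : ι → Q) (S : ι → Finset Q)
    (h : ∀ i j, tgt i ∉ S j) (s : Finset ι) : Circuit R Q :=
  s.toList.map fun i => Step.gate (S i) (tgt i) (h i i) notGate

theorem flipLayer_queries (tgt : ι → Q) (S : ι → Finset Q) (h : ∀ i j, tgt i ∉ S j)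
    (s : Finset ι) : (flipLayer R tgt S h s).queries = 0 := by
  simp [flipLayer, Circuit.queries, Function.comp_def, Step.queries]

theorem flipLayer_size (tgt : ι → Q) (S : ι → Finset Q) (h : ∀ i j, tgt i ∉ S j)
    (s : Finset ι) : (flipLayer R tgt S h s).size = ∑ i ∈ s, (1 + (S i).card) := by
  simp [flipLayer, Circuit.size, Function.comp_def, Step.size]

/-- The circuit `c`, conjugated by negations of the qubits in `S`; this turns controls on `1` into
controls on `0`. -/
noncomputable def conjNot (S : Finset Q) (c : Circuit R Q) : Circuit R Q :=
  flipLayer R id (fun _ => ∅) (by simp) S ++ (c ++ flipLayer R id (fun _ => ∅) (by simp) S)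

theorem conjNot_queries (S : Finset Q) (c : Circuit R Q) :
    (conjNot S c).queries = c.queries := by
  simp only [conjNot, Circuit.queries_append, flipLayer_queries, zero_add, add_zero]

theorem conjNot_size (S : Finset Q) (c : Circuit R Q) :
    (conjNot S c).size = c.size + 2 * S.card := by
  simp only [conjNot, Circuit.size_append, flipLayer_size, Finset.card_empty, add_zero,
    Finset.sum_const, smul_eq_mul, mul_one]
  ring

/-- A one-qubit gate, applied if all qubits in `S` are `0`. -/
noncomputable def zeroGate (R : Type) (S : Finset Q) (t : Q) (ht : t ∉ S)
    (u : Matrix.unitaryGroup Bool ℂ) : Circuit R Q :=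
  conjNot S [Step.gate S t ht u]

theorem zeroGate_queries (S : Finset Q) (t : Q) (ht : t ∉ S) (u : Matrix.unitaryGroup Bool ℂ) :
    (zeroGate R S t ht u).queries = 0 := conjNot_queries _ _

theorem zeroGate_size (S : Finset Q) (t : Q) (ht : t ∉ S) (u : Matrix.unitaryGroup Bool ℂ) :
    (zeroGate R S t ht u).size = 1 + 3 * S.card := by
  rw [zeroGate, conjNot_size]
  simp [Circuit.size, Step.size]
  ring

variable [DecidableEq Q]

theorem notGate_op_mulVec [Fintype Q] (O : Op R) (S : Finset Q) (t : Q) (ht : t ∉ S) (v : Ket Q)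
    (x : Q → Bool) : ((Step.gate S t ht notGate : Step R Q).op O *ᵥ v) x =
      if ∀ c ∈ S, x c = true then v (Function.update x t (!x t)) else v x := by
  rw [gate_op_mulVec]
  congr 1
  cases h : x t <;> simp [notGate]

theorem phaseGate_op_mulVec [Fintype Q] (O : Op R) (S : Finset Q) (t : Q) (ht : t ∉ S) {c : ℂ}
    (hc : ‖c‖ = 1) (v : Ket Q) (x : Q → Bool) :
    ((Step.gate S t ht (phaseGate c hc) : Step R Q).op O *ᵥ v) x =
      if ∀ c ∈ S, x c = true then (if x t then starRingEnd ℂ c else c) * v x else v x := by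
  rw [gate_op_mulVec]
  congr 1
  rw [Finset.sum_eq_single (x t)]
  · rw [Function.update_eq_self]
    simp [phaseGate]
  · intro b _ hb
    simp [phaseGate, Matrix.diagonal_apply_ne _ hb.symm]
  · simp

theorem flipLayer_op_mulVec [Fintype Q] (O : Op R) {tgt : ι → Q} (ht : Function.Injective tgt)
    {S : ι → Finset Q} (h : ∀ i j, tgt i ∉ S j) (s : Finset ι) (v : Ket Q) (x : Q → Bool) :
    (Circuit.op O (flipLayer R tgt S h s) *ᵥ v) x =
      v (flipFn tgt (fun i => i ∈ s ∧ ∀ c ∈ S i, x c = true) x) := by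
  suffices H : ∀ l : List ι, l.Nodup →
      ∀ v, (Circuit.op O (l.map fun i => (Step.gate (S i) (tgt i) (h i i) notGate : Step R Q)) *ᵥ v)
        x = v (flipFn tgt (fun i => i ∈ l ∧ ∀ c ∈ S i, x c = true) x) by
    have := H s.toList s.nodup_toList v
    simp only [Finset.mem_toList] at this
    exact this
  intro l
  classical
  induction l with
  | nil =>
    intro _ v
    have : flipFn tgt (fun i => i ∈ ([] : List ι) ∧ ∀ c ∈ S i, x c = true) x = x := by
      funext q; simp [flipFn]
    rw [this]
    simp [Circuit.op]
  | cons i l ih =>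
    intro hl v
    rw [List.nodup_cons] at hl
    rw [List.map_cons, Circuit.op, ← Matrix.mulVec_mulVec, ih hl.2, notGate_op_mulVec]
    set y := flipFn tgt (fun i => i ∈ l ∧ ∀ c ∈ S i, x c = true) x with hy
    have hctrl : (∀ c ∈ S i, y c = true) ↔ ∀ c ∈ S i, x c = true :=
      forall₂_congr fun c hc => by
        rw [hy, flipFn_of_ne]
        rintro j rfl
        exact h j i hc
    have hyi : y (tgt i) = x (tgt i) := by
      rw [hy, flipFn_apply ht, if_neg fun h => hl.1 h.1]
    have hother : ∀ q, q ≠ tgt i →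
        y q = flipFn tgt (fun j => j ∈ i :: l ∧ ∀ c ∈ S j, x c = true) x q := by
      intro q hq
      by_cases hj : ∃ j, tgt j = q
      · obtain ⟨j, rfl⟩ := hj
        have hji : j ≠ i := fun e => hq (by rw [e])
        rw [hy, flipFn_apply ht, flipFn_apply ht]
        simp [hji]
      · rw [hy, flipFn_of_ne fun j e => hj ⟨j, e⟩, flipFn_of_ne fun j e => hj ⟨j, e⟩]
    simp only [hctrl]
    split_ifs with hx
    · congr 1
      funext q
      by_cases hq : q = tgt i
      · rw [hq, Function.update_self, hyi, flipFn_apply ht, if_pos ⟨List.mem_cons_self, hx⟩]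
      · rw [Function.update_of_ne hq, hother q hq]
    · congr 1
      funext q
      by_cases hq : q = tgt i
      · rw [hq, hyi, flipFn_apply ht, if_neg fun h => hx h.2]
      · rw [hother q hq]

/-- The bits in `S` are negated. -/
def negOn (S : Finset Q) (x : Q → Bool) : Q → Bool := fun q => if q ∈ S then !x q else x q

theorem negOn_negOn (S : Finset Q) (x : Q → Bool) : negOn S (negOn S x) = x := by
  funext q
  unfold negOn
  split_ifs <;> simp

theorem negOn_of_notMem {S : Finset Q} {q : Q} (hq : q ∉ S) (x : Q → Bool) :
    negOn S x q = x q := if_neg hq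

theorem negOn_ctrl (S : Finset Q) (x : Q → Bool) :
    (∀ c ∈ S, negOn S x c = true) ↔ ∀ c ∈ S, x c = false :=
  forall₂_congr fun c hc => by rw [negOn, if_pos hc]; simp

theorem conjNot_op_mulVec [Fintype Q] (O : Op R) (S : Finset Q) (c : Circuit R Q) (v : Ket Q)
    (x : Q → Bool) :
    (Circuit.op O (conjNot S c) *ᵥ v) x =
      (Circuit.op O c *ᵥ fun y => v (negOn S y)) (negOn S x) := by
  have h : ∀ v : Ket Q, (Circuit.op O (flipLayer R id (fun _ => ∅) (by simp) S) *ᵥ v) =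
      fun y => v (negOn S y) := fun v => by
    funext y
    rw [flipLayer_op_mulVec O Function.injective_id]
    congr 1
    funext q
    simp [flipFn, negOn]
  rw [conjNot, Circuit.op_append_mulVec, Circuit.op_append_mulVec, h, h]

theorem zeroGate_op_mulVec [Fintype Q] (O : Op R) (S : Finset Q) (t : Q) (ht : t ∉ S)
    (u : Matrix.unitaryGroup Bool ℂ) (v : Ket Q) (x : Q → Bool) :
    (Circuit.op O (zeroGate R S t ht u) *ᵥ v) x =
      if ∀ c ∈ S, x c = false then ∑ b, u.1 (x t) b * v (Function.update x t b) else v x := by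
  rw [zeroGate, conjNot_op_mulVec, Circuit.op_singleton, gate_op_mulVec]
  simp only [negOn_ctrl, negOn_negOn, negOn_of_notMem ht]
  congr 1
  refine Finset.sum_congr rfl fun b _ => ?_
  congr 2
  funext q
  by_cases hq : q = t
  · rw [hq, Function.update_self, negOn_of_notMem ht, Function.update_self]
  · rw [Function.update_of_ne hq]
    by_cases hS : q ∈ S
    · rw [negOn, if_pos hS, Function.update_of_ne hq, negOn, if_pos hS, Bool.not_not]
    · rw [negOn_of_notMem hS, Function.update_of_ne hq, negOn_of_notMem hS]

theorem zero_phaseGate_op_mulVec [Fintype Q] (O : Op R) (S : Finset Q) (t : Q) (ht : t ∉ S) {c : ℂ}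
    (hc : ‖c‖ = 1) (v : Ket Q) (x : Q → Bool) :
    (Circuit.op O (zeroGate R S t ht (phaseGate c hc)) *ᵥ v) x =
      if ∀ c ∈ S, x c = false then (if x t then starRingEnd ℂ c else c) * v x else v x := by
  rw [zeroGate, conjNot_op_mulVec, Circuit.op_singleton, phaseGate_op_mulVec]
  simp only [negOn_ctrl, negOn_negOn, negOn_of_notMem ht]

/-- The bits `src i` are added to the bits `tgt i`, if all qubits in `S` are `0`. -/
noncomputable def addLayer (R : Type) [Fintype ι] (S : Finset Q) (src tgt : ι → Q)
    (hS : ∀ i, tgt i ∉ S) (hst : ∀ i j, tgt i ≠ src j) : Circuit R Q :=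
  conjNot S (flipLayer R tgt (fun i => insert (src i) S) (by simp [hS, hst]) Finset.univ)

theorem addLayer_op_mulVec [Fintype Q] [Fintype ι] (O : Op R) {S : Finset Q} {src tgt : ι → Q}
    (hS : ∀ i, tgt i ∉ S) (hst : ∀ i j, tgt i ≠ src j) (ht : Function.Injective tgt)
    (hsrc : ∀ i, src i ∉ S) (v : Ket Q) (x : Q → Bool) :
    (Circuit.op O (addLayer R S src tgt hS hst) *ᵥ v) x =
      v (flipFn tgt (fun i => x (src i) = true ∧ ∀ c ∈ S, x c = false) x) := by
  classical
  rw [addLayer, conjNot_op_mulVec, flipLayer_op_mulVec O ht]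
  congr 1
  simp only [Finset.mem_univ, true_and, Finset.forall_mem_insert, negOn_ctrl,
    negOn_of_notMem (hsrc _)]
  funext q
  by_cases hj : ∃ j, tgt j = q
  · obtain ⟨j, rfl⟩ := hj
    rw [negOn_of_notMem (hS j), flipFn_apply ht, flipFn_apply ht, negOn_of_notMem (hS j)]
  · rw [flipFn_of_ne fun j e => hj ⟨j, e⟩]
    conv_rhs => rw [← negOn_negOn S x]
    unfold negOn
    rw [flipFn_of_ne fun j e => hj ⟨j, e⟩]

theorem addLayer_queries [Fintype ι] {S : Finset Q} {src tgt : ι → Q}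
    (hS : ∀ i, tgt i ∉ S) (hst : ∀ i j, tgt i ≠ src j) :
    (addLayer R S src tgt hS hst).queries = 0 := by
  rw [addLayer, conjNot_queries, flipLayer_queries]

theorem addLayer_size_le [Fintype ι] {S : Finset Q} {src tgt : ι → Q}
    (hS : ∀ i, tgt i ∉ S) (hst : ∀ i j, tgt i ≠ src j) :
    (addLayer R S src tgt hS hst).size ≤ Fintype.card ι * (2 + S.card) + 2 * S.card := by
  rw [addLayer, conjNot_size, flipLayer_size]
  refine Nat.add_le_add_right ?_ _
  refine (Finset.sum_le_card_nsmul Finset.univ _ (2 + S.card) fun i _ => ?_).trans ?_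
  · have := Finset.card_insert_le (src i) S
    omega
  · simp

end Flips

section ZeroEmbed

variable {R Q Q' : Type} [DecidableEq R] [Fintype R] [DecidableEq Q] [Fintype Q] [DecidableEq Q']
  [Fintype Q']

/-- A circuit on the qubits in the range of `e`, applied if all qubits in `S` are `0`. -/
noncomputable def zeroEmbed {R Q Q' : Type} [DecidableEq Q'] (e : Q ↪ Q') (S : Finset Q')
    (hS : ∀ q, e q ∉ S) (c : Circuit R Q) : Circuit R Q' :=
  conjNot S (c.embed e S hS)

theorem zeroEmbed_op_mulVec {e : Q ↪ Q'} {S : Finset Q'} (hS : ∀ q, e q ∉ S) (O : Op R)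
    (c : Circuit R Q) (v : Ket Q') (x : Q' → Bool) :
    (Circuit.op O (zeroEmbed e S hS c) *ᵥ v) x =
      if ∀ c ∈ S, x c = false then (Circuit.op O c *ᵥ slice e x v) (x ∘ e) else v x := by
  have hslice : slice e (negOn S x) (fun y => v (negOn S y)) = slice e x v := by
    funext z
    rw [slice, slice]
    congr 1
    funext q
    by_cases hq : ∃ r, e r = q
    · obtain ⟨r, rfl⟩ := hq
      rw [negOn_of_notMem (hS r), e.injective.extend_apply, e.injective.extend_apply]
    · conv_rhs => rw [Function.extend_apply' _ _ _ hq, ← negOn_negOn S x]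
      unfold negOn
      rw [Function.extend_apply' _ _ _ hq]
  have hcomp : negOn S x ∘ e = x ∘ e := funext fun r => negOn_of_notMem (hS r) x
  rw [zeroEmbed, conjNot_op_mulVec, ← slice_self e (negOn S x) (_ *ᵥ _), Circuit.slice_op_embed,
    hslice, hcomp]
  simp only [negOn_ctrl]
  split_ifs
  · rfl
  · rw [slice_self]

end ZeroEmbed

/-! ### Alternating circuits -/

section Alternating

variable {R B Q : Type} [DecidableEq B] [Fintype B] [DecidableEq Q] [Fintype Q]

/-- The circuit that alternates the circuit `cU` and its inverse; `c₁ i` supplies the phase after a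
use of `cU`, and `c₀ i` the phase at the beginning and after a use of the inverse. -/
def signalCircuit {R Q : Type} (cU : Circuit R Q) (c₀ c₁ : ℕ → Circuit R Q) : ℕ → Circuit R Q
  | 0 => c₀ 0
  | l + 1 => signalCircuit cU c₀ c₁ l ++
      if Even l then cU ++ c₁ (l + 1) else cU.inverse ++ c₀ (l + 1)

theorem signalCircuit_queries {R Q : Type} (cU : Circuit R Q) {c₀ c₁ : ℕ → Circuit R Q}
    (h₀ : ∀ i, (c₀ i).queries = 0) (h₁ : ∀ i, (c₁ i).queries = 0) (l : ℕ) :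
    (signalCircuit cU c₀ c₁ l).queries = l * cU.queries := by
  induction l with
  | zero => simp [signalCircuit, h₀]
  | succ l ih =>
    rw [signalCircuit, Circuit.queries_append, ih]
    split_ifs <;>
      simp only [Circuit.queries_append, Circuit.queries_inverse, h₀, h₁] <;> ring

theorem signalCircuit_size_le {R Q : Type} (cU : Circuit R Q) {c₀ c₁ : ℕ → Circuit R Q} {s : ℕ}
    (h₀ : ∀ i, (c₀ i).size ≤ s) (h₁ : ∀ i, (c₁ i).size ≤ s) (l : ℕ) :
    (signalCircuit cU c₀ c₁ l).size ≤ l * cU.size + (l + 1) * s := by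
  induction l with
  | zero => simpa [signalCircuit] using h₀ 0
  | succ l ih =>
    rw [signalCircuit, Circuit.size_append]
    split_ifs <;> simp only [Circuit.size_append, Circuit.size_inverse]
    · calc _ ≤ (l * cU.size + (l + 1) * s) + (cU.size + s) := by gcongr; exact h₁ _
        _ = _ := by ring
    · calc _ ≤ (l * cU.size + (l + 1) * s) + (cU.size + s) := by gcongr; exact h₀ _
        _ = _ := by ring

open Classical in
/-- The restriction of `v` to the basis vectors that satisfy `good`. -/
noncomputable def restrict {B : Type} (good : (B → Bool) → Prop) (v : Ket B) : Ket B :=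
  fun x => if good x then v x else 0

theorem restrict_add_restrict_not {B : Type} (good : (B → Bool) → Prop) (v : Ket B) :
    restrict good v + restrict (fun x => ¬ good x) v = v := by
  funext x
  by_cases h : good x <;> simp [restrict, h]

/-- The squared norm of the marked part of `M |z⟩`. -/
noncomputable def goodWeight (M : Op B) (z : B → Bool) (good : (B → Bool) → Prop) : ℝ :=
  ∑ x, ‖restrict good (M *ᵥ ket z) x‖ ^ 2

/-- The unnormalized vector that together with `|z⟩` spans the plane in which the alternating
circuit acts at even times. -/
noncomputable def perpVec (M : Op B) (z : B → Bool) (good : (B → Bool) → Prop) : Ket B :=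
  Mᴴ *ᵥ ((1 - (goodWeight M z good : ℂ)) • restrict good (M *ᵥ ket z) -
    (goodWeight M z good : ℂ) • restrict (fun x => ¬ good x) (M *ᵥ ket z))

/-- The state of the alternating circuit after `l` steps. -/
noncomputable def signalVec (M : Op B) (z : B → Bool) (good : (B → Bool) → Prop) (φ : ℕ → ℂ)
    (l : ℕ) : Ket B :=
  if Even l then (signal φ (goodWeight M z good) l).1 • ket z +
      (signal φ (goodWeight M z good) l).2 • perpVec M z good
    else (signal φ (goodWeight M z good) l).1 • restrict good (M *ᵥ ket z) +
      (signal φ (goodWeight M z good) l).2 • restrict (fun x => ¬ good x) (M *ᵥ ket z)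

variable {M : Op B}

theorem mulVec_perpVec (hM : M ∈ Matrix.unitaryGroup (B → Bool) ℂ) (z : B → Bool)
    (good : (B → Bool) → Prop) : M *ᵥ perpVec M z good =
      (1 - (goodWeight M z good : ℂ)) • restrict good (M *ᵥ ket z) -
        (goodWeight M z good : ℂ) • restrict (fun x => ¬ good x) (M *ᵥ ket z) := by
  rw [perpVec, Matrix.mulVec_mulVec, ← Matrix.star_eq_conjTranspose,
    Matrix.mem_unitaryGroup_iff.1 hM, Matrix.one_mulVec]

theorem conjTranspose_mulVec_mulVec (hM : M ∈ Matrix.unitaryGroup (B → Bool) ℂ) (v : Ket B) :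
    Mᴴ *ᵥ (M *ᵥ v) = v := by
  rw [Matrix.mulVec_mulVec, ← Matrix.star_eq_conjTranspose, Matrix.mem_unitaryGroup_iff'.1 hM,
    Matrix.one_mulVec]

theorem conjTranspose_mulVec_restrict (hM : M ∈ Matrix.unitaryGroup (B → Bool) ℂ) (z : B → Bool)
    (good : (B → Bool) → Prop) :
    Mᴴ *ᵥ restrict good (M *ᵥ ket z) = (goodWeight M z good : ℂ) • ket z + perpVec M z good ∧
      Mᴴ *ᵥ restrict (fun x => ¬ good x) (M *ᵥ ket z) =
        (1 - (goodWeight M z good : ℂ)) • ket z - perpVec M z good := by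
  have h := conjTranspose_mulVec_mulVec hM (ket z)
  conv at h => lhs; rw [← restrict_add_restrict_not good (M *ᵥ ket z), Matrix.mulVec_add]
  rw [perpVec, Matrix.mulVec_sub, Matrix.mulVec_smul, Matrix.mulVec_smul]
  generalize Mᴴ *ᵥ restrict good (M *ᵥ ket z) = a at h ⊢
  generalize Mᴴ *ᵥ restrict (fun x => ¬ good x) (M *ᵥ ket z) = b at h ⊢
  constructor
  · rw [← h]; module
  · rw [← h]; module

theorem sum_norm_sq_mulVec (hM : M ∈ Matrix.unitaryGroup (B → Bool) ℂ) (v : Ket B) :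
    ∑ x, ‖(M *ᵥ v) x‖ ^ 2 = ∑ x, ‖v x‖ ^ 2 := by
  have h : ∀ w : Ket B, ((∑ x, ‖w x‖ ^ 2 : ℝ) : ℂ) = star w ⬝ᵥ w := fun w => by
    simp only [dotProduct, Pi.star_apply, Complex.ofReal_sum]
    refine Finset.sum_congr rfl fun x _ => ?_
    rw [← Complex.normSq_eq_norm_sq, Complex.normSq_eq_conj_mul_self]
    rfl
  have h2 : star (M *ᵥ v) ⬝ᵥ (M *ᵥ v) = star v ⬝ᵥ v := by
    rw [Matrix.star_mulVec, ← Matrix.dotProduct_mulVec, conjTranspose_mulVec_mulVec hM]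
  rw [← h, ← h] at h2
  exact_mod_cast h2

theorem sum_norm_sq_ket (z : B → Bool) : ∑ x, ‖ket z x‖ ^ 2 = 1 := by
  rw [Finset.sum_eq_single z]
  · simp [ket]
  · intro x _ hx
    simp [ket, hx]
  · simp

theorem goodWeight_nonneg (M : Op B) (z : B → Bool) (good : (B → Bool) → Prop) :
    0 ≤ goodWeight M z good := Finset.sum_nonneg fun _ _ => by positivity

theorem goodWeight_add (hM : M ∈ Matrix.unitaryGroup (B → Bool) ℂ) (z : B → Bool)
    (good : (B → Bool) → Prop) :
    goodWeight M z good + goodWeight M z (fun x => ¬ good x) = 1 := by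
  rw [goodWeight, goodWeight, ← Finset.sum_add_distrib, ← sum_norm_sq_ket z,
    ← sum_norm_sq_mulVec hM]
  refine Finset.sum_congr rfl fun x _ => ?_
  by_cases h : good x <;> simp [restrict, h]

theorem goodWeight_le_one (hM : M ∈ Matrix.unitaryGroup (B → Bool) ℂ) (z : B → Bool)
    (good : (B → Bool) → Prop) : goodWeight M z good ≤ 1 := by
  linarith [goodWeight_add hM z good, goodWeight_nonneg M z fun x => ¬ good x]

/-- The overlap of `Mᴴ G` with `|z⟩`, for the marked part `G` of `M |z⟩`. -/
theorem conjTranspose_mulVec_restrict_self (M : Op B) (z : B → Bool) (good : (B → Bool) → Prop) :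
    (Mᴴ *ᵥ restrict good (M *ᵥ ket z)) z = (goodWeight M z good : ℂ) := by
  simp only [goodWeight, Matrix.mulVec, dotProduct, Complex.ofReal_sum]
  refine Finset.sum_congr rfl fun x _ => ?_
  have : ∑ y, M x y * ket z y = M x z := by
    rw [Finset.sum_eq_single z]
    · simp [ket]
    · intro y _ hy
      simp [ket, hy]
    · simp
  by_cases h : good x
  · simp only [restrict, h, if_true, Matrix.mulVec, dotProduct, this, Matrix.conjTranspose_apply]
    rw [← Complex.normSq_eq_norm_sq, Complex.normSq_eq_conj_mul_self]
    rfl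
  · simp [restrict, h]

theorem perpVec_self (hM : M ∈ Matrix.unitaryGroup (B → Bool) ℂ) (z : B → Bool)
    (good : (B → Bool) → Prop) : perpVec M z good z = 0 := by
  have h := congrFun (conjTranspose_mulVec_restrict hM z good).1 z
  rw [conjTranspose_mulVec_restrict_self] at h
  have hz : ket z z = 1 := by simp [ket]
  simp only [Pi.add_apply, Pi.smul_apply, hz, smul_eq_mul, mul_one] at h
  linear_combination -h

theorem signalVec_even (hM : M ∈ Matrix.unitaryGroup (B → Bool) ℂ) (z : B → Bool)
    (good : (B → Bool) → Prop) (φ : ℕ → ℂ) {l : ℕ} (hl : Even l) :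
    signalVec M z good φ l z = (signal φ (goodWeight M z good) l).1 := by
  rw [signalVec, if_pos hl]
  simp [perpVec_self hM, ket]

theorem signalVec_odd (z : B → Bool) {good : (B → Bool) → Prop} (φ : ℕ → ℂ) {l : ℕ}
    (hl : ¬ Even l) {x : B → Bool} (hx : good x) :
    signalVec M z good φ l x = (signal φ (goodWeight M z good) l).1 * (M *ᵥ ket z) x := by
  rw [signalVec, if_neg hl]
  simp [restrict, hx]

/-- The alternating circuit acts on the encoded states `L v` as computed by `signal`, whenever its
parts act on encoded states as they should; the qubits of the circuit may differ from those of
`M`. -/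
theorem signalCircuit_op_mulVec (hM : M ∈ Matrix.unitaryGroup (B → Bool) ℂ) {z : B → Bool}
    {good : (B → Bool) → Prop} [DecidablePred good] {φ : ℕ → ℂ} {O : Op R} {L : Ket B → Ket Q}
    {cU : Circuit R Q} {c₀ c₁ : ℕ → Circuit R Q}
    (hU : ∀ v, Circuit.op O cU *ᵥ L v = L (M *ᵥ v))
    (hU' : ∀ v, Circuit.op O cU.inverse *ᵥ L v = L (Mᴴ *ᵥ v))
    (h₀ : ∀ i v, Circuit.op O (c₀ i) *ᵥ L v = L fun x => if x = z then φ i * v x else v x)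
    (h₁ : ∀ i v, Circuit.op O (c₁ i) *ᵥ L v = L fun x => if good x then φ i * v x else v x)
    (l : ℕ) :
    Circuit.op O (signalCircuit cU c₀ c₁ l) *ᵥ L (ket z) = L (signalVec M z good φ l) := by
  induction l with
  | zero =>
    rw [signalCircuit, h₀]
    congr 1
    funext x
    by_cases hx : x = z <;> simp [signalVec, signal, ket, hx]
  | succ l ih =>
    set t : ℂ := (goodWeight M z good : ℂ) with ht
    rw [signalCircuit, Circuit.op_append_mulVec, ih]
    by_cases hl : Even l
    · rw [if_pos hl, Circuit.op_append_mulVec, hU, h₁]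
      congr 1
      have hl' : ¬ Even (l + 1) := by rw [Nat.even_add_one]; exact not_not.2 hl
      rw [signalVec, if_pos hl, signalVec, if_neg hl', signal, if_pos hl, Matrix.mulVec_add,
        Matrix.mulVec_smul, Matrix.mulVec_smul, mulVec_perpVec hM]
      funext x
      by_cases hx : good x <;> simp [restrict, hx, ← ht] <;> ring
    · rw [if_neg hl, Circuit.op_append_mulVec, hU', h₀]
      congr 1
      have hl' : Even (l + 1) := by rw [Nat.even_add_one]; exact hl
      rw [signalVec, if_neg hl, signalVec, if_pos hl', signal, if_neg hl, Matrix.mulVec_add,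
        Matrix.mulVec_smul, Matrix.mulVec_smul, (conjTranspose_mulVec_restrict hM z good).1,
        (conjTranspose_mulVec_restrict hM z good).2]
      funext x
      by_cases hx : x = z
      · subst hx
        simp only [Pi.add_apply, Pi.sub_apply, Pi.smul_apply, smul_eq_mul, perpVec_self hM, if_true,
          ket, Pi.single_eq_same, ← ht]
        ring
      · simp [hx, ket, ← ht]; ring

end Alternating

/-! ### Probability oracles and product states -/

theorem sum_sumArrow_mul {α β : Type} [Fintype α] [Fintype β] [DecidableEq α] [DecidableEq β]
    (f : (α → Bool) → ℝ) (g : (β → Bool) → ℝ) :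
    ∑ x : α ⊕ β → Bool, f (fun i => x (Sum.inl i)) * g (fun i => x (Sum.inr i)) =
      (∑ y, f y) * ∑ y, g y := by
  rw [Finset.sum_mul_sum, ← Fintype.sum_prod_type']
  exact (Equiv.sumArrowEquivProdArrow α β Bool).sum_comp fun y => f y.1 * g y.2

theorem sum_optionArrow {α : Type} [Fintype α] [DecidableEq α] (f : (Option α → Bool) → ℝ) :
    ∑ x, f x = ∑ c : Bool, ∑ y : α → Bool, f fun q => q.elim c y := by
  rw [← Fintype.sum_prod_type', ← (Equiv.piOptionEquivProd (β := fun _ => Bool)).symm.sum_comp f]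
  refine Finset.sum_congr rfl fun y _ => congrArg f (funext fun q => ?_)
  cases q <;> rfl

theorem sum_unitArrow (f : (Unit → Bool) → ℝ) :
    ∑ x, f x = f (fun _ => false) + f fun _ => true := by
  rw [← (Equiv.funUnique Unit Bool).symm.sum_comp f, Fintype.sum_bool, add_comm]
  rfl

theorem enc_injective {n a : ℕ} (hn : n ≤ 2 ^ a) : Function.Injective (enc a (n := n)) := by
  intro i j h
  refine Fin.ext (Nat.eq_of_testBit_eq fun t => ?_)
  by_cases ht : t < a
  · exact congrFun h ⟨t, ht⟩
  · have hb : ∀ k : Fin n, (k : ℕ).testBit t = false := fun k =>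
      Nat.testBit_lt_two_pow (k.2.trans_le (hn.trans (Nat.pow_le_pow_right two_pos (not_lt.1 ht))))
    rw [hb, hb]

section Oracle

variable {n a b : ℕ} {p : Fin n → ℝ} {ψ : Fin n → Ket (Fin b)} {O : Op (OReg a b)}

theorem IsOracle.normalized (h : IsOracle p ψ O) (i : Fin n) : ∑ x, ‖ψ i x‖ ^ 2 = 1 := by
  have h1 := h.orthonormal i i
  rw [if_pos rfl] at h1
  have h2 : ((∑ x, ‖ψ i x‖ ^ 2 : ℝ) : ℂ) = star (ψ i) ⬝ᵥ ψ i := by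
    simp only [dotProduct, Pi.star_apply, Complex.ofReal_sum]
    refine Finset.sum_congr rfl fun x _ => ?_
    rw [← Complex.normSq_eq_norm_sq, Complex.normSq_eq_conj_mul_self]
    rfl
  rw [h1] at h2
  exact_mod_cast h2

theorem IsOracle.le_one (h : IsOracle p ψ O) (i : Fin n) : p i ≤ 1 :=
  h.sum_eq_one ▸ Finset.single_le_sum (fun j _ => h.nonneg j) (Finset.mem_univ i)

/-- The labels have different binary representations, so a single summand survives. -/
theorem IsOracle.apply_of_enc (h : IsOracle p ψ O) (hn : n ≤ 2 ^ a) (i : Fin n)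
    {x : OReg a b → Bool} (hx : x ∘ Sum.inl = enc a i) :
    (O *ᵥ ket0 (OReg a b)) x = (√(p i) : ℂ) * ψ i (x ∘ Sum.inr) := by
  rw [h.apply_zero]
  beta_reduce
  rw [Finset.sum_eq_single i]
  · simp [ket, hx]
  · intro j _ hj
    have : enc a i ≠ enc a j := fun e => hj (enc_injective hn e).symm
    simp [ket, hx, this]
  · simp

/-- The marked part belonging to the label `i` has weight `p i`; this is the parameter `t` of the
signal processing in the separation circuit. -/
theorem IsOracle.goodWeight_label (h : IsOracle p ψ O) (hn : n ≤ 2 ^ a) (i : Fin n) :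
    goodWeight O (fun _ => false) (fun x => x ∘ Sum.inl = enc a i) = p i := by
  have h1 : ∀ x : OReg a b → Bool,
      ‖restrict (fun x => x ∘ Sum.inl = enc a i) (O *ᵥ ket fun _ => false) x‖ ^ 2 =
        (if (fun t => x (Sum.inl t)) = enc a i then p i else 0) *
          ‖ψ i fun t => x (Sum.inr t)‖ ^ 2 := fun x => by
    change _ = (if x ∘ Sum.inl = enc a i then p i else 0) * _
    by_cases hx : x ∘ Sum.inl = enc a i
    · have e := h.apply_of_enc hn i hx
      rw [ket0] at e
      rw [restrict, if_pos hx, e, norm_mul, mul_pow, if_pos hx, Complex.norm_real,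
        Real.norm_eq_abs, sq_abs, Real.sq_sqrt (h.nonneg i)]
      rfl
    · rw [restrict, if_neg hx, if_neg hx]
      simp
  rw [goodWeight, Finset.sum_congr rfl fun x _ => h1 x,
    sum_sumArrow_mul (fun y => if y = enc a i then p i else 0) fun y => ‖ψ i y‖ ^ 2, h.normalized]
  simp

theorem sum_norm_sq_piKet (u : Bool → ℂ) (i : Fin n) :
    ∑ x, ‖piKet (a := a) (b := b) u i x‖ ^ 2 = ‖u false‖ ^ 2 + ‖u true‖ ^ 2 := by
  simp only [piKet, norm_mul, mul_pow]
  rw [sum_sumArrow_mul (fun y : Unit → Bool => ‖u (y ())‖ ^ 2) fun y : OReg a b ⊕ Fin a → Bool =>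
    ‖ket0 (OReg a b) fun r => y (Sum.inl r)‖ ^ 2 * ‖ket (enc a i) fun t => y (Sum.inr t)‖ ^ 2,
    sum_sumArrow_mul (fun y => ‖ket0 (OReg a b) y‖ ^ 2) fun y => ‖ket (enc a i) y‖ ^ 2, ket0,
    sum_norm_sq_ket, sum_norm_sq_ket, sum_unitArrow]
  ring

theorem normalized_piKet_qzero (i : Fin n) : Normalized (piKet (a := a) (b := b) qzero i) := by
  rw [Normalized, sum_norm_sq_piKet]
  simp [qzero]

theorem normalized_piKet_qplus (i : Fin n) : Normalized (piKet (a := a) (b := b) qplus i) := by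
  rw [Normalized, sum_norm_sq_piKet]
  simp only [qplus, Complex.norm_real, Real.norm_eq_abs, sq_abs, inv_pow, Real.sq_sqrt zero_le_two]
  norm_num

theorem sum_norm_sq_locKet (c : Bool) (v : Ket (PIReg a b)) :
    ∑ x, ‖locKet c v x‖ ^ 2 = ∑ y, ‖v y‖ ^ 2 := by
  rw [sum_optionArrow]
  cases c <;> simp [locKet]

end Oracle

/-! ### The separation circuit -/

section Separation

variable {a b : ℕ}

theorem hadamard_op_mulVec {R Q : Type} [DecidableEq Q] [Fintype Q] (O : Op R) (t : Q)
    (ht : t ∉ (∅ : Finset Q)) (v : Ket Q) (x : Q → Bool) :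
    ((Step.gate ∅ t ht hadamard : Step R Q).op O *ᵥ v) x = (((√2)⁻¹ : ℝ) : ℂ) *
      (v (Function.update x t false) + (if x t then -1 else 1) * v (Function.update x t true)) := by
  rw [gate_op_mulVec, if_pos (by simp), Fintype.sum_bool]
  cases x t <;> simp [hadamard] <;> ring

/-- The qubit `P`. -/
abbrev pQubit : Loc a b := some (Sum.inl ())

/-- The copy of the oracle registers in `I`. -/
def oracleEmb : OReg a b ↪ Loc a b :=
  ⟨fun r => some (Sum.inr (Sum.inl r)), fun _ _ h => by simpa using h⟩

/-- The qubits of the label in `I`. -/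
abbrev labelQubit (t : Fin a) : Loc a b := some (Sum.inr (Sum.inr t))

/-- The vector `|c⟩_C |s⟩_P |v⟩ |i⟩`, where `v` is a vector on the copy of the oracle registers. -/
def encLoc {n : ℕ} (i : Fin n) (c s : Bool) (v : Ket (OReg a b)) : Ket (Loc a b) := fun x =>
  if x none = c ∧ x pQubit = s ∧ (fun t => x (labelQubit t)) = enc a i then
    v fun r => x (oracleEmb r) else 0

theorem oracleEmb_ne_none (r : OReg a b) : oracleEmb r ≠ none := nofun

theorem oracleEmb_ne_pQubit (r : OReg a b) : oracleEmb r ≠ pQubit := fun h => by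
  simpa using Option.some_injective _ h

theorem oracleEmb_ne_labelQubit (r : OReg a b) (t : Fin a) : oracleEmb r ≠ labelQubit t :=
  fun h => by simpa using Option.some_injective _ h

theorem pQubit_notMem (S : Finset (OReg a b)) : pQubit ∉ S.map oracleEmb := fun h => by
  obtain ⟨r, _, hr⟩ := Finset.mem_map.1 h
  exact oracleEmb_ne_pQubit r hr

theorem none_notMem : none ∉ insert pQubit ((Finset.univ : Finset (OReg a b)).map oracleEmb) :=
  fun h => by
    rcases Finset.mem_insert.1 h with h | h
    · exact nomatch h
    · obtain ⟨r, _, hr⟩ := Finset.mem_map.1 h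
      exact oracleEmb_ne_none r hr

/-- The phase on the initial state `|0⟩` of the copy of the oracle registers. -/
noncomputable def initialPhase (c : ℂ) (hc : ‖c‖ = 1) : Circuit (OReg a b) (Loc a b) :=
  zeroGate _ (Finset.univ.map oracleEmb) pQubit (pQubit_notMem _) (phaseGate c hc)

/-- The label is added to the copy of the register `A`. -/
noncomputable def addLabel : Circuit (OReg a b) (Loc a b) :=
  addLayer _ ∅ labelQubit (fun t => oracleEmb (Sum.inl t)) (by simp)
    fun _ _ => oracleEmb_ne_labelQubit _ _

/-- The phase on the states in which the copy of the register `A` agrees with the label. -/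
noncomputable def labelPhase (c : ℂ) (hc : ‖c‖ = 1) : Circuit (OReg a b) (Loc a b) :=
  addLabel ++ (zeroGate _ ((Finset.univ.map Function.Embedding.inl).map oracleEmb) pQubit
    (pQubit_notMem _) (phaseGate c hc) ++ addLabel)

theorem query_encLoc {n : ℕ} (i : Fin n) (c s : Bool) (O : Op (OReg a b)) (inv : Bool)
    (v : Ket (OReg a b)) :
    Circuit.op O [Step.query ∅ oracleEmb (by simp) inv] *ᵥ encLoc i c s v =
      encLoc i c s ((if inv then Oᴴ else O) *ᵥ v) := by
  funext x
  rw [Circuit.op_singleton, query_op_mulVec, if_pos (by simp)]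
  have h : slice oracleEmb x (encLoc i c s v) =
      if x none = c ∧ x pQubit = s ∧ (fun t => x (labelQubit t)) = enc a i then v else 0 := by
    funext z
    have h1 : ∀ q : Loc a b, (∀ r, oracleEmb r ≠ q) →
        Function.extend oracleEmb z x q = x q := fun q hq => extend_eq_of_notMem _ _ _ hq
    have h2 : (fun r => Function.extend oracleEmb z x (oracleEmb r)) = z :=
      funext fun r => oracleEmb.injective.extend_apply _ _ _
    rw [slice, encLoc, h2, h1 none oracleEmb_ne_none, h1 pQubit oracleEmb_ne_pQubit]
    simp only [fun t => h1 (labelQubit t) fun r => oracleEmb_ne_labelQubit r t]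
    split_ifs <;> rfl
  rw [h, encLoc]
  split_ifs
  · rfl
  · simp
  · rfl
  · simp

theorem initialPhase_encLoc {n : ℕ} (i : Fin n) (c s : Bool) (O : Op (OReg a b)) {z : ℂ}
    (hz : ‖z‖ = 1) (v : Ket (OReg a b)) :
    Circuit.op O (initialPhase z hz) *ᵥ encLoc i c s v =
      encLoc i c s fun x => if x = fun _ => false then (if s then starRingEnd ℂ z else z) * v x
        else v x := by
  funext x
  rw [initialPhase, zero_phaseGate_op_mulVec]
  have h : (∀ q ∈ Finset.univ.map oracleEmb, x q = false) ↔
      (fun r => x (oracleEmb r)) = fun _ => false := by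
    rw [funext_iff]
    exact ⟨fun h r => h _ (Finset.mem_map_of_mem _ (Finset.mem_univ r)), fun h q hq => by
      obtain ⟨r, _, rfl⟩ := Finset.mem_map.1 hq
      exact h r⟩
  simp only [h]
  unfold encLoc
  split_ifs <;> simp_all

theorem labelPhase_encLoc {n : ℕ} (i : Fin n) (c s : Bool) (O : Op (OReg a b)) {z : ℂ}
    (hz : ‖z‖ = 1) (v : Ket (OReg a b)) :
    Circuit.op O (labelPhase z hz) *ᵥ encLoc i c s v =
      encLoc i c s fun x => if x ∘ Sum.inl = enc a i then (if s then starRingEnd ℂ z else z) * v x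
        else v x := by
  have hinj : Function.Injective fun t : Fin a => (oracleEmb (Sum.inl t) : Loc a b) :=
    fun t u h => Sum.inl_injective (oracleEmb.injective h)
  set f : (Loc a b → Bool) → Loc a b → Bool := fun x =>
    flipFn (fun t : Fin a => oracleEmb (Sum.inl t)) (fun t => x (labelQubit t) = true) x with hf
  have hadd : ∀ v : Ket (Loc a b), Circuit.op O addLabel *ᵥ v = fun x => v (f x) := fun v => by
    funext x
    rw [addLabel, addLayer_op_mulVec O (by simp) _ hinj (by simp)]
    simp [hf]
  have hne : ∀ (q : Loc a b), (∀ t, oracleEmb (Sum.inl t) ≠ q) → ∀ x, f x q = x q :=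
    fun q hq x => flipFn_of_ne hq _ _
  have hlabel : ∀ x t, f x (labelQubit t) = x (labelQubit t) := fun x t =>
    hne _ (fun _ => oracleEmb_ne_labelQubit _ _) x
  have hff : ∀ x, f (f x) = x := fun x => by
    have h : f (f x) = flipFn (fun t : Fin a => oracleEmb (Sum.inl t))
        (fun t => f x (labelQubit t) = true) (f x) := rfl
    rw [h]
    simp only [hlabel]
    exact flipFn_flipFn _ _
  have hA : ∀ x t, f x (oracleEmb (Sum.inl t)) =
      if x (labelQubit t) = true then !x (oracleEmb (Sum.inl t)) else x (oracleEmb (Sum.inl t)) :=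
    fun x t => flipFn_apply hinj (fun t => x (labelQubit t) = true) x t
  funext x
  rw [labelPhase, Circuit.op_append_mulVec, Circuit.op_append_mulVec, hadd, hadd]
  beta_reduce
  rw [zero_phaseGate_op_mulVec, hff, hne pQubit fun _ => oracleEmb_ne_pQubit _]
  have h : (∀ q ∈ (Finset.univ.map Function.Embedding.inl).map oracleEmb, f x q = false) ↔
      (fun t => x (oracleEmb (Sum.inl t))) = fun t => x (labelQubit t) := by
    rw [funext_iff]
    constructor
    · intro h t
      have := h _ (Finset.mem_map_of_mem _ (Finset.mem_map_of_mem _ (Finset.mem_univ t)))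
      change f x (oracleEmb (Sum.inl t)) = false at this
      rw [hA] at this
      cases h1 : x (labelQubit t) <;> cases h2 : x (oracleEmb (Sum.inl t)) <;> simp_all
    · intro h q hq
      obtain ⟨r, hr, rfl⟩ := Finset.mem_map.1 hq
      obtain ⟨t, _, rfl⟩ := Finset.mem_map.1 hr
      change f x (oracleEmb (Sum.inl t)) = false
      rw [hA, h t]
      cases h1 : x (labelQubit t) <;> simp
  simp only [h]
  unfold encLoc
  by_cases hx : x none = c ∧ x pQubit = s ∧ (fun t => x (labelQubit t)) = enc a i
  · simp only [if_pos hx]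
    rw [hx.2.2, hx.2.1]
    rfl
  · simp only [if_neg hx]
    simp

/-- The separation circuit with phases `φ`. The phases enter with opposite signs for the two values
of `P`, so that the component along `|+⟩_P` sees the real part of the resulting amplitude; `C` is
flipped on the part of this component with the copy of the oracle registers in state `|0⟩`. -/
noncomputable def separationCircuit (φ : ℕ → ℂ) (hφ : ∀ i, ‖φ i‖ = 1) (l : ℕ) :
    Circuit (OReg a b) (Loc a b) :=
  [Step.gate ∅ pQubit (by simp) hadamard] ++
    (signalCircuit [Step.query ∅ oracleEmb (by simp) false] (fun i => initialPhase (φ i) (hφ i))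
      (fun i => labelPhase (φ i) (hφ i)) l ++
    ([Step.gate ∅ pQubit (by simp) hadamard] ++
    (zeroGate _ (insert pQubit (Finset.univ.map oracleEmb)) none none_notMem notGate ++
    [Step.gate ∅ pQubit (by simp) hadamard])))

theorem initialPhase_size (c : ℂ) (hc : ‖c‖ = 1) :
    (initialPhase c hc : Circuit (OReg a b) (Loc a b)).size = 1 + 3 * (a + b) := by
  rw [initialPhase, zeroGate_size]
  simp

theorem labelPhase_size_le (c : ℂ) (hc : ‖c‖ = 1) :
    (labelPhase c hc : Circuit (OReg a b) (Loc a b)).size ≤ 1 + 7 * a := by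
  have h : (addLabel : Circuit (OReg a b) (Loc a b)).size ≤ 2 * a := by
    refine (addLayer_size_le _ _).trans ?_
    simp [mul_comm]
  rw [labelPhase, Circuit.size_append, Circuit.size_append, zeroGate_size]
  simp only [Finset.card_map, Finset.card_univ, Fintype.card_fin]
  omega

theorem separationCircuit_queries (φ : ℕ → ℂ) (hφ : ∀ i, ‖φ i‖ = 1) (l : ℕ) :
    (separationCircuit φ hφ l : Circuit (OReg a b) (Loc a b)).queries = l := by
  have h : (addLabel : Circuit (OReg a b) (Loc a b)).queries = 0 := addLayer_queries _ _
  have hH : Circuit.queries [(Step.gate ∅ pQubit (by simp) hadamard : Step (OReg a b) (Loc a b))] =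
      0 := rfl
  simp only [separationCircuit, Circuit.queries_append, zeroGate_queries, hH]
  rw [signalCircuit_queries _ (c₀ := fun i => initialPhase (φ i) (hφ i))
    (fun i => zeroGate_queries _ _ _ _) fun i => by
      simp only [labelPhase, Circuit.queries_append, zeroGate_queries, h]]
  simp [Circuit.queries, Step.queries]

theorem separationCircuit_size_le (φ : ℕ → ℂ) (hφ : ∀ i, ‖φ i‖ = 1) (l : ℕ) :
    (separationCircuit φ hφ l : Circuit (OReg a b) (Loc a b)).size ≤
      (a + b + 1) * (8 * l + 14) := by
  have hH : Circuit.size [(Step.gate ∅ pQubit (by simp) hadamard : Step (OReg a b) (Loc a b))] =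
      1 := rfl
  have hq : Circuit.size [(Step.query ∅ oracleEmb (by simp) false : Step (OReg a b) (Loc a b))] =
      1 := rfl
  have h := signalCircuit_size_le [(Step.query ∅ oracleEmb (by simp) false :
      Step (OReg a b) (Loc a b))] (s := 7 * (a + b + 1))
    (c₀ := fun i => initialPhase (φ i) (hφ i)) (c₁ := fun i => labelPhase (φ i) (hφ i))
    (fun i => by rw [initialPhase_size]; omega)
    (fun i => (labelPhase_size_le _ _).trans (by omega)) l
  rw [hq] at h
  simp only [separationCircuit, Circuit.size_append, zeroGate_size, hH]
  rw [Finset.card_insert_of_notMem (pQubit_notMem _), Finset.card_map, Finset.card_univ,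
    Fintype.card_sum, Fintype.card_fin, Fintype.card_fin]
  nlinarith

theorem hadamard_encLoc {n : ℕ} (i : Fin n) (c s : Bool) (O : Op (OReg a b))
    (v : Ket (OReg a b)) :
    Circuit.op O [Step.gate ∅ pQubit (by simp) hadamard] *ᵥ encLoc i c s v =
      (((√2)⁻¹ : ℝ) : ℂ) •
        (encLoc i c false v + (if s then -1 else 1 : ℂ) • encLoc i c true v) := by
  funext x
  rw [Circuit.op_singleton, hadamard_op_mulVec]
  have h : ∀ d, encLoc i c s v (Function.update x pQubit d) =
      if d = s then encLoc i c (x pQubit) v x else 0 := fun d => by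
    have h1 : (fun r => Function.update x pQubit d (oracleEmb r)) = fun r => x (oracleEmb r) :=
      funext fun r => Function.update_of_ne (oracleEmb_ne_pQubit r) _ _
    have h2 : (fun t => Function.update x pQubit d (labelQubit t)) = fun t => x (labelQubit t) :=
      funext fun t => Function.update_of_ne (by simp) _ _
    unfold encLoc
    rw [h1, h2, Function.update_self, Function.update_of_ne (by simp)]
    split_ifs <;> simp_all
  rw [h, h]
  have h3 : ∀ d, d ≠ x pQubit → encLoc i c d v x = 0 := fun d hd => if_neg fun h => hd h.2.1.symm
  simp only [Pi.smul_apply, Pi.add_apply, smul_eq_mul]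
  cases hx : x pQubit <;> cases s
  · rw [h3 true (by simp [hx])]; simp
  · rw [h3 true (by simp [hx])]; simp
  · rw [h3 false (by simp [hx])]; simp
  · rw [h3 false (by simp [hx])]; simp

/-- The flip of `C` on the part of the state with `P` and the copy of the oracle registers `0`. -/
theorem flip_encLoc {n : ℕ} (i : Fin n) (s : Bool) (O : Op (OReg a b)) (v : Ket (OReg a b)) :
    Circuit.op O
      (zeroGate _ (insert pQubit (Finset.univ.map oracleEmb)) none none_notMem notGate) *ᵥ
        encLoc i false s v =
        encLoc i false s (if s then v else fun x => if x = fun _ => false then 0 else v x) +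
          (if s then 0 else v fun _ => false) • encLoc i true false (ket0 _) := by
  funext x
  rw [zeroGate_op_mulVec]
  have h : (∀ q ∈ insert pQubit (Finset.univ.map oracleEmb), x q = false) ↔
      x pQubit = false ∧ (fun r => x (oracleEmb r)) = fun _ => false := by
    rw [funext_iff, Finset.forall_mem_insert]
    refine and_congr_right fun _ => ?_
    exact ⟨fun h r => h _ (Finset.mem_map_of_mem _ (Finset.mem_univ r)), fun h q hq => by
      obtain ⟨r, _, rfl⟩ := Finset.mem_map.1 hq
      exact h r⟩
  have h1 : ∀ d, encLoc i false s v (Function.update x none d) =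
      if d = false then encLoc i (x none) s v x else 0 := fun d => by
    have h1 : (fun r => Function.update x none d (oracleEmb r)) = fun r => x (oracleEmb r) :=
      funext fun r => Function.update_of_ne (oracleEmb_ne_none r) _ _
    have h2 : (fun t => Function.update x none d (labelQubit t)) = fun t => x (labelQubit t) :=
      funext fun t => Function.update_of_ne (by simp) _ _
    unfold encLoc
    rw [h1, h2, Function.update_self, Function.update_of_ne (by simp)]
    split_ifs <;> simp_all
  simp only [h, h1, Fintype.sum_bool]
  simp only [encLoc, ket0, ket, notGate, Pi.add_apply, Pi.smul_apply, smul_eq_mul]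
  by_cases hl : (fun t => x (labelQubit t)) = enc a i
  · by_cases hz : (fun r => x (oracleEmb r)) = fun _ => false
    · rw [hz]
      cases s <;> cases hp : x pQubit <;> cases hc : x none <;> simp [hl]
    · cases s <;> cases hp : x pQubit <;> cases hc : x none <;> simp [hl, hz]
  · simp [hl]

/-- The vector `|s⟩_P |v⟩ |i⟩`, where `v` is a vector on the copy of the oracle registers. -/
def encPI {n : ℕ} (i : Fin n) (s : Bool) (v : Ket (OReg a b)) : Ket (PIReg a b) := fun x =>
  if x (Sum.inl ()) = s ∧ (fun t => x (Sum.inr (Sum.inr t))) = enc a i then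
    v fun r => x (Sum.inr (Sum.inl r)) else 0

theorem encLoc_eq_locKet {n : ℕ} (i : Fin n) (c s : Bool) (v : Ket (OReg a b)) :
    encLoc i c s v = locKet c (encPI i s v) := by
  funext x
  rw [encLoc, locKet, ite_and]
  rfl

theorem locKet_add (c : Bool) (v w : Ket (PIReg a b)) :
    locKet c (v + w) = locKet c v + locKet c w := by
  funext x
  simp only [locKet, Pi.add_apply]
  split_ifs <;> simp

theorem locKet_smul (c : Bool) (z : ℂ) (v : Ket (PIReg a b)) :
    locKet c (z • v) = z • locKet c v := by
  funext x
  simp only [locKet, Pi.smul_apply]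
  split_ifs <;> simp

theorem piKet_eq_add {n : ℕ} (u : Bool → ℂ) (i : Fin n) :
    (piKet u i : Ket (PIReg a b)) =
      u false • encPI i false (ket0 _) + u true • encPI i true (ket0 _) := by
  funext x
  simp only [piKet, encPI, Pi.add_apply, Pi.smul_apply, smul_eq_mul]
  by_cases hl : (fun t => x (Sum.inr (Sum.inr t))) = enc a i
  · cases hp : x (Sum.inl ()) <;> simp [hl, ket]
  · simp [hl, ket]

/-- The amplitude of the flipped component is the mean of the amplitudes for the phases `φ` and for
their conjugates, i.e. the real part. -/
theorem separationCircuit_op_mulVec {n : ℕ} (hn : n ≤ 2 ^ a) {p : Fin n → ℝ}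
    {ψ : Fin n → Ket (Fin b)} {O : Op (OReg a b)} (h : IsOracle p ψ O) (φ : ℕ → ℂ)
    (hφ : ∀ i, ‖φ i‖ = 1) {l : ℕ} (hl : Even l) (i : Fin n) :
    ∃ γ : Ket (PIReg a b), Circuit.op O (separationCircuit φ hφ l) *ᵥ locKet false (piKet qzero i) =
      locKet false γ + ((signal φ (p i) l).1.re : ℂ) • locKet true (piKet qplus i) := by
  set good : (OReg a b → Bool) → Prop := fun x => x ∘ Sum.inl = enc a i with hgood
  set F : Bool → Ket (OReg a b) := fun s =>
    signalVec O (fun _ => false) good (fun j => if s then starRingEnd ℂ (φ j) else φ j) l with hF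
  have hsig : ∀ s, Circuit.op O (signalCircuit [Step.query ∅ oracleEmb (by simp) false]
      (fun i => initialPhase (φ i) (hφ i)) (fun i => labelPhase (φ i) (hφ i)) l) *ᵥ
        encLoc i false s (ket0 _) = encLoc i false s (F s) := fun s =>
    signalCircuit_op_mulVec h.unitary (L := encLoc i false s) (good := good)
      (fun v => query_encLoc i false s O false v) (fun v => query_encLoc i false s O true v)
      (fun j v => initialPhase_encLoc i false s O (hφ j) v)
      (fun j v => labelPhase_encLoc i false s O (hφ j) v) l
  have hF0 : F false (fun _ => false) + F true (fun _ => false) =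
      2 * ((signal φ (p i) l).1.re : ℂ) := by
    simp only [hF, signalVec_even h.unitary _ _ _ hl, hgood, h.goodWeight_label hn]
    simp only [if_true, Bool.false_eq_true, if_false, signal_conj]
    rw [Complex.add_conj]
    push_cast
    ring
  have hr : (((√2)⁻¹ : ℝ) : ℂ) * (((√2)⁻¹ : ℝ) : ℂ) = 1 / 2 := by
    rw [← Complex.ofReal_mul, ← mul_inv, Real.mul_self_sqrt zero_le_two]
    norm_num
  have h0 : (locKet false (piKet qzero i) : Ket (Loc a b)) = encLoc i false false (ket0 _) := by
    rw [piKet_eq_add, encLoc_eq_locKet]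
    simp [qzero]
  have h1 : (locKet true (piKet qplus i) : Ket (Loc a b)) =
      (((√2)⁻¹ : ℝ) : ℂ) • (encLoc i true false (ket0 _) + encLoc i true true (ket0 _)) := by
    rw [piKet_eq_add, encLoc_eq_locKet, encLoc_eq_locKet, ← locKet_add, ← locKet_smul, smul_add]
    rfl
  generalize hrv : (((√2)⁻¹ : ℝ) : ℂ) = r at hr h1
  set F' : Bool → Ket (OReg a b) := fun s x => if x = fun _ => false then 0 else F s x with hF'
  refine ⟨r • (r • (r • (encPI i false (F' false) + encPI i true (F' false)) +
    r • (encPI i false (F false) - encPI i true (F false))) +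
    r • (r • (encPI i false (F' true) + encPI i true (F' true)) -
    r • (encPI i false (F true) - encPI i true (F true)))), ?_⟩
  rw [separationCircuit]
  simp only [Circuit.op_append_mulVec, h0, hadamard_encLoc, Matrix.mulVec_smul, Matrix.mulVec_add,
    hsig, flip_encLoc, Bool.false_eq_true, if_false, if_true, one_smul, zero_smul, add_zero, h1,
    hrv, sub_eq_add_neg, ← neg_one_smul ℂ (encPI _ _ _), ← neg_one_smul ℂ (_ • (_ + _)),
    locKet_smul, locKet_add, ← encLoc_eq_locKet]
  have hFs : ∀ s, (fun x => if x = fun _ => false then 0 else F s x) = F' s := fun s => rfl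
  simp only [hFs]
  linear_combination (norm := module) (r * (F false (fun _ => false) + F true fun _ => false) * hr +
    r / 2 * hF0) • (encLoc i true false (ket0 _) + encLoc i true true (ket0 _))

/-- A separation circuit for the threshold `2 ^ (-J)` exists. -/
theorem exists_separates {n : ℕ} (hn : n ≤ 2 ^ a) {J : ℕ} (hJ : 1 ≤ J) {ε : ℝ} (hε : 0 < ε)
    (hε1 : ε ≤ 1) : ∃ (W : Circuit (OReg a b) (Loc a b)) (β β' : ℝ → ℝ),
      Separates n (1 / 2 ^ J) ε W β β' ∧
      (W.queries : ℝ) ≤ 500 * (2 ^ J * Real.log (2 / ε)) ∧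
      (W.size : ℝ) ≤ 4020 * (a + b + 1) * (2 ^ J * Real.log (2 / ε)) := by
  obtain ⟨φ, D, R, hφ, hD, hR, hR1, hsmall, hlarge⟩ := exists_separation_phases hJ hε hε1
  have hle : ∀ x : ℝ, 0 ≤ x → x ≤ 1 → R.eval (x ^ 2) ^ 2 ≤ 1 := fun x h0 h1 =>
    hR1 _ ⟨by positivity, pow_le_one₀ h0 h1⟩
  refine ⟨separationCircuit φ hφ (2 * D), fun x => R.eval (x ^ 2),
    fun x => √(1 - R.eval (x ^ 2) ^ 2), ⟨fun x h0 h1 => ?_, hsmall, hlarge, ?_⟩, ?_, ?_⟩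
  · rw [Real.sq_sqrt (sub_nonneg.2 (hle x h0 h1))]
    ring
  · intro p ψ O h i
    obtain ⟨γ, hγ⟩ := separationCircuit_op_mulVec hn h φ hφ (even_two_mul D) i
    rw [hR] at hγ
    have hsq : √(p i) ^ 2 = p i := Real.sq_sqrt (h.nonneg i)
    have hn := sum_norm_sq_mulVec
      (Circuit.op_mem_unitaryGroup h.unitary (separationCircuit φ hφ (2 * D)))
      (locKet false (piKet qzero i))
    rw [hγ, ← locKet_smul, sum_norm_sq_locKet, normalized_piKet_qzero, sum_optionArrow] at hn
    simp only [Fintype.sum_bool, Pi.add_apply, locKet, Option.elim, Bool.false_eq_true, if_false,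
      if_true, zero_add, add_zero, Pi.smul_apply, smul_eq_mul, norm_mul, mul_pow,
      Complex.norm_real, Real.norm_eq_abs, sq_abs, ← Finset.mul_sum, Bool.true_eq_false] at hn
    have hp1 : ∑ x, ‖(piKet qplus i : Ket (PIReg a b)) x‖ ^ 2 = 1 := normalized_piKet_qplus i
    rw [hp1, mul_one] at hn
    simp only [hsq]
    rw [hγ]
    set r := √(1 - R.eval (p i) ^ 2) with hr
    have hr2 : r ^ 2 = ∑ x, ‖γ x‖ ^ 2 := by
      rw [hr, Real.sq_sqrt (by linarith [hR1 _ ⟨h.nonneg i, h.le_one i⟩])]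
      linarith
    -- for `r = 0` the residual vector vanishes, and every unit vector can be taken
    by_cases h0 : r = 0
    · refine ⟨_, normalized_piKet_qzero i, ?_⟩
      rw [h0] at hr2 ⊢
      have hγ0 : γ = 0 := by
        funext x
        have := (Finset.sum_eq_zero_iff_of_nonneg fun x _ => by positivity).1
          (hr2.symm.trans (by norm_num)) x (Finset.mem_univ x)
        simpa using this
      have : locKet false (0 : Ket (PIReg a b)) = 0 := by
        funext x; simp [locKet]
      simp [hγ0, this]
    · refine ⟨((r⁻¹ : ℝ) : ℂ) • γ, ?_, ?_⟩
      · simp only [Normalized, Pi.smul_apply, smul_eq_mul, norm_mul, mul_pow, Complex.norm_real,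
          Real.norm_eq_abs, sq_abs, ← Finset.mul_sum, ← hr2]
        field_simp
      · rw [locKet_smul, smul_smul, ← Complex.ofReal_mul, mul_inv_cancel₀ h0, Complex.ofReal_one,
          one_smul]
  · rw [separationCircuit_queries]
    exact hD
  · have h := separationCircuit_size_le (a := a) (b := b) φ hφ (2 * D)
    have hlog : Real.log 2 ≤ Real.log (2 / ε) :=
      Real.log_le_log two_pos (by rw [le_div_iff₀ hε]; linarith)
    have h2 : (2 : ℝ) ^ 1 ≤ 2 ^ J := pow_le_pow_right₀ one_le_two hJ
    have hX : 1 ≤ (2 : ℝ) ^ J * Real.log (2 / ε) := by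
      nlinarith [Real.log_two_gt_d9]
    have h' : ((separationCircuit φ hφ (2 * D) : Circuit (OReg a b) (Loc a b)).size : ℝ) ≤
        ((a + b + 1) * (8 * (2 * D : ℕ) + 14) : ℝ) := by exact_mod_cast h
    refine h'.trans ?_
    have : (0 : ℝ) ≤ a + b + 1 := by positivity
    nlinarith

end Separation

/-! ### The separated state -/

section Separated

variable {n a b m : ℕ}

theorem sum_prodArrow_prod {ι P : Type} [DecidableEq ι] [Fintype ι] [DecidableEq P] [Fintype P]
    (f : ι → (P → Bool) → ℝ) :
    ∑ y : ι × P → Bool, ∏ j, f j (fun q => y (j, q)) = ∏ j, ∑ z, f j z := by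
  rw [Finset.prod_univ_sum, Fintype.piFinset_univ]
  exact (Equiv.curry ι P Bool).sum_comp fun y => ∏ j, f j (y j)

/-- The product of a vector on the registers `A`, `B` and of vectors on the triples. -/
def prodKet (u : Ket (OReg a b)) (f : Fin m → Ket (Loc a b)) : Ket (Reg a b m) :=
  fun x => u (fun r => x (Sum.inl r)) * ∏ j, f j fun q => x (Sum.inr (j, q))

/-- The vector `|i⟩_A |v⟩_B`. -/
def labelKet (i : Fin n) (v : Ket (Fin b)) : Ket (OReg a b) :=
  fun y => ket (enc a i) (y ∘ Sum.inl) * v (y ∘ Sum.inr)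

theorem sum_norm_sq_prodKet (u : Ket (OReg a b)) (f : Fin m → Ket (Loc a b)) :
    ∑ x, ‖prodKet u f x‖ ^ 2 = (∑ y, ‖u y‖ ^ 2) * ∏ j, ∑ z, ‖f j z‖ ^ 2 := by
  simp only [prodKet, norm_mul, mul_pow, norm_prod, ← Finset.prod_pow]
  rw [sum_sumArrow_mul (fun y => ‖u y‖ ^ 2) fun y => ∏ j, ‖f j fun q => y (j, q)‖ ^ 2,
    sum_prodArrow_prod fun j z => ‖f j z‖ ^ 2]

theorem sum_norm_sq_labelKet (i : Fin n) {v : Ket (Fin b)} (hv : ∑ x, ‖v x‖ ^ 2 = 1) :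
    ∑ x, ‖labelKet (a := a) i v x‖ ^ 2 = 1 := by
  simp only [labelKet, norm_mul, mul_pow]
  refine (sum_sumArrow_mul (fun y => ‖ket (enc a i) y‖ ^ 2) fun y => ‖v y‖ ^ 2).trans ?_
  rw [sum_norm_sq_ket, hv, one_mul]

theorem prodKet_eq_zero (u : Ket (OReg a b)) {f : Fin m → Ket (Loc a b)} {j : Fin m} {c : Bool}
    {v : Ket (PIReg a b)} (hf : f j = locKet c v) {x : Reg a b m → Bool} (hx : x (cQubit j) ≠ c) :
    prodKet u f x = 0 := by
  have : (f j fun q => x (Sum.inr (j, q))) = 0 := by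
    rw [hf, locKet]
    exact if_neg hx
  rw [prodKet, Finset.prod_eq_zero (Finset.mem_univ j) this, mul_zero]

theorem prodKet_update (u : Ket (OReg a b)) (f : Fin m → Ket (Loc a b)) (l : Fin m)
    (g : Ket (Loc a b)) (x : Reg a b m → Bool) :
    prodKet u (Function.update f l g) x = u (fun r => x (Sum.inl r)) *
      (∏ j ∈ Finset.univ.erase l, f j fun q => x (Sum.inr (j, q))) *
        g fun q => x (Sum.inr (l, q)) := by
  rw [prodKet, ← Finset.mul_prod_erase _ _ (Finset.mem_univ l), Function.update_self,
    Finset.prod_congr rfl fun j hj => by rw [Function.update_of_ne (Finset.ne_of_mem_erase hj)]]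
  ring

theorem branchKet_eq_prodKet (k : Fin m) (i : Fin n) (v : Ket (Fin b))
    (G : Fin m → Ket (PIReg a b)) :
    branchKet k i v (fun y => ∏ j, G j fun q => y (j, q)) =
      prodKet (labelKet i v) fun j => locKet (decide (j = k)) (G j) := by
  funext x
  simp only [branchKet, prodKet, locKet, Finset.prod_ite_zero, Finset.mem_univ, true_implies]
  change (if ∀ j, x (cQubit j) = decide (j = k) then 1 else 0) * _ =
    _ * (if ∀ j, x (cQubit j) = decide (j = k) then _ else 0)
  split_ifs
  · rw [one_mul]
    rfl
  · simp

theorem copyLabel_copyLabel (l : Fin m) (x : Reg a b m → Bool) :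
    copyLabel l (copyLabel l x) = x := by
  funext q
  match q with
  | Sum.inr (i, some (Sum.inr (Sum.inr t))) => by_cases h : i = l <;> simp [copyLabel, h]
  | Sum.inl _ => rfl
  | Sum.inr (_, none) => rfl
  | Sum.inr (_, some (Sum.inl _)) => rfl
  | Sum.inr (_, some (Sum.inr (Sum.inl _))) => rfl

theorem copyLabel_of_ne {l j : Fin m} (h : j ≠ l) (x : Reg a b m → Bool) (q : Loc a b) :
    copyLabel l x (Sum.inr (j, q)) = x (Sum.inr (j, q)) := by
  match q with
  | none => rfl
  | some (Sum.inl _) => rfl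
  | some (Sum.inr (Sum.inl _)) => rfl
  | some (Sum.inr (Sum.inr _)) => simp [copyLabel, h]

theorem earlierZero_copyLabel (l : Fin m) (x : Reg a b m → Bool) :
    earlierZero l (copyLabel l x) ↔ earlierZero l x := Iff.rfl

/-- `copyLabel` is an involution, so the permutation matrix `T l` acts by composition with it. -/
theorem T_mulVec (l : Fin m) (v : Ket (Reg a b m)) (x : Reg a b m → Bool) :
    (T l *ᵥ v) x = v (copyLabel l x) := by
  simp only [Matrix.mulVec, dotProduct, T, Matrix.of_apply]
  rw [Finset.sum_eq_single (copyLabel l x)]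
  · simp [copyLabel_copyLabel]
  · intro y _ hy
    rw [if_neg, zero_mul]
    rintro rfl
    exact hy (copyLabel_copyLabel l y).symm
  · simp

open Classical in
theorem CT_mulVec (l : Fin m) (v : Ket (Reg a b m)) (x : Reg a b m → Bool) :
    (CT l *ᵥ v) x = if earlierZero l x then v (copyLabel l x) else v x := by
  rw [CT, controlled_mulVec, T_mulVec]
  intro x y h
  simp only [T, Matrix.of_apply, ne_eq, ite_eq_right_iff, one_ne_zero, imp_false, not_not] at h
  rw [h, earlierZero_copyLabel]

theorem indepOf_earlierZero (l : Fin m) : IndepOf (locEmb (a := a) (b := b) l) (earlierZero l) :=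
  fun x z => forall₂_congr fun j hj => by
    rw [extend_eq_of_notMem]
    intro q h
    exact hj.ne (Prod.mk.inj (Sum.inr.inj h)).1.symm

open Classical in
/-- One round of separation, evaluated at a basis vector. -/
theorem round_mulVec (O : Op (OReg a b)) (l : Fin m) (W : Circuit (OReg a b) (Loc a b))
    (v : Ket (Reg a b m)) (x : Reg a b m → Bool) :
    ((CW O l W * CT l) *ᵥ v) x = if earlierZero l x then
      (W.op O *ᵥ fun z => v (copyLabel l (Function.extend (locEmb l) z x))) (x ∘ locEmb l)
        else v x := by
  rw [← Matrix.mulVec_mulVec, CW, controlled_place_mulVec (indepOf_earlierZero l)]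
  have h := indepOf_earlierZero (a := a) (b := b) l
  split_ifs with hx
  · congr 2
    funext z
    rw [slice, CT_mulVec, if_pos ((h x z).2 hx)]
  · rw [CT_mulVec, if_neg hx]

/-- The states of the pairs `(P_j, I_j)` in the branch in which the first `l` rounds gave
`C = 0`. -/
def piFactor (γ : Fin m → Ket (PIReg a b)) (l : ℕ) (j : Fin m) : Ket (PIReg a b) :=
  if (j : ℕ) < l then γ j else ket0 _

/-- The effect of round `l` on the branch in which the previous rounds gave `C = 0`. -/
theorem round_prodKet (O : Op (OReg a b)) (l : Fin m) (W : Circuit (OReg a b) (Loc a b))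
    (i : Fin n) (v : Ket (Fin b)) (γ : Fin m → Ket (PIReg a b)) {x : Reg a b m → Bool}
    (hx : earlierZero l x) :
    ((CW O l W * CT l) *ᵥ prodKet (labelKet i v) fun j => locKet false (piFactor γ l j)) x =
      prodKet (labelKet i v) (Function.update (fun j => locKet false (piFactor γ l j)) l
        (W.op O *ᵥ locKet false (piKet qzero i))) x := by
  rw [round_mulVec, if_pos hx, prodKet_update]
  set A := labelKet i v (fun r => x (Sum.inl r)) *
      ∏ j ∈ Finset.univ.erase l, locKet false (piFactor γ l j) fun q => x (Sum.inr (j, q)) with hA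
  have h : (fun z => prodKet (labelKet i v) (fun j => locKet false (piFactor γ l j))
      (copyLabel l (Function.extend (locEmb l) z x))) = A • locKet false (piKet qzero i) := by
    funext z
    set y := Function.extend (locEmb l) z x with hy
    have hy1 : ∀ r, y (Sum.inl r) = x (Sum.inl r) := fun r =>
      extend_eq_of_notMem _ _ _ fun q h => nomatch h
    have hy2 : ∀ j ≠ l, ∀ q, y (Sum.inr (j, q)) = x (Sum.inr (j, q)) := fun j hj q =>
      extend_eq_of_notMem _ _ _ fun q h => hj (Prod.mk.inj (Sum.inr.inj h)).1.symm
    have hy3 : ∀ q, y (Sum.inr (l, q)) = z q := fun q =>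
      (locEmb l).injective.extend_apply z x q
    have h1 : (fun r => copyLabel l y (Sum.inl r)) = fun r => x (Sum.inl r) := funext hy1
    rw [prodKet, ← Finset.mul_prod_erase _ _ (Finset.mem_univ l), h1,
      Finset.prod_congr rfl fun j hj => by
        rw [funext fun q => (copyLabel_of_ne (Finset.ne_of_mem_erase hj) y q).trans
          (hy2 j (Finset.ne_of_mem_erase hj) q)]]
    rw [Pi.smul_apply, smul_eq_mul, mul_left_comm, ← hA, mul_comm]
    by_cases hl : (fun r => x (Sum.inl (Sum.inl r))) = enc a i
    · congr 1
      simp only [piFactor, lt_irrefl, if_false, locKet]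
      have hc : copyLabel l y (Sum.inr (l, none)) = z none := hy3 none
      simp only [hc]
      congr 1
      have hP : copyLabel l y (Sum.inr (l, some (Sum.inl ()))) = z (some (Sum.inl ())) := hy3 _
      have hI : ∀ r, copyLabel l y (Sum.inr (l, some (Sum.inr (Sum.inl r)))) =
        z (some (Sum.inr (Sum.inl r))) := fun r => hy3 _
      have hL : ∀ t, copyLabel l y (Sum.inr (l, some (Sum.inr (Sum.inr t)))) =
          xor (z (some (Sum.inr (Sum.inr t)))) (enc a i t) := fun t => by
        rw [← hl, ← hy3]
        simp [copyLabel, hy1]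
      have key : (fun q => copyLabel l y (Sum.inr (l, some q))) = (fun _ => false) ↔
          z (some (Sum.inl ())) = false ∧ (fun r => z (some (Sum.inr (Sum.inl r)))) =
            (fun _ => false) ∧ (fun t => z (some (Sum.inr (Sum.inr t)))) = enc a i := by
        simp only [funext_iff, Sum.forall, hP, hI, hL, forall_const]
        simp
      simp only [ket0, ket, piKet, Pi.single_apply, key, qzero]
      by_cases e1 : z (some (Sum.inl ())) = false <;>
      by_cases e2 : (fun r => z (some (Sum.inr (Sum.inl r)))) = (fun _ => false) <;>
      by_cases e3 : (fun t => z (some (Sum.inr (Sum.inr t)))) = enc a i <;> simp [e1, e2, e3]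
    · -- `A` vanishes unless the register `A` holds the label `i`
      have : A = 0 := by
        have : labelKet i v (fun r => x (Sum.inl r)) = 0 := by
          have : ket (enc a i) (fun r => x (Sum.inl (Sum.inl r))) = 0 := by simp [ket, hl]
          exact (congrArg (· * _) this).trans (zero_mul _)
        rw [hA, this, zero_mul]
      rw [this, zero_mul, zero_mul]
  rw [h, Matrix.mulVec_smul]
  rfl

theorem piFactor_succ (γ : Fin m → Ket (PIReg a b)) (l : Fin m) (c : Bool) (v : Ket (PIReg a b)) :
    Function.update (fun j => locKet false (piFactor γ l j)) l (locKet c v) = fun j =>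
      locKet (if j = l then c else false) (if j = l then v else piFactor γ (l + 1) j) := by
  funext j
  by_cases hj : j = l
  · subst hj
    simp
  · have : (j : ℕ) < l + 1 ↔ (j : ℕ) < l := by
      have := Fin.val_ne_of_ne hj
      omega
    simp [hj, piFactor, this]

/-- The state of the branch in which the first `l` rounds gave `C = 0`. -/
noncomputable def zeroBranch (p : Fin n → ℝ) (ψ : Fin n → Ket (Fin b)) (β' : Fin m → ℝ → ℝ)
    (γ : Fin n → Fin m → Ket (PIReg a b)) (l : ℕ) : Ket (Reg a b m) :=
  ∑ i, ((√(p i) * ∏ j ∈ Finset.univ.filter fun j : Fin m => (j : ℕ) < l, β' j √(p i) : ℝ) : ℂ) •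
    prodKet (labelKet i (ψ i)) fun j => locKet false (piFactor (γ i) l j)

variable {p : Fin n → ℝ} {ψ : Fin n → Ket (Fin b)} {O : Op (OReg a b)}
  {W : Fin m → Circuit (OReg a b) (Loc a b)} {β β' : Fin m → ℝ → ℝ}
  {γ : Fin n → Fin m → Ket (PIReg a b)}

theorem stateAfter_zero_eq (h : IsOracle p ψ O) :
    stateAfter O W 0 = zeroBranch p ψ β' γ 0 := by
  funext x
  have hs : slice Function.Embedding.inl x (ket0 (Reg a b m)) =
      (if (fun q => x (Sum.inr q)) = fun _ => false then (1 : ℂ) else 0) • ket0 (OReg a b) := by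
    funext z
    have h1 : Function.extend (Function.Embedding.inl : OReg a b ↪ Reg a b m) z x =
        (fun _ => false) ↔ z = (fun _ => false) ∧ (fun q => x (Sum.inr q)) = fun _ => false := by
      simp only [funext_iff, Sum.forall (α := OReg a b)]
      refine and_congr (forall_congr' fun r => ?_) (forall_congr' fun q => ?_)
      · rw [show (Sum.inl r : Reg a b m) = (Function.Embedding.inl : OReg a b ↪ Reg a b m) r from
          rfl, Function.Embedding.inl.injective.extend_apply]
      · rw [extend_eq_of_notMem _ _ _ fun r h => Sum.inl_ne_inr h]
    simp only [slice, ket0, ket, Pi.single_apply, h1, Pi.smul_apply, smul_eq_mul, ite_and]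
    split_ifs <;> simp
  rw [stateAfter, place_mulVec, hs, Matrix.mulVec_smul, h.apply_zero, zeroBranch, Finset.sum_apply,
    Pi.smul_apply, smul_eq_mul, Finset.mul_sum]
  refine Finset.sum_congr rfl fun i _ => ?_
  have h2 : ∏ j : Fin m, locKet false (ket0 (PIReg a b)) (fun q => x (Sum.inr (j, q))) =
      if (fun q => x (Sum.inr q)) = fun _ => false then (1 : ℂ) else 0 := by
    have h3 : ∀ j : Fin m, locKet false (ket0 (PIReg a b)) (fun q => x (Sum.inr (j, q))) =
        if ∀ q, x (Sum.inr (j, q)) = false then (1 : ℂ) else 0 := fun j => by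
      simp only [locKet, ket0, ket, Pi.single_apply, funext_iff, Option.forall (p := fun q =>
        x (Sum.inr (j, q)) = false), ite_and]
    simp only [h3, Finset.prod_ite_zero, Finset.prod_const_one, Finset.mem_univ, true_implies,
      funext_iff, Prod.forall]
  simp only [Pi.smul_apply, smul_eq_mul, prodKet, piFactor, Nat.not_lt_zero, if_false, h2,
    Finset.filter_false, Finset.prod_empty, mul_one]
  rw [mul_comm, mul_assoc]
  rfl

/-- One round, on the part of the state in which the earlier qubits `C_j` are `0`. -/
theorem stateAfter_succ_eq (l : Fin m)
    (hγ : ∀ i, (W l).op O *ᵥ locKet false (piKet qzero i) =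
      (β' l √(p i) : ℂ) • locKet false (γ i l) + (β l √(p i) : ℂ) • locKet true (piKet qplus i))
    (hs : ∀ x, earlierZero l x → stateAfter O W l x = zeroBranch p ψ β' γ l x)
    {x : Reg a b m → Bool} (hx : earlierZero l x) :
    stateAfter O W (l + 1) x = zeroBranch p ψ β' γ (l + 1) x +
      ∑ i, ((√(p i) * coefB β β' l √(p i) : ℝ) : ℂ) *
        prodKet (labelKet i (ψ i)) (fun j => locKet (if j = l then true else false)
          (if j = l then piKet qplus i else piFactor (γ i) (l + 1) j)) x := by
  have h1 : stateAfter O W (l + 1) x =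
      ((CW O l (W l) * CT l) *ᵥ zeroBranch p ψ β' γ l) x := by
    rw [stateAfter, dif_pos l.2, round_mulVec, round_mulVec, if_pos hx, if_pos hx]
    congr 2
    funext z
    exact hs _ ((indepOf_earlierZero l x z).2 hx)
  rw [h1, zeroBranch, Matrix.mulVec_sum, zeroBranch, Finset.sum_apply, Finset.sum_apply,
    ← Finset.sum_add_distrib]
  refine Finset.sum_congr rfl fun i _ => ?_
  have hI : (Finset.univ.filter fun j : Fin m => (j : ℕ) < l) = Finset.Iio l := by
    ext j; simp
  have hS : (Finset.univ.filter fun j : Fin m => (j : ℕ) < (l : ℕ) + 1) =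
      insert l (Finset.Iio l) := by
    ext j; simp
  rw [Matrix.mulVec_smul, Pi.smul_apply, Pi.smul_apply, round_prodKet _ _ _ _ _ _ hx, hγ,
    prodKet_update, hI, hS, Finset.prod_insert (by simp)]
  have e1 := prodKet_update (labelKet i (ψ i)) (fun j => locKet false (piFactor (γ i) l j)) l
    (locKet false (γ i l)) x
  have e2 := prodKet_update (labelKet i (ψ i)) (fun j => locKet false (piFactor (γ i) l j)) l
    (locKet true (piKet qplus i)) x
  rw [piFactor_succ] at e1 e2
  have e3 : (fun j => locKet (if j = l then false else false)
      (if j = l then γ i l else piFactor (γ i) (l + 1) j)) =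
        fun j => locKet false (piFactor (γ i) (l + 1) j) := by
    funext j
    by_cases hj : j = l
    · subst hj; simp [piFactor]
    · simp [hj]
  rw [e3] at e1
  simp only [smul_eq_mul, Pi.add_apply, Pi.smul_apply]
  rw [e1, e2, coefB]
  push_cast
  ring

theorem zeroBranch_eq_zero {l : ℕ} {x : Reg a b m → Bool} {j : Fin m} (hx : x (cQubit j) = true) :
    zeroBranch p ψ β' γ l x = 0 := by
  rw [zeroBranch, Finset.sum_apply]
  refine Finset.sum_eq_zero fun i _ => ?_
  rw [Pi.smul_apply, prodKet_eq_zero _ (j := j) rfl (by simp [hx]), smul_zero]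

/-- After `l` rounds, the part of the state with `C_j = 0` for all `j < l` is the branch without any
success, and no qubit `C_j` with `j ≥ l` has been touched. The parts with an earlier success need
not be described: later rounds act on them as the identity. -/
theorem stateAfter_eq (h : IsOracle p ψ O)
    (hγ : ∀ j i, (W j).op O *ᵥ locKet false (piKet qzero i) =
      (β' j √(p i) : ℂ) • locKet false (γ i j) + (β j √(p i) : ℂ) • locKet true (piKet qplus i))
    (l : ℕ) (hl : l ≤ m) :
    (∀ x, (∀ j : Fin m, (j : ℕ) < l → x (cQubit j) = false) →
      stateAfter O W l x = zeroBranch p ψ β' γ l x) ∧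
    ∀ (x : Reg a b m → Bool) (j : Fin m), l ≤ j → x (cQubit j) = true →
      stateAfter O W l x = 0 := by
  induction l with
  | zero =>
    rw [stateAfter_zero_eq (β' := β') (γ := γ) h]
    exact ⟨fun _ _ => rfl, fun x j _ hj => zeroBranch_eq_zero hj⟩
  | succ l ih =>
    obtain ⟨ih1, ih2⟩ := ih (by omega)
    have hround := fun x => stateAfter_succ_eq (ψ := ψ) (O := O) (γ := γ) ⟨l, hl⟩ (hγ _)
      (fun x hx => ih1 x fun j hj => hx j hj) (x := x)
    refine ⟨fun x hx => ?_, fun x j hj hxj => ?_⟩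
    · rw [hround x fun j hj => hx j (Nat.lt_succ_of_lt hj), Finset.sum_eq_zero, add_zero]
      intro i _
      rw [prodKet_eq_zero _ (j := ⟨l, hl⟩) rfl (by rw [hx _ (Nat.lt_succ_self l)]; simp), mul_zero]
    · by_cases hx : earlierZero ⟨l, hl⟩ x
      · rw [hround x hx, zeroBranch_eq_zero hxj, zero_add, Finset.sum_eq_zero]
        intro i _
        have hne : j ≠ ⟨l, hl⟩ := fun e => by
          rw [e] at hj
          exact absurd hj (Nat.not_succ_le_self l)
        rw [prodKet_eq_zero _ (j := j) rfl (by simp [hxj, hne]), mul_zero]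
      · rw [stateAfter, dif_pos (Nat.lt_of_succ_le hl), round_mulVec, if_neg hx]
        exact ih2 x j (by omega) hxj

/-- The vectors `g_i` in the branch `C_k = 1`. -/
noncomputable def branchVec (γ : Fin n → Fin m → Ket (PIReg a b)) (k : Fin m) (i : Fin n) :
    Ket (Fin m × PIReg a b) :=
  fun y => ∏ j, (if j = k then piKet qplus i else piFactor (γ i) (k + 1) j) fun q => y (j, q)

theorem normalized_branchVec (hγ : ∀ i j, Normalized (γ i j)) (k : Fin m) (i : Fin n) :
    Normalized (branchVec γ k i) := by
  simp only [Normalized, branchVec, norm_prod, ← Finset.prod_pow]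
  rw [sum_prodArrow_prod fun j z =>
    ‖(if j = k then piKet qplus i else piFactor (γ i) (k + 1) j) z‖ ^ 2]
  refine Finset.prod_eq_one fun j _ => ?_
  split_ifs
  · exact normalized_piKet_qplus i
  · unfold piFactor
    split_ifs
    · exact hγ i j
    · exact sum_norm_sq_ket _

/-- The branch `C_k = 1` of the separated state. -/
theorem restrict_Psi (h : IsOracle p ψ O)
    (hγ : ∀ j i, (W j).op O *ᵥ locKet false (piKet qzero i) =
      (β' j √(p i) : ℂ) • locKet false (γ i j) + (β j √(p i) : ℂ) • locKet true (piKet qplus i))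
    (k : Fin m) : restrict (fun x => x (cQubit k) = true) (Psi O W k) =
      ∑ i, ((√(p i) * coefB β β' k √(p i) : ℝ) : ℂ) • branchKet k i (ψ i) (branchVec γ k i) := by
  funext x
  obtain ⟨h1, h2⟩ := stateAfter_eq h hγ k k.2.le
  rw [restrict, Finset.sum_apply]
  simp only [Pi.smul_apply, smul_eq_mul]
  by_cases hx : x (cQubit k) = true
  · rw [if_pos hx, Psi]
    by_cases hz : earlierZero k x
    · rw [stateAfter_succ_eq (ψ := ψ) (γ := γ) k (hγ k) (fun x hx => h1 x fun j hj => hx j hj) hz,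
        zeroBranch_eq_zero hx, zero_add]
      refine Finset.sum_congr rfl fun i _ => ?_
      unfold branchVec
      rw [branchKet_eq_prodKet]
      simp
    · rw [stateAfter, dif_pos k.2, round_mulVec, if_neg hz, h2 x k le_rfl hx]
      refine (Finset.sum_eq_zero fun i _ => ?_).symm
      rw [branchKet, if_neg, zero_mul, mul_zero]
      intro hc
      refine hz fun j hj => ?_
      rw [hc, decide_eq_false hj.ne]
  · rw [if_neg hx]
    refine (Finset.sum_eq_zero fun i _ => ?_).symm
    rw [branchKet, if_neg, zero_mul, mul_zero]
    intro hc
    exact hx (by rw [hc]; simp)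

/-- The branch vectors are orthonormal, since at each basis vector at most one label contributes. -/
theorem sum_norm_sq_branch (hn : n ≤ 2 ^ a) (hψ : ∀ i, ∑ x, ‖ψ i x‖ ^ 2 = 1)
    (hγ : ∀ i j, Normalized (γ i j)) (k : Fin m) (c : Fin n → ℂ) :
    ∑ x, ‖(∑ i, c i • branchKet k i (ψ i) (branchVec γ k i)) x‖ ^ 2 = ∑ i, ‖c i‖ ^ 2 := by
  have h1 : ∀ i, ∑ x, ‖branchKet k i (ψ i) (branchVec γ k i) x‖ ^ 2 = 1 := fun i => by
    unfold branchVec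
    rw [branchKet_eq_prodKet, sum_norm_sq_prodKet, sum_norm_sq_labelKet i (hψ i), one_mul]
    refine Finset.prod_eq_one fun j _ => ?_
    rw [sum_norm_sq_locKet]
    split_ifs
    · exact normalized_piKet_qplus i
    · unfold piFactor
      split_ifs
      · exact hγ i j
      · exact sum_norm_sq_ket _
  have h2 : ∀ x : Reg a b m → Bool, ‖(∑ i, c i • branchKet k i (ψ i) (branchVec γ k i)) x‖ ^ 2 =
      ∑ i, ‖c i‖ ^ 2 * ‖branchKet k i (ψ i) (branchVec γ k i) x‖ ^ 2 := fun x => by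
    rw [Finset.sum_apply]
    have h3 : ∀ i, (fun t => x (Sum.inl (Sum.inl t))) ≠ enc a i →
        branchKet k i (ψ i) (branchVec γ k i) x = 0 := fun i hi => by
      simp [branchKet, ket, hi]
    by_cases hx : ∃ i : Fin n, (fun t => x (Sum.inl (Sum.inl t))) = enc a i
    · obtain ⟨i, hi⟩ := hx
      have h4 : ∀ j ≠ i, branchKet k j (ψ j) (branchVec γ k j) x = 0 := fun j hj =>
        h3 j fun e => hj (enc_injective hn (e.symm.trans hi))
      rw [Finset.sum_eq_single i (fun j _ hj => by simp [h4 j hj]) (by simp),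
        Finset.sum_eq_single i (fun j _ hj => by simp [h4 j hj]) (by simp)]
      simp [mul_pow]
    · push Not at hx
      rw [Finset.sum_eq_zero fun i _ => by simp [h3 i (hx i)],
        Finset.sum_eq_zero fun i _ => by simp [h3 i (hx i)]]
      simp
  rw [Finset.sum_congr rfl fun x _ => h2 x, Finset.sum_comm]
  refine Finset.sum_congr rfl fun i _ => ?_
  rw [← Finset.mul_sum, h1, mul_one]

theorem sum_norm_sq_restrict_Psi (hn : n ≤ 2 ^ a) (h : IsOracle p ψ O)
    (hγ : ∀ j i, (W j).op O *ᵥ locKet false (piKet qzero i) =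
      (β' j √(p i) : ℂ) • locKet false (γ i j) + (β j √(p i) : ℂ) • locKet true (piKet qplus i))
    (hγ1 : ∀ i j, Normalized (γ i j)) (k : Fin m) :
    ∑ x, ‖restrict (fun x => x (cQubit k) = true) (Psi O W k) x‖ ^ 2 = sumB p β β' k := by
  rw [restrict_Psi h hγ k, sum_norm_sq_branch hn h.normalized hγ1, sumB]
  refine Finset.sum_congr rfl fun i _ => ?_
  rw [Complex.norm_real, Real.norm_eq_abs, sq_abs, mul_pow, Real.sq_sqrt (h.nonneg i)]

end Separated

/-! ### The circuit that prepares the separated state -/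

section Preparation

variable {a b m : ℕ}

/-- The qubits `C_i` with `i < j`. -/
def earlierQubits (j : Fin m) : Finset (Reg a b m) :=
  (Finset.Iio j).map ⟨cQubit, fun _ _ h => (Prod.mk.inj (Sum.inr.inj h)).1⟩

theorem forall_mem_earlierQubits (j : Fin m) (x : Reg a b m → Bool) :
    (∀ c ∈ earlierQubits j, x c = false) ↔ earlierZero j x := by
  rw [earlierQubits, Finset.forall_mem_map]
  simp only [Finset.mem_Iio]
  exact Iff.rfl

theorem card_earlierQubits (j : Fin m) : (earlierQubits (a := a) (b := b) j).card = j := by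
  rw [earlierQubits, Finset.card_map, Fin.card_Iio]

theorem locEmb_notMem (j : Fin m) (q : Loc a b) : locEmb j q ∉ earlierQubits j := fun h => by
  obtain ⟨i, hi, h⟩ := Finset.mem_map.1 h
  exact (Finset.mem_Iio.1 hi).ne (Prod.mk.inj (Sum.inr.inj h)).1

theorem inl_notMem (j : Fin m) (r : OReg a b) : (Sum.inl r : Reg a b m) ∉ earlierQubits j :=
  fun h => by
    obtain ⟨i, _, h⟩ := Finset.mem_map.1 h
    exact Sum.inr_ne_inl h

theorem locEmb_ne_inl (j : Fin m) (q : Loc a b) (r : OReg a b) : locEmb j q ≠ Sum.inl r :=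
  Sum.inr_ne_inl

/-- The circuit for the controlled copy of the label. -/
noncomputable def copyCircuit (j : Fin m) : Circuit (OReg a b) (Reg a b m) :=
  addLayer _ (earlierQubits j) (fun t => Sum.inl (Sum.inl t))
    (fun t : Fin a => locEmb j (labelQubit t)) (fun _ => locEmb_notMem j _)
    (fun _ _ => locEmb_ne_inl j _ _)

/-- The circuit for one round of separation. -/
noncomputable def roundCircuit (j : Fin m) (W : Circuit (OReg a b) (Loc a b)) :
    Circuit (OReg a b) (Reg a b m) :=
  copyCircuit j ++ zeroEmbed (locEmb j) (earlierQubits j) (locEmb_notMem j) W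

theorem copyCircuit_op_mulVec (O : Op (OReg a b)) (j : Fin m) (v : Ket (Reg a b m)) :
    Circuit.op O (copyCircuit j) *ᵥ v = CT j *ᵥ v := by
  classical
  have hinj : Function.Injective fun t : Fin a => locEmb j (labelQubit t : Loc a b) :=
    fun t u h => by simpa using (locEmb j).injective h
  funext x
  rw [copyCircuit, addLayer_op_mulVec O _ _ hinj fun _ => inl_notMem j _, CT_mulVec, ← apply_ite v]
  congr 1
  simp only [forall_mem_earlierQubits]
  funext q
  split_ifs with hx
  · simp only [hx, and_true]
    match q with
    | Sum.inr (i, some (Sum.inr (Sum.inr t))) =>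
      by_cases hi : i = j
      · subst hi
        refine (flipFn_apply hinj (fun t => x (Sum.inl (Sum.inl t)) = true) x t).trans ?_
        have e : locEmb i (labelQubit t) =
          (Sum.inr (i, some (Sum.inr (Sum.inr t))) : Reg a b m) := rfl
        rw [e, copyLabel, if_pos rfl]
        cases x (Sum.inl (Sum.inl t)) <;> simp
      · rw [flipFn_of_ne, copyLabel, if_neg hi]
        exact fun t h => hi (Prod.mk.inj (Sum.inr.inj h)).1.symm
    | Sum.inl _ => exact flipFn_of_ne (fun t h => Sum.inr_ne_inl h) _ _
    | Sum.inr (_, none) =>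
      refine flipFn_of_ne (fun t h => ?_) _ _
      have := (Prod.mk.inj (Sum.inr.inj h)).2
      simp at this
    | Sum.inr (_, some (Sum.inl _)) =>
      refine flipFn_of_ne (fun t h => ?_) _ _
      have := (Prod.mk.inj (Sum.inr.inj h)).2
      simp at this
    | Sum.inr (_, some (Sum.inr (Sum.inl _))) =>
      refine flipFn_of_ne (fun t h => ?_) _ _
      have := (Prod.mk.inj (Sum.inr.inj h)).2
      simp at this
  · simp [hx, flipFn]

theorem roundCircuit_op_mulVec (O : Op (OReg a b)) (j : Fin m) (W : Circuit (OReg a b) (Loc a b))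
    (v : Ket (Reg a b m)) :
    Circuit.op O (roundCircuit j W) *ᵥ v = (CW O j W * CT j) *ᵥ v := by
  classical
  rw [roundCircuit, Circuit.op_append_mulVec, copyCircuit_op_mulVec, ← Matrix.mulVec_mulVec]
  funext x
  rw [zeroEmbed_op_mulVec, CW, controlled_place_mulVec (indepOf_earlierZero j)]
  simp only [forall_mem_earlierQubits]

theorem roundCircuit_queries (j : Fin m) (W : Circuit (OReg a b) (Loc a b)) :
    (roundCircuit j W).queries = W.queries := by
  rw [roundCircuit, Circuit.queries_append, copyCircuit, addLayer_queries, zeroEmbed,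
    conjNot_queries, Circuit.queries_embed, zero_add]

theorem roundCircuit_size_le (j : Fin m) (W : Circuit (OReg a b) (Loc a b)) :
    (roundCircuit j W).size ≤ a * (2 + m) + 4 * m + (1 + m) * W.size := by
  have h1 := addLayer_size_le (R := OReg a b) (S := earlierQubits j)
    (src := fun t => Sum.inl (Sum.inl t))
    (tgt := fun t : Fin a => locEmb (a := a) (b := b) j (labelQubit t))
    (fun _ => locEmb_notMem j _) fun _ _ => locEmb_ne_inl j _ _
  have h2 := Circuit.size_embed_le (locEmb_notMem j) W
  rw [card_earlierQubits] at h1 h2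
  rw [roundCircuit, Circuit.size_append, copyCircuit, zeroEmbed, conjNot_size, card_earlierQubits]
  rw [Fintype.card_fin] at h1
  have hj : (j : ℕ) ≤ m := j.2.le
  have h3 : a * (2 + (j : ℕ)) ≤ a * (2 + m) := by gcongr
  have h4 : (1 + (j : ℕ)) * W.size ≤ (1 + m) * W.size := by gcongr
  omega

/-- The circuit for the state after `l` rounds of separation. -/
noncomputable def prepCircuit (W : Fin m → Circuit (OReg a b) (Loc a b)) :
    ℕ → Circuit (OReg a b) (Reg a b m)
  | 0 => [Step.query ∅ Function.Embedding.inl (by simp) false]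
  | l + 1 => prepCircuit W l ++ if h : l < m then roundCircuit ⟨l, h⟩ (W ⟨l, h⟩) else []

theorem prepCircuit_op_mulVec (O : Op (OReg a b)) (W : Fin m → Circuit (OReg a b) (Loc a b))
    (l : ℕ) : Circuit.op O (prepCircuit W l) *ᵥ ket0 (Reg a b m) = stateAfter O W l := by
  induction l with
  | zero =>
    funext x
    rw [prepCircuit, Circuit.op_singleton, query_op_mulVec, stateAfter, place_mulVec]
    simp
  | succ l ih =>
    rw [prepCircuit, Circuit.op_append_mulVec, ih, stateAfter]
    split_ifs with h
    · exact roundCircuit_op_mulVec O _ _ _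
    · simp [Circuit.op]

/-- A geometric sum: the first query costs at most as much as the bound for one round. -/
theorem prepCircuit_queries_le {W : Fin m → Circuit (OReg a b) (Loc a b)} {A : ℝ} (hA : 1 ≤ 2 * A)
    (hW : ∀ j, ((W j).queries : ℝ) ≤ A * 2 ^ ((j : ℕ) + 1)) (l : ℕ) :
    ((prepCircuit W l).queries : ℝ) ≤ A * 2 ^ (l + 1) := by
  induction l with
  | zero => simpa [prepCircuit, Circuit.queries, Step.queries, mul_comm] using hA
  | succ l ih =>
    rw [prepCircuit, Circuit.queries_append]
    push_cast
    have h : ((if h : l < m then roundCircuit ⟨l, h⟩ (W ⟨l, h⟩) else [] :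
        Circuit (OReg a b) (Reg a b m)).queries : ℝ) ≤ A * 2 ^ (l + 1) := by
      split_ifs with h
      · rw [roundCircuit_queries]
        exact hW _
      · have : 0 ≤ A * 2 ^ (l + 1) := mul_nonneg (by linarith) (by positivity)
        simpa [Circuit.queries] using this
    calc _ ≤ A * 2 ^ (l + 1) + A * 2 ^ (l + 1) := add_le_add ih h
      _ = _ := by ring

theorem prepCircuit_size_le {W : Fin m → Circuit (OReg a b) (Loc a b)} {A : ℝ} (hA : 1 ≤ 2 * A)
    (hW : ∀ j, ((W j).size : ℝ) ≤ A * 2 ^ ((j : ℕ) + 1)) (l : ℕ) :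
    ((prepCircuit W l).size : ℝ) ≤ 7 * ((a : ℝ) + b + m + 1) ^ 2 * A * 2 ^ (l + 1) := by
  have hN : (1 : ℝ) ≤ ((a : ℝ) + b + m + 1) ^ 2 := by
    nlinarith [Nat.cast_nonneg (α := ℝ) a, Nat.cast_nonneg (α := ℝ) b,
      Nat.cast_nonneg (α := ℝ) m]
  induction l with
  | zero =>
    simp only [prepCircuit, Circuit.size, Step.size, List.map_cons, List.map_nil, List.sum_cons,
      List.sum_nil, Finset.card_empty, add_zero, Nat.cast_one, zero_add, pow_one]
    nlinarith
  | succ l ih =>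
    rw [prepCircuit, Circuit.size_append]
    push_cast
    have h : ((if h : l < m then roundCircuit ⟨l, h⟩ (W ⟨l, h⟩) else [] :
        Circuit (OReg a b) (Reg a b m)).size : ℝ) ≤
          7 * ((a : ℝ) + b + m + 1) ^ 2 * A * 2 ^ (l + 1) := by
      split_ifs with h
      · have h1 : ((roundCircuit ⟨l, h⟩ (W ⟨l, h⟩)).size : ℝ) ≤
            a * (2 + m) + 4 * m + (1 + m) * (W ⟨l, h⟩).size := by
          exact_mod_cast roundCircuit_size_le ⟨l, h⟩ (W ⟨l, h⟩)
        have h2 := hW ⟨l, h⟩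
        have h3 : (1 : ℝ) ≤ A * 2 ^ (l + 1) := by
          have : (1 : ℝ) ≤ 2 ^ l := one_le_pow₀ one_le_two
          rw [pow_succ]
          nlinarith
        generalize hX : A * 2 ^ (l + 1) = X at h2 h3
        have ha := Nat.cast_nonneg (α := ℝ) a
        have hb := Nat.cast_nonneg (α := ℝ) b
        have hm := Nat.cast_nonneg (α := ℝ) m
        set N : ℝ := (a : ℝ) + b + m + 1 with hNdef
        have hN1 : 1 ≤ N := by linarith
        have h4 : (1 + (m : ℝ)) * (W ⟨l, h⟩).size ≤ N * X := by
          have : (0 : ℝ) ≤ (W ⟨l, h⟩).size := Nat.cast_nonneg _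
          gcongr
          linarith
        have h5 : (a : ℝ) * (2 + m) ≤ N * (N + 1) := by
          exact mul_le_mul (by linarith) (by linarith) (by linarith) (by linarith)
        calc _ ≤ N * (N + 1) + 4 * N + N * X := by linarith
          _ ≤ 6 * N ^ 2 * X + N ^ 2 * X := by
            have h6 : N * X ≤ N ^ 2 * X := by gcongr; nlinarith
            have h7 : 6 * N ^ 2 * 1 ≤ 6 * N ^ 2 * X := by gcongr
            nlinarith
          _ = 7 * N ^ 2 * X := by ring
          _ = _ := by rw [← hX]; ring
      · have : 0 ≤ A := by linarith
        simp only [Circuit.size, List.map_nil, List.sum_nil, Nat.cast_zero]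
        positivity
    calc _ ≤ _ := add_le_add ih h
      _ = _ := by ring

end Preparation

/-! ### Amplitude amplification with an ancilla -/

section Amplification

variable {R Q : Type} [DecidableEq R] [Fintype R] [DecidableEq Q] [Fintype Q]

theorem slice_some_withAncilla {Q : Type} (v : Ket Q) (x : Option Q → Bool) :
    slice Function.Embedding.some x (withAncilla v) = if x none = false then v else 0 := by
  funext z
  have h1 : Function.extend Function.Embedding.some z x none = x none :=
    extend_eq_of_notMem _ _ _ fun r h => nomatch h
  have h2 : (fun q => Function.extend Function.Embedding.some z x (some q)) = z :=
    extend_comp Function.Embedding.some z x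
  rw [slice, withAncilla, h1, h2]
  split_ifs <;> rfl

/-- The circuit `c`, next to an ancilla on which it does not act. -/
def ancillaEmbed {R Q : Type} [DecidableEq Q] (c : Circuit R Q) : Circuit R (Option Q) :=
  c.embed Function.Embedding.some ∅ (by simp)

theorem ancillaEmbed_op_mulVec (O : Op R) (c : Circuit R Q) (v : Ket Q) :
    Circuit.op O (ancillaEmbed c) *ᵥ withAncilla v = withAncilla (Circuit.op O c *ᵥ v) := by
  funext x
  rw [← slice_self Function.Embedding.some x (Circuit.op O _ *ᵥ _), ancillaEmbed,
    Circuit.slice_op_embed, if_pos (by simp), slice_some_withAncilla, withAncilla]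
  split_ifs
  · rfl
  · simp

theorem ancillaEmbed_inverse_op_mulVec {O : Op R} (hO : O ∈ Matrix.unitaryGroup (R → Bool) ℂ)
    (c : Circuit R Q) (v : Ket Q) : Circuit.op O (ancillaEmbed c).inverse *ᵥ withAncilla v =
      withAncilla ((Circuit.op O c)ᴴ *ᵥ v) := by
  have h := Circuit.op_mem_unitaryGroup hO c
  have h1 : v = Circuit.op O c *ᵥ ((Circuit.op O c)ᴴ *ᵥ v) := by
    rw [Matrix.mulVec_mulVec, ← Matrix.star_eq_conjTranspose, Matrix.mem_unitaryGroup_iff.1 h,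
      Matrix.one_mulVec]
  conv_lhs => rw [h1]
  rw [← ancillaEmbed_op_mulVec, Circuit.op_inverse,
    conjTranspose_mulVec_mulVec (Circuit.op_mem_unitaryGroup hO _)]

theorem withAncilla_ket0 : withAncilla (ket0 Q) = ket0 (Option Q) := by
  funext x
  simp only [withAncilla, ket0, ket, Pi.single_apply, funext_iff, Option.forall (p := fun q =>
    x q = false), ite_and]

/-- Amplification of the part of `c |0⟩` with the qubit `t` equal to `1`; the phases are applied
to an ancilla. -/
noncomputable def amplifyCircuit {R Q : Type} [DecidableEq Q] [Fintype Q] (c : Circuit R Q) (t : Q)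
    (φ : ℕ → ℂ) (hφ : ∀ i, ‖φ i‖ = 1) (l : ℕ) : Circuit R (Option Q) :=
  signalCircuit (ancillaEmbed c)
    (fun i => zeroGate R (Finset.univ.map Function.Embedding.some) none (by simp)
      (phaseGate (φ i) (hφ i)))
    (fun i => [Step.gate {some t} none (by simp) (phaseGate (φ i) (hφ i))]) l

theorem amplifyCircuit_op_mulVec {O : Op R} (hO : O ∈ Matrix.unitaryGroup (R → Bool) ℂ)
    (c : Circuit R Q) (t : Q) (φ : ℕ → ℂ) (hφ : ∀ i, ‖φ i‖ = 1) (l : ℕ) :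
    Circuit.op O (amplifyCircuit c t φ hφ l) *ᵥ ket0 (Option Q) =
      withAncilla (signalVec (Circuit.op O c) (fun _ => false) (fun x => x t = true) φ l) := by
  rw [← withAncilla_ket0]
  refine signalCircuit_op_mulVec (Circuit.op_mem_unitaryGroup hO c)
    (fun v => ancillaEmbed_op_mulVec O c v) (fun v => ancillaEmbed_inverse_op_mulVec hO c v)
    (fun i v => ?_) (fun i v => ?_) l
  · funext x
    rw [zero_phaseGate_op_mulVec]
    have h : (∀ q ∈ Finset.univ.map (Function.Embedding.some (α := Q)), x q = false) ↔
        (fun q => x (some q)) = fun _ => false := by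
      simp [funext_iff]
    simp only [h, withAncilla]
    split_ifs <;> simp_all
  · funext x
    rw [Circuit.op_singleton, phaseGate_op_mulVec]
    simp only [Finset.mem_singleton, forall_eq, withAncilla]
    split_ifs <;> simp_all

theorem amplifyCircuit_queries {R Q : Type} [DecidableEq Q] [Fintype Q] (c : Circuit R Q) (t : Q)
    (φ : ℕ → ℂ) (hφ : ∀ i, ‖φ i‖ = 1) (l : ℕ) :
    (amplifyCircuit c t φ hφ l).queries = l * c.queries := by
  rw [amplifyCircuit, signalCircuit_queries _ (fun _ => zeroGate_queries _ _ _ _) fun _ => rfl,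
    ancillaEmbed, Circuit.queries_embed]

theorem amplifyCircuit_size_le {R Q : Type} [DecidableEq Q] [Fintype Q] (c : Circuit R Q) (t : Q)
    (φ : ℕ → ℂ) (hφ : ∀ i, ‖φ i‖ = 1) (l : ℕ) :
    (amplifyCircuit c t φ hφ l).size ≤ l * c.size + (l + 1) * (2 + 3 * Fintype.card Q) := by
  refine (signalCircuit_size_le _ (s := 2 + 3 * Fintype.card Q) (fun i => ?_) (fun i => ?_)
    l).trans ?_
  · rw [zeroGate_size, Finset.card_map, Finset.card_univ]
    omega
  · simp [Circuit.size, Step.size]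
  · gcongr
    refine (Circuit.size_embed_le _ c).trans ?_
    simp

/-- After an odd number of steps, the overlap with the normalized marked part of `M |z⟩`. -/
theorem norm_sq_star_signalVec_dotProduct {M : Op Q} {z : Q → Bool} {good : (Q → Bool) → Prop}
    (φ : ℕ → ℂ) {l : ℕ} (hl : ¬ Even l) (hpos : 0 < goodWeight M z good) :
    ‖star (signalVec M z good φ l) ⬝ᵥ
      ((√(goodWeight M z good) : ℝ) : ℂ)⁻¹ • restrict good (M *ᵥ ket z)‖ ^ 2 =
        goodWeight M z good * ‖(signal φ (goodWeight M z good) l).1‖ ^ 2 := by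
  set t := goodWeight M z good with ht
  have h : star (signalVec M z good φ l) ⬝ᵥ restrict good (M *ᵥ ket z) =
      star (signal φ t l).1 * t := by
    rw [ht, goodWeight, Complex.ofReal_sum, Finset.mul_sum, dotProduct]
    refine Finset.sum_congr rfl fun x _ => ?_
    by_cases hx : good x
    · rw [Pi.star_apply, signalVec_odd z φ hl hx, restrict, if_pos hx, star_mul', mul_assoc,
        ← Complex.normSq_eq_norm_sq, Complex.normSq_eq_conj_mul_self, ← goodWeight, ← ht]
      rfl
    · simp [restrict, hx]
  rw [dotProduct_smul, h, smul_eq_mul, norm_mul, norm_mul, norm_star, norm_inv, Complex.norm_real,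
    Complex.norm_real, Real.norm_of_nonneg (Real.sqrt_nonneg _), Real.norm_of_nonneg hpos.le,
    mul_pow, mul_pow, inv_pow, Real.sq_sqrt hpos.le]
  field_simp

end Amplification

/-! ### Extraction of a branch -/

section Extraction

variable {n a b m : ℕ}

/-- The residual vectors `γ` of all separation circuits, for one oracle. -/
theorem Separates.exists_residual {ε : ℝ} {W : Fin m → Circuit (OReg a b) (Loc a b)}
    {β β' : Fin m → ℝ → ℝ} (hW : ∀ j, Separates n (thr j) ε (W j) (β j) (β' j)) {p : Fin n → ℝ}
    {ψ : Fin n → Ket (Fin b)} {O : Op (OReg a b)} (h : IsOracle p ψ O) :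
    ∃ γ : Fin n → Fin m → Ket (PIReg a b), (∀ i j, Normalized (γ i j)) ∧
      ∀ j i, (W j).op O *ᵥ locKet false (piKet qzero i) =
        (β' j √(p i) : ℂ) • locKet false (γ i j) +
          (β j √(p i) : ℂ) • locKet true (piKet qplus i) := by
  choose γ hγ using fun (i : Fin n) (j : Fin m) => (hW j).apply p ψ O h i
  exact ⟨γ, fun i j => (hγ i j).1, fun j i => (hγ i j).2⟩

theorem phi_eq_smul (p : Fin n → ℝ) (O : Op (OReg a b)) (W : Fin m → Circuit (OReg a b) (Loc a b))
    (β β' : Fin m → ℝ → ℝ) (k : Fin m) : phi p O W β β' k =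
      ((√(sumB p β β' k) : ℝ) : ℂ)⁻¹ • restrict (fun x => x (cQubit k) = true) (Psi O W k) := by
  funext x
  simp only [phi, restrict, Pi.smul_apply, smul_eq_mul, mul_ite, mul_zero]

theorem card_reg_le : (Fintype.card (Reg a b m) : ℝ) ≤ 3 * ((a : ℝ) + b + m + 1) ^ 2 := by
  have h : Fintype.card (Reg a b m) = a + b + m * (2 * a + b + 2) := by
    simp only [Fintype.card_sum, Fintype.card_prod, Fintype.card_option, Fintype.card_fin,
      Fintype.card_unit]
    ring
  rw [h]
  push_cast
  nlinarith [Nat.cast_nonneg (α := ℝ) a, Nat.cast_nonneg (α := ℝ) b, Nat.cast_nonneg (α := ℝ) m,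
    mul_nonneg (Nat.cast_nonneg (α := ℝ) m) (Nat.cast_nonneg (α := ℝ) a),
    mul_nonneg (Nat.cast_nonneg (α := ℝ) m) (Nat.cast_nonneg (α := ℝ) b),
    mul_nonneg (Nat.cast_nonneg (α := ℝ) b) (Nat.cast_nonneg (α := ℝ) a)]

/-- A lower bound for the logarithmic factors, which absorbs additive constants in the costs. -/
theorem one_le_two_mul_log_two_div {ε : ℝ} (hε : 0 < ε) (hε1 : ε ≤ 1) :
    1 ≤ 2 * Real.log (2 / ε) := by
  have : Real.log 2 ≤ Real.log (2 / ε) :=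
    Real.log_le_log two_pos (by rw [le_div_iff₀ hε]; linarith)
  linarith [Real.log_two_gt_d9]

/-- The branch `C_k = 1` of the separated state can be extracted. -/
theorem exists_extraction (hn : n ≤ 2 ^ a) {ε : ℝ} (hε : 0 < ε) (hε1 : ε ≤ 1)
    {W : Fin m → Circuit (OReg a b) (Loc a b)} {β β' : Fin m → ℝ → ℝ} {K G : ℝ} (hK : 1 ≤ K)
    (hG : 1 ≤ G) (hW : ∀ j, Separates n (thr j) ε (W j) (β j) (β' j))
    (hq : ∀ j, ((W j).queries : ℝ) ≤ K * (2 ^ ((j : ℕ) + 1) * Real.log (2 / ε)))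
    (hg : ∀ j, ((W j).size : ℝ) ≤ G * (2 ^ ((j : ℕ) + 1) * Real.log (2 / ε)))
    (k : Fin m) {δ s : ℝ} (hδ : 0 < δ) (hδ1 : δ ≤ 1) (hs : 0 < s) (hs1 : s ≤ 1) :
    ∃ V : Circuit (OReg a b) (Option (Reg a b m)),
      (V.queries : ℝ) ≤
        14 * K * (Real.log (2 / ε) * Real.log (2 / δ) * (2 ^ ((k : ℕ) + 1) / √s)) ∧
      (V.size : ℝ) ≤ 250 * G * ((a : ℝ) + b + m + 1) ^ 2 *
          (Real.log (2 / ε) * Real.log (2 / δ) * (2 ^ ((k : ℕ) + 1) / √s)) ∧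
      ∀ (p : Fin n → ℝ) (ψ : Fin n → Ket (Fin b)) (O : Op (OReg a b)), IsOracle p ψ O →
        s ≤ sumB p β β' k →
        ∃ φ' : Ket (Reg a b m), V.op O *ᵥ ket0 (Option (Reg a b m)) = withAncilla φ' ∧
          1 - δ ^ 2 ≤ ‖star φ' ⬝ᵥ phi p O W β β' k‖ ^ 2 := by
  have hQ := one_le_two_mul_log_two_div hε hε1
  have hD := one_le_two_mul_log_two_div hδ hδ1
  have hsq : 0 < √s := Real.sqrt_pos.2 hs
  set Q := Real.log (2 / ε)
  set X := Real.log (2 / δ) / √s with hX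
  have hX1 : 1 ≤ 2 * X := by
    have : Real.log (2 / δ) ≤ X := by
      rw [hX, le_div_iff₀ hsq]
      nlinarith [Real.sqrt_le_one.2 hs1]
    linarith
  have hX0 : 0 ≤ X := by linarith
  have hQ0 : 0 ≤ Q := by linarith
  have hG0 : 0 ≤ G := by linarith
  -- `2 D + 1` exceeds `X` by a bounded amount, which is at most a multiple of `X` as `X ≥ 1 / 2`
  set D := ⌈X / 2⌉₊ with hDdef
  have hDle : X ≤ 2 * D + 1 := by linarith [Nat.le_ceil (X / 2)]
  have hDge : ((2 * D + 1 : ℕ) : ℝ) ≤ 7 * X := by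
    have := (Nat.ceil_lt_add_one (show 0 ≤ X / 2 by linarith)).le
    push_cast
    linarith
  obtain ⟨φ, hφ, hamp⟩ := exists_amplification_phases hδ hδ1 hs hDle
  have htarget : Q * Real.log (2 / δ) * (2 ^ ((k : ℕ) + 1) / √s) = Q * 2 ^ ((k : ℕ) + 1) * X := by
    rw [hX]; ring
  rw [htarget]
  refine ⟨amplifyCircuit (prepCircuit W (k + 1)) (cQubit k) φ hφ (2 * D + 1), ?_, ?_, ?_⟩
  · rw [amplifyCircuit_queries, Nat.cast_mul]
    have h := prepCircuit_queries_le (A := K * Q) (by nlinarith)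
      (fun j => (hq j).trans_eq (by ring)) ((k : ℕ) + 1)
    calc _ ≤ 7 * X * (K * Q * 2 ^ ((k : ℕ) + 1 + 1)) := by gcongr
      _ = _ := by ring
  · have h1 := amplifyCircuit_size_le (prepCircuit W (k + 1)) (cQubit k) φ hφ (2 * D + 1)
    have h := prepCircuit_size_le (A := G * Q) (by nlinarith)
      (fun j => (hg j).trans_eq (by ring)) ((k : ℕ) + 1)
    have hcard := card_reg_le (a := a) (b := b) (m := m)
    have h2 : ((amplifyCircuit (prepCircuit W (k + 1)) (cQubit k) φ hφ (2 * D + 1)).size : ℝ) ≤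
        (2 * D + 1 : ℕ) * ((prepCircuit W (k + 1)).size : ℝ) +
          ((2 * D + 1 : ℕ) + 1) * (2 + 3 * (Fintype.card (Reg a b m) : ℝ)) := by exact_mod_cast h1
    have hN : (1 : ℝ) ≤ ((a : ℝ) + b + m + 1) ^ 2 := one_le_pow₀ (by
      linarith [Nat.cast_nonneg (α := ℝ) a, Nat.cast_nonneg (α := ℝ) b,
        Nat.cast_nonneg (α := ℝ) m])
    have hY : 1 ≤ G * Q * 2 ^ ((k : ℕ) + 1) := by
      have h2 : (1 : ℝ) ≤ 2 ^ (k : ℕ) := one_le_pow₀ one_le_two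
      rw [pow_succ]
      have : 1 ≤ 2 * Q * G := one_le_mul_of_one_le_of_one_le hQ hG
      nlinarith
    set N : ℝ := ((a : ℝ) + b + m + 1) ^ 2
    calc _ ≤ 7 * X * (7 * N * (G * Q) * 2 ^ ((k : ℕ) + 1 + 1)) +
          (7 * X + 2 * X) * (2 * N + 3 * (3 * N)) := by
          refine h2.trans ?_
          gcongr
          linarith
      _ = 98 * N * (G * Q * 2 ^ ((k : ℕ) + 1)) * X + 99 * N * 1 * X := by ring
      _ ≤ 98 * N * (G * Q * 2 ^ ((k : ℕ) + 1)) * X +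
          99 * N * (G * Q * 2 ^ ((k : ℕ) + 1)) * X := by gcongr
      _ ≤ 250 * N * (G * Q * 2 ^ ((k : ℕ) + 1)) * X := by
        have : 0 ≤ N * (G * Q * 2 ^ ((k : ℕ) + 1)) * X := by positivity
        linarith
      _ = _ := by ring
  · intro p ψ O hO hsum
    obtain ⟨γ, hγ1, hγ⟩ := Separates.exists_residual hW hO
    refine ⟨_, amplifyCircuit_op_mulVec hO.unitary _ _ φ hφ _, ?_⟩
    have hPsi : Circuit.op O (prepCircuit W (k + 1)) *ᵥ ket (fun _ => false) = Psi O W k :=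
      prepCircuit_op_mulVec O W (k + 1)
    have hw : goodWeight (Circuit.op O (prepCircuit W (k + 1))) (fun _ => false)
        (fun x => x (cQubit k) = true) = sumB p β β' k := by
      rw [goodWeight, hPsi, sum_norm_sq_restrict_Psi hn hO hγ hγ1]
    have hpos := hs.trans_le hsum
    have hodd : ¬ Even (2 * D + 1) := by simp
    have h := norm_sq_star_signalVec_dotProduct φ hodd (hw.symm ▸ hpos)
    rw [hw, hPsi, ← phi_eq_smul] at h
    rw [h]
    exact hamp _ hsum (hw ▸ goodWeight_le_one (Circuit.op_mem_unitaryGroup hO.unitary _) _ _)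

theorem phi_eq_sum_branchKet {p : Fin n → ℝ} {ψ : Fin n → Ket (Fin b)} {O : Op (OReg a b)}
    (hO : IsOracle p ψ O) {ε : ℝ} {W : Fin m → Circuit (OReg a b) (Loc a b)}
    {β β' : Fin m → ℝ → ℝ} (hW : ∀ j, Separates n (thr j) ε (W j) (β j) (β' j)) (k : Fin m) :
    ∃ g : Fin n → Ket (Fin m × PIReg a b), (∀ i, Normalized (g i)) ∧
      phi p O W β β' k = ∑ i,
        ((√(p i) * coefB β β' k √(p i) / √(sumB p β β' k) : ℝ) : ℂ) •
          branchKet k i (ψ i) (g i) := by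
  obtain ⟨γ, hγ1, hγ⟩ := Separates.exists_residual hW hO
  refine ⟨branchVec γ k, normalized_branchVec hγ1 k, ?_⟩
  rw [phi_eq_smul, restrict_Psi hO hγ k, Finset.smul_sum]
  refine Finset.sum_congr rfl fun i _ => ?_
  rw [smul_smul]
  congr 1
  push_cast
  ring

end Extraction

end QEntropy

theorem theorem4 :
    ∃ (K₀ : ℝ) (d : ℕ), 0 < K₀ ∧ ∀ (n a b m : ℕ), n ≤ 2 ^ a → ∀ ε : ℝ, 0 < ε → ε ≤ 1 →
      -- separation circuits with the required cost exist
      (∃ (W : Fin m → QEntropy.Circuit (QEntropy.OReg a b) (QEntropy.Loc a b))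
          (β β' : Fin m → ℝ → ℝ), ∀ j : Fin m,
          QEntropy.Separates n (QEntropy.thr j) ε (W j) (β j) (β' j) ∧
          ((W j).queries : ℝ) ≤ K₀ * (2 ^ ((j : ℕ) + 1) * Real.log (2 / ε)) ∧
          ((W j).size : ℝ) ≤
            K₀ * ((a : ℝ) + b + 1) ^ d * (2 ^ ((j : ℕ) + 1) * Real.log (2 / ε))) ∧
      -- for all separation circuits, the branch `C_k = 1` can be extracted
      (∀ (W : Fin m → QEntropy.Circuit (QEntropy.OReg a b) (QEntropy.Loc a b))
          (β β' : Fin m → ℝ → ℝ) (K G : ℝ), 1 ≤ K → 1 ≤ G →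
          (∀ j : Fin m,
            QEntropy.Separates n (QEntropy.thr j) ε (W j) (β j) (β' j) ∧
            ((W j).queries : ℝ) ≤ K * (2 ^ ((j : ℕ) + 1) * Real.log (2 / ε)) ∧
            ((W j).size : ℝ) ≤ G * (2 ^ ((j : ℕ) + 1) * Real.log (2 / ε))) →
          ∀ (k : Fin m) (δ s : ℝ), 0 < δ → δ ≤ 1 → 0 < s → s ≤ 1 →
            ∃ V : QEntropy.Circuit (QEntropy.OReg a b) (Option (QEntropy.Reg a b m)),
              (V.queries : ℝ) ≤
                K₀ * K * (Real.log (2 / ε) * Real.log (2 / δ) * (2 ^ ((k : ℕ) + 1) / √s)) ∧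
              (V.size : ℝ) ≤
                K₀ * G * ((a : ℝ) + b + m + 1) ^ d *
                  (Real.log (2 / ε) * Real.log (2 / δ) * (2 ^ ((k : ℕ) + 1) / √s)) ∧
              ∀ (p : Fin n → ℝ) (ψ : Fin n → QEntropy.Ket (Fin b))
                (O : QEntropy.Op (QEntropy.OReg a b)), QEntropy.IsOracle p ψ O →
                s ≤ QEntropy.sumB p β β' k →
                (∃ g : Fin n → QEntropy.Ket (Fin m × QEntropy.PIReg a b),
                  (∀ i, QEntropy.Normalized (g i)) ∧
                  QEntropy.phi p O W β β' k =
                    ∑ i, ((√(p i) * QEntropy.coefB β β' k √(p i) /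
                      √(QEntropy.sumB p β β' k) : ℝ) : ℂ) •
                        QEntropy.branchKet k i (ψ i) (g i)) ∧
                ∃ φ' : QEntropy.Ket (QEntropy.Reg a b m),
                  V.op O *ᵥ QEntropy.ket0 (Option (QEntropy.Reg a b m)) =
                    QEntropy.withAncilla φ' ∧
                  1 - δ ^ 2 ≤ ‖star φ' ⬝ᵥ QEntropy.phi p O W β β' k‖ ^ 2) := by
  refine ⟨4020, 2, by norm_num, fun n a b m hn ε hε hε1 => ⟨?_, ?_⟩⟩
  · choose W β β' hW hq hg using fun j : Fin m =>
      QEntropy.exists_separates (b := b) hn (Nat.le_add_left 1 j) hε hε1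
    refine ⟨W, β, β', fun j => ⟨hW j, (hq j).trans ?_, (hg j).trans ?_⟩⟩
    all_goals
      have hQ := QEntropy.one_le_two_mul_log_two_div hε hε1
      have hnn : 0 ≤ 2 ^ ((j : ℕ) + 1) * Real.log (2 / ε) :=
        mul_nonneg (by positivity) (by linarith)
    · gcongr
      norm_num
    · have h1 : (1 : ℝ) ≤ a + b + 1 := by
        linarith [Nat.cast_nonneg (α := ℝ) a, Nat.cast_nonneg (α := ℝ) b]
      gcongr
      exact le_self_pow₀ h1 two_ne_zero
  · intro W β β' K G hK hG hW k δ s hδ hδ1 hs hs1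
    obtain ⟨V, hVq, hVs, hV⟩ := QEntropy.exists_extraction hn hε hε1 hK hG (fun j => (hW j).1)
      (fun j => (hW j).2.1) (fun j => (hW j).2.2) k hδ hδ1 hs hs1
    have hQ := QEntropy.one_le_two_mul_log_two_div hε hε1
    have hD := QEntropy.one_le_two_mul_log_two_div hδ hδ1
    have hnn : 0 ≤ Real.log (2 / ε) * Real.log (2 / δ) * (2 ^ ((k : ℕ) + 1) / √s) :=
      mul_nonneg (mul_nonneg (by linarith) (by linarith)) (by positivity)
    refine ⟨V, hVq.trans ?_, hVs.trans ?_, fun p ψ O hO hsum =>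
      ⟨QEntropy.phi_eq_sum_branchKet hO (fun j => (hW j).1) k, hV p ψ O hO hsum⟩⟩
    · gcongr
      norm_num
    · gcongr
      norm_num
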